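/- Let $r:\mathbb{R}\to\mathbb{R}_{\ge 0}$ be bounded, measurable and compactly supported with $\|r\|_1=1$. Let $c\in\ell^\infty(\mathbb{Z})$ be real, and let $a\in\ell^\infty(\mathbb{Z})$ be real with $a(n)\ge\delta>0$ for all $n\in\mathbb{Z}$. Let $(d_n)_{n\in\mathbb{Z}}$ satisfy $0<d_n\le 1$ for all $n$, and suppose that $d_n\ge C|n|^{-\zeta}$ for all $n\neq 0$, where $C>0$ and $\zeta<\tfrac12$ are constants. Put $r_n(x)=d_n^{-1}r(d_n^{-1}x)$, $M_n=\sup\{|E|:E\in\operatorname{supp} r_n\}$, $I_n=[c(n)-M_n,c(n)+M_n]$, and let $\Omega=\prod_{n\in\mathbb{Z}}I_n$ carry the product probability measure $d\mu(\omega)=\prod_{n\in\mathbb{Z}}r_n(\omega(n)-c(n))\,d\omega(n)$. For $\omega\in\Omega$ let $J_\omega$ be the bounded Jacobi operator on $\ell^2(\mathbb{Z})$, $$(J_\omega\phi)(n)=a(n)\phi(n+1)+a(n-1)\phi(n-1)+\omega(n)\phi(n),$$ and let $\delta_n$ denote the standard basis vectors of $\ell^2(\mathbb{Z})$. Then there exist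 constants $C'>0$ and $\gamma''>0$ such that for every $m\in\mathbb{Z}$ with $m\neq 0$, the function $\omega\mapsto\sup_{t\in\mathbb{R}}|\langle\delta_m,e^{-itJ_\omega}\delta_0\rangle|$ is $\mu$-integrable and $$\int_\Omega\Big(\sup_{t\in\mathbb{R}}\left|\langle\delta_m,e^{-itJ_\omega}\delta_0\rangle\right|\Big)\,d\mu(\omega)\le C'|m|^{\zeta/2}\exp\left(-\gamma''|m|^{1-2\zeta}\right).$$ -/

import Mathlib

open MeasureTheory
open scoped ENNReal InnerProductSpace

noncomputable section

/-- The complex Hilbert space `ℓ²(ℤ)`. -/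
abbrev EllTwo : Type := lp (fun _ : ℤ => ℂ) 2

/-- The standard basis vector `δ_n` of `ℓ²(ℤ)`. -/
def basisVec (n : ℤ) : EllTwo := lp.single 2 n (1 : ℂ)

/-- A bounded weight times a relabelling of an `ℓ²` sequence is an `ℓ²` sequence, with the
obvious norm bound. -/
theorem exists_weighted_comp (w : ℤ → ℝ) (B : ℝ) (hw : ∀ n, |w n| ≤ B) (e : ℤ ≃ ℤ)
    (φ : EllTwo) :
    ∃ ψ : EllTwo, (∀ n, ψ n = (w n : ℂ) * φ (e n)) ∧ ‖ψ‖ ≤ B * ‖φ‖ := by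
  have hB : 0 ≤ B := (abs_nonneg _).trans (hw 0)
  have h2 : (0 : ℝ) < (2 : ℝ≥0∞).toReal := by norm_num
  have hs : Summable fun n => ‖φ n‖ ^ (2 : ℝ≥0∞).toReal := (memℓp_gen_iff h2).1 (lp.memℓp φ)
  have hse : Summable fun n => ‖φ (e n)‖ ^ (2 : ℝ≥0∞).toReal :=
    (Equiv.summable_iff e (f := fun n => ‖φ n‖ ^ (2 : ℝ≥0∞).toReal)).2 hs
  have hle : ∀ n, ‖(w n : ℂ) * φ (e n)‖ ^ (2 : ℝ≥0∞).toReal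
      ≤ B ^ (2 : ℝ≥0∞).toReal * ‖φ (e n)‖ ^ (2 : ℝ≥0∞).toReal := by
    intro n
    rw [← Real.mul_rpow hB (norm_nonneg _)]
    refine Real.rpow_le_rpow (norm_nonneg _) ?_ h2.le
    rw [norm_mul, Complex.norm_real, Real.norm_eq_abs]
    exact mul_le_mul_of_nonneg_right (hw n) (norm_nonneg _)
  have hsw : Summable fun n => ‖(w n : ℂ) * φ (e n)‖ ^ (2 : ℝ≥0∞).toReal :=
    Summable.of_nonneg_of_le (fun n => Real.rpow_nonneg (norm_nonneg _) _) hle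
      (hse.mul_left _)
  refine ⟨⟨fun n => (w n : ℂ) * φ (e n), memℓp_gen hsw⟩, fun n => rfl, ?_⟩
  refine lp.norm_le_of_tsum_le h2 (mul_nonneg hB (norm_nonneg _)) ?_
  calc ∑' n, ‖(w n : ℂ) * φ (e n)‖ ^ (2 : ℝ≥0∞).toReal
      ≤ ∑' n, B ^ (2 : ℝ≥0∞).toReal * ‖φ (e n)‖ ^ (2 : ℝ≥0∞).toReal :=
        hsw.tsum_le_tsum hle (hse.mul_left _)
    _ = B ^ (2 : ℝ≥0∞).toReal * ∑' n, ‖φ (e n)‖ ^ (2 : ℝ≥0∞).toReal := tsum_mul_left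
    _ = B ^ (2 : ℝ≥0∞).toReal * ∑' n, ‖φ n‖ ^ (2 : ℝ≥0∞).toReal := by
        rw [Equiv.tsum_eq e (fun n => ‖φ n‖ ^ (2 : ℝ≥0∞).toReal)]
    _ = (B * ‖φ‖) ^ (2 : ℝ≥0∞).toReal := by
        rw [Real.mul_rpow hB (norm_nonneg _), lp.norm_rpow_eq_tsum h2]

/-- The Jacobi difference expression
`n ↦ a(n) φ(n+1) + a(n-1) φ(n-1) + b(n) φ(n)`. -/
def jacobiFun (a b : ℤ → ℝ) (φ : ℤ → ℂ) (n : ℤ) : ℂ :=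
  (a n : ℂ) * φ (n + 1) + (a (n - 1) : ℂ) * φ (n - 1) + (b n : ℂ) * φ n

theorem exists_jacobi_image (a b : ℤ → ℝ) (A B : ℝ) (ha : ∀ n, |a n| ≤ A) (hb : ∀ n, |b n| ≤ B)
    (φ : EllTwo) :
    ∃ ψ : EllTwo, (∀ n, ψ n = jacobiFun a b φ n) ∧ ‖ψ‖ ≤ (A + A + B) * ‖φ‖ := by
  obtain ⟨ψ₁, h₁, n₁⟩ := exists_weighted_comp a A ha (Equiv.addRight 1) φ
  obtain ⟨ψ₂, h₂, n₂⟩ :=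
    exists_weighted_comp (fun n => a (n - 1)) A (fun n => ha _) (Equiv.subRight 1) φ
  obtain ⟨ψ₃, h₃, n₃⟩ := exists_weighted_comp b B hb (Equiv.refl ℤ) φ
  refine ⟨ψ₁ + ψ₂ + ψ₃, fun n => ?_, ?_⟩
  · simp only [lp.coeFn_add, Pi.add_apply, h₁, h₂, h₃, jacobiFun, Equiv.coe_addRight,
      Equiv.subRight_apply, Equiv.refl_apply]
  · calc ‖ψ₁ + ψ₂ + ψ₃‖ ≤ ‖ψ₁‖ + ‖ψ₂‖ + ‖ψ₃‖ := norm_add₃_le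
      _ ≤ (A + A + B) * ‖φ‖ := by linarith

theorem memℓp_jacobiFun {a b : ℤ → ℝ} (ha : ∃ A, ∀ n, |a n| ≤ A) (hb : ∃ B, ∀ n, |b n| ≤ B)
    (φ : EllTwo) : Memℓp (jacobiFun a b φ) 2 := by
  obtain ⟨A, hA⟩ := ha
  obtain ⟨B, hB⟩ := hb
  obtain ⟨ψ, h, -⟩ := exists_jacobi_image a b A B hA hB φ
  have : jacobiFun a b φ = ψ := funext fun n => (h n).symm
  rw [this]
  exact lp.memℓp ψ

/-- The bounded Jacobi operator on `ℓ²(ℤ)` with bounded coefficient sequences `a` (off-diagonal)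
and `b` (diagonal). -/
def jacobiOp (a b : ℤ → ℝ) (ha : ∃ A, ∀ n, |a n| ≤ A) (hb : ∃ B, ∀ n, |b n| ≤ B) :
    EllTwo →L[ℂ] EllTwo :=
  LinearMap.mkContinuousOfExistsBound
    { toFun := fun φ => ⟨jacobiFun a b φ, memℓp_jacobiFun ha hb φ⟩
      map_add' := fun φ ψ => by
        refine lp.ext (funext fun n => ?_)
        change jacobiFun a b (⇑(φ + ψ)) n = jacobiFun a b φ n + jacobiFun a b ψ n
        simp only [jacobiFun, lp.coeFn_add, Pi.add_apply]
        ring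
      map_smul' := fun z φ => by
        refine lp.ext (funext fun n => ?_)
        change jacobiFun a b (⇑(z • φ)) n = z * jacobiFun a b φ n
        simp only [jacobiFun, lp.coeFn_smul, Pi.smul_apply, smul_eq_mul]
        ring }
    (by
      obtain ⟨A, hA⟩ := ha
      obtain ⟨B, hB⟩ := hb
      refine ⟨A + A + B, fun φ => ?_⟩
      obtain ⟨ψ, h, hn⟩ := exists_jacobi_image a b A B hA hB φ
      refine le_of_eq_of_le (congrArg norm ?_) hn
      exact lp.ext (funext fun n => (h n).symm))

theorem jacobiOp_apply (a b : ℤ → ℝ) (ha : ∃ A, ∀ n, |a n| ≤ A) (hb : ∃ B, ∀ n, |b n| ≤ B)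
    (φ : EllTwo) (n : ℤ) :
    jacobiOp a b ha hb φ n
      = (a n : ℂ) * φ (n + 1) + (a (n - 1) : ℂ) * φ (n - 1) + (b n : ℂ) * φ n := rfl

/-- The data of a random Jacobi operator: a single-site density `r`, a bounded background
potential `c`, bounded off-diagonal coefficients `a` that are uniformly positive, and a bounded
sequence `d` of positive scaling (damping) parameters. -/
structure RandomJacobi where
  /-- the single-site probability density -/
  r : ℝ → ℝ
  r_nonneg : ∀ x, 0 ≤ r x
  r_measurable : Measurable r
  r_bounded : ∃ B, ∀ x, r x ≤ B
  r_compact : HasCompactSupport r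
  r_integral : ∫ x, r x = 1
  /-- the background potential -/
  c : ℤ → ℝ
  c_bounded : ∃ B, ∀ n, |c n| ≤ B
  /-- the off-diagonal coefficients -/
  a : ℤ → ℝ
  a_bounded : ∃ B, ∀ n, |a n| ≤ B
  a_lower : ∃ δ > 0, ∀ n, δ ≤ a n
  /-- the scaling (damping) parameters -/
  d : ℤ → ℝ
  d_pos : ∀ n, 0 < d n
  d_bounded : ∃ B, ∀ n, |d n| ≤ B

namespace RandomJacobi

variable (S : RandomJacobi)

/-- The rescaled density `r_n(x) = d_n⁻¹ r(d_n⁻¹ x)`. -/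
def density (n : ℤ) (x : ℝ) : ℝ := (S.d n)⁻¹ * S.r ((S.d n)⁻¹ * x)

/-- `M_n = sup {|E| : E ∈ supp r_n}`. -/
def radius (n : ℤ) : ℝ := sSup ((fun E : ℝ => |E|) '' tsupport (S.density n))

/-- `I_n = [c(n) - M_n, c(n) + M_n]`. -/
def siteInterval (n : ℤ) : Set ℝ := Set.Icc (S.c n - S.radius n) (S.c n + S.radius n)

/-- The configuration space `Ω = ∏_{n ∈ ℤ} I_n`, with its product σ-algebra. -/
abbrev Config : Type := (n : ℤ) → S.siteInterval n

/-- The distribution `r_n(x - c(n)) dx` on `I_n`. -/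
def siteMeasure (n : ℤ) : Measure (S.siteInterval n) :=
  (volume.withDensity fun x : ℝ => ENNReal.ofReal (S.density n (x - S.c n))).comap Subtype.val

theorem density_measurable (n : ℤ) : Measurable (S.density n) :=
  (S.r_measurable.comp (measurable_const_mul _)).const_mul _

theorem tsupport_density_subset (n : ℤ) :
    tsupport (S.density n) ⊆ (fun x => S.d n * x) '' tsupport S.r := by
  refine closure_minimal ?_ ((S.r_compact.image (continuous_const_mul _)).isClosed)
  intro x hx
  refine ⟨(S.d n)⁻¹ * x, subset_tsupport _ ?_, ?_⟩
  · exact fun h => hx (by simp [density, h])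
  · exact mul_inv_cancel_left₀ (S.d_pos n).ne' x

theorem abs_le_radius (n : ℤ) {x : ℝ} (hx : S.density n x ≠ 0) : |x| ≤ S.radius n := by
  have hK : IsCompact (tsupport (S.density n)) :=
    (S.r_compact.image (continuous_const_mul (S.d n))).of_isClosed_subset
      (isClosed_tsupport _) (S.tsupport_density_subset n)
  exact le_csSup (hK.image continuous_abs).bddAbove ⟨x, subset_tsupport _ hx, rfl⟩

theorem exists_radius_le : ∃ B, ∀ n, S.radius n ≤ B := by
  obtain ⟨D, hD⟩ := S.d_bounded
  obtain ⟨R, hR⟩ := (IsCompact.image S.r_compact continuous_abs).bddAbove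
  have hD0 : 0 ≤ D := (abs_nonneg _).trans (hD 0)
  refine ⟨D * max R 0, fun n => Real.sSup_le ?_ (mul_nonneg hD0 (le_max_right _ _))⟩
  rintro _ ⟨x, hx, rfl⟩
  obtain ⟨y, hy, rfl⟩ := S.tsupport_density_subset n hx
  change |S.d n * y| ≤ _
  rw [abs_mul]
  exact mul_le_mul (hD n) ((hR ⟨y, hy, rfl⟩).trans (le_max_left _ _)) (abs_nonneg _) hD0

theorem density_integral (n : ℤ) : ∫ x, S.density n x = 1 := by
  simp only [density]
  rw [integral_const_mul, Measure.integral_comp_mul_left, S.r_integral, inv_inv,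
    abs_of_pos (S.d_pos n)]
  simp [(S.d_pos n).ne']

instance isProbabilityMeasure_siteMeasure (n : ℤ) : IsProbabilityMeasure (S.siteMeasure n) := by
  constructor
  have hm : MeasurableSet (S.siteInterval n) := measurableSet_Icc
  have h0 : ∀ x, 0 ≤ S.density n x := fun x =>
    mul_nonneg (inv_nonneg.2 (S.d_pos n).le) (S.r_nonneg _)
  rw [siteMeasure, (MeasurableEmbedding.subtype_coe hm).comap_apply, Set.image_univ,
    Subtype.range_coe, withDensity_apply _ hm]
  have hsub : Function.support (fun x => ENNReal.ofReal (S.density n (x - S.c n)))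
      ⊆ S.siteInterval n := by
    intro x hx
    have h1 : S.density n (x - S.c n) ≠ 0 := fun h => hx (by simp [h])
    have h2 := abs_le.1 (S.abs_le_radius n h1)
    exact ⟨by linarith [h2.1], by linarith [h2.2]⟩
  rw [setLIntegral_eq_of_support_subset hsub]
  have hI : ∫ x, S.density n (x - S.c n) = 1 := by
    rw [integral_sub_right_eq_self (S.density n) (S.c n), S.density_integral]
  have hint : Integrable fun x => S.density n (x - S.c n) := by
    by_contra h
    rw [integral_undef h] at hI
    exact zero_ne_one hI
  rw [← ofReal_integral_eq_lintegral_ofReal hint (Filter.Eventually.of_forall fun x => h0 _), hI,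
    ENNReal.ofReal_one]

/-- The product measure `μ` on `Ω`, that is `dμ(x) = ∏_n r_n(x_n - c(n)) dx_n`. -/
def configMeasure : Measure S.Config := Measure.infinitePi S.siteMeasure

/-- The random potential `b_ω(n) = ω(n)`. -/
def potential (ω : S.Config) (n : ℤ) : ℝ := (ω n : ℝ)

theorem potential_bounded (ω : S.Config) : ∃ B, ∀ n, |S.potential ω n| ≤ B := by
  obtain ⟨B, hB⟩ := S.c_bounded
  obtain ⟨R, hR⟩ := S.exists_radius_le
  refine ⟨B + R, fun n => ?_⟩
  have h := (ω n).2
  have h1 := abs_le.1 (hB n)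
  have h2 := hR n
  exact abs_le.2 ⟨by have := h.1; simp only [potential]; linarith [h1.1],
    by have := h.2; simp only [potential]; linarith [h1.2]⟩

/-- The random Jacobi operator `J_ω`. -/
def operator (ω : S.Config) : EllTwo →L[ℂ] EllTwo :=
  jacobiOp S.a (S.potential ω) S.a_bounded (S.potential_bounded ω)

/-- The unitary propagator `e^{-itJ_ω}`. -/
def propagator (ω : S.Config) (t : ℝ) : EllTwo →L[ℂ] EllTwo :=
  NormedSpace.exp ((-(Complex.I * (t : ℂ))) • S.operator ω)

/-- `sup_{t ∈ ℝ} |⟨δ_m, e^{-itJ_ω} δ_n⟩|`. -/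
def maxAmplitude (m n : ℤ) (ω : S.Config) : ℝ :=
  ⨆ t : ℝ, ‖⟪basisVec m, S.propagator ω t (basisVec n)⟫_ℂ‖

end RandomJacobi

end

noncomputable section

/-! ### L² contraction for averages over translations and the inversion -/

section Contraction

open ProbabilityTheory

/-! This is the Kunz–Souillard method. Truncated to the window from -L to L, the operator is a
finite matrix. Expanding its propagator in eigenvectors bounds the amplitude, uniformly in time, by
the correlator ∑_k |φ_k(p) φ_k(q)|. The truncated amplitudes converge to the true one
(`tendsto_jacobiAmplitude`), and Fatou's lemma carries a bound uniform in L to the limit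
(`integral_maxAmplitude_le`).

To average the correlator over the potential v at site q, exchange v for the energy. With the other
sites fixed, an eigenvector not vanishing at q forces v to be an explicit function of its eigenvalue
E, with derivative 1/φ(q)². The change of variables therefore cancels the normalization and leaves
an integral over E of ρ(v(E)) |u_p/u_q|, where u solves the recursion from the left end of the
window (`lintegral_eigenCorrelator_le`). At fixed E, the ratio is a product of factors α_j/|y_j| in
Riccati variables with y_{j+1} = E - β_{j+1} - α_j²/y_j. Integrating the sites q-1, …, p one after
another then alternates two operations on L²(ℝ): the inversion h ↦ (a/|y|) h(-a²/y), which is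
unitary, and averaging over translations by E - x with x distributed as the potential, which is a
contraction (`lintegral_chainIntegrand_update`).

The decay comes from `lintegral_average_inversion_average_sq_le`: an average, an inversion and a
second average lose a fraction ε d² of the squared norm when the densities are at most B/d.
Otherwise both averages lose very little. By the variance identity their inputs are then almost
invariant under some translation of size at least of order d, and iterating O(1/d) times gives
almost invariance under a translation longer than 2a. A function with that property has less than
half of its mass on [-a, a]. This applies to the output of the first average and to its inversion,
but the inversion exchanges the inside and outside of [-a, a], so the total mass would be too small.

With d_n ≥ C|m|^(-ζ) between 0 and m there are about |m|/2 such pairs, which gives the exponent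
|m|^(1-2ζ). The endpoint densities enter only through their L² norms, and d_m^(-1/2) produces the
factor |m|^(ζ/2). -/

theorem lintegral_lintegral_comp_add (ν : Measure ℝ) [IsProbabilityMeasure ν]
    {F : ℝ → ℝ≥0∞} (hF : Measurable F) :
    ∫⁻ w, ∫⁻ t, F (w + t) ∂ν = ∫⁻ w, F w := by
  rw [lintegral_lintegral_swap (f := fun w t => F (w + t))
    (hF.comp (measurable_fst.add measurable_snd)).aemeasurable]
  simp [lintegral_add_right_eq_self]

/-- The average of `f` over the translations distributed according to `ν`. -/
def translationAverage (ν : Measure ℝ) (f : ℝ → ℝ) (w : ℝ) : ℝ := ∫ t, f (w + t) ∂ν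

theorem measurable_translationAverage (ν : Measure ℝ) [SFinite ν] {f : ℝ → ℝ}
    (hf : Measurable f) : Measurable (translationAverage ν f) := by
  have h : StronglyMeasurable (Function.uncurry fun w t : ℝ => f (w + t)) :=
    (hf.comp (measurable_fst.add measurable_snd)).stronglyMeasurable
  exact h.integral_prod_right.measurable

/-- By Tonelli, integrating ∫ |f(w + t)|² dν(t) over w returns the finite squared norm of f, so the
inner integral is finite for almost every w. -/
theorem ae_memLp_comp_add (ν : Measure ℝ) [IsProbabilityMeasure ν] {f : ℝ → ℝ}
    (hf : Measurable f) (h2 : ∫⁻ x, ‖f x‖ₑ ^ 2 ≠ ∞) :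
    ∀ᵐ w, MemLp (fun t => f (w + t)) 2 ν := by
  have hF : Measurable fun x => ‖f x‖ₑ ^ 2 := hf.enorm.pow_const 2
  rw [← lintegral_lintegral_comp_add ν hF] at h2
  have hm : Measurable fun w => ∫⁻ t, ‖f (w + t)‖ₑ ^ 2 ∂ν :=
    Measurable.lintegral_prod_right' (f := fun p : ℝ × ℝ => ‖f (p.1 + p.2)‖ₑ ^ 2)
      (hF.comp (measurable_fst.add measurable_snd))
  filter_upwards [ae_lt_top hm h2] with w hw
  refine ⟨(hf.comp (measurable_const_add w)).aestronglyMeasurable, ?_⟩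
  rw [eLpNorm_lt_top_iff_lintegral_rpow_enorm_lt_top two_ne_zero ENNReal.ofNat_ne_top]
  simpa using hw

theorem lintegral_enorm_sq_eq_evariance_add {ν : Measure ℝ} [IsProbabilityMeasure ν]
    {X : ℝ → ℝ} (hX : MemLp X 2 ν) :
    ∫⁻ t, ‖X t‖ₑ ^ 2 ∂ν = evariance X ν + ‖∫ t, X t ∂ν‖ₑ ^ 2 := by
  have h1 : ∫⁻ t, ‖X t‖ₑ ^ 2 ∂ν = ENNReal.ofReal (∫ t, X t ^ 2 ∂ν) := by
    rw [ofReal_integral_eq_lintegral_ofReal hX.integrable_sq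
      (Filter.Eventually.of_forall fun _ => sq_nonneg _)]
    refine lintegral_congr fun t => ?_
    rw [← enorm_pow, Real.enorm_of_nonneg (sq_nonneg _)]
  have h2 : ‖∫ t, X t ∂ν‖ₑ ^ 2 = ENNReal.ofReal ((∫ t, X t ∂ν) ^ 2) := by
    rw [← enorm_pow, Real.enorm_of_nonneg (sq_nonneg _)]
  rw [h1, h2, ← ofReal_variance hX, ← ENNReal.ofReal_add (variance_nonneg _ _) (sq_nonneg _),
    variance_eq_sub hX]
  simp

/-- The `L²` variance identity for averages over translations. -/
theorem lintegral_translation_defect (ν : Measure ℝ) [IsProbabilityMeasure ν] {f : ℝ → ℝ}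
    (hf : Measurable f) (h2 : ∫⁻ x, ‖f x‖ₑ ^ 2 ≠ ∞) :
    (∫⁻ t, (∫⁻ w, ‖f (w + t) - translationAverage ν f w‖ₑ ^ 2) ∂ν)
      + ∫⁻ w, ‖translationAverage ν f w‖ₑ ^ 2 = ∫⁻ x, ‖f x‖ₑ ^ 2 := by
  have hg := measurable_translationAverage ν hf
  have hm : Measurable (Function.uncurry fun w t : ℝ =>
      ‖f (w + t) - translationAverage ν f w‖ₑ ^ 2) :=
    (((hf.comp (measurable_fst.add measurable_snd)).sub (hg.comp measurable_fst)).enorm).pow_const 2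
  rw [← lintegral_lintegral_swap (f := fun w t =>
      ‖f (w + t) - translationAverage ν f w‖ₑ ^ 2) hm.aemeasurable,
    ← lintegral_add_right _ (hg.enorm.pow_const 2),
    ← lintegral_lintegral_comp_add ν (hf.enorm.pow_const 2)]
  refine lintegral_congr_ae ?_
  filter_upwards [ae_memLp_comp_add ν hf h2] with w hw
  rw [lintegral_enorm_sq_eq_evariance_add hw]
  rfl

/-- If averaging over translations loses little `L²` mass, then the function is almost invariant
under two translations that are far apart on the scale of the distribution. -/
theorem exists_translations_near_average {ν : Measure ℝ} [IsProbabilityMeasure ν] {Λ : ℝ}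
    (hΛ : 0 < Λ) (hν : ∀ s, MeasurableSet s → ν s ≤ ENNReal.ofReal Λ * volume s) {f : ℝ → ℝ}
    (hf : Measurable f) {η N : ℝ} (hη : 0 < η) (hN : 0 < N)
    (h2 : ∫⁻ x, ‖f x‖ₑ ^ 2 = ENNReal.ofReal (N ^ 2))
    (hg : ENNReal.ofReal ((1 - η) * N ^ 2) ≤ ∫⁻ w, ‖translationAverage ν f w‖ₑ ^ 2) :
    ∃ t t', 1 / (8 * Λ) ≤ t - t' ∧
      ∫⁻ w, ‖f (w + t) - translationAverage ν f w‖ₑ ^ 2 ≤ ENNReal.ofReal (2 * η * N ^ 2) ∧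
      ∫⁻ w, ‖f (w + t') - translationAverage ν f w‖ₑ ^ 2 ≤ ENNReal.ofReal (2 * η * N ^ 2) := by
  set I : ℝ → ℝ≥0∞ := fun t => ∫⁻ w, ‖f (w + t) - translationAverage ν f w‖ₑ ^ 2 with hI
  have hgm := measurable_translationAverage ν hf
  have hIm : Measurable I :=
    Measurable.lintegral_prod_right'
      (f := fun p : ℝ × ℝ => ‖f (p.2 + p.1) - translationAverage ν f p.2‖ₑ ^ 2)
      ((((hf.comp (measurable_snd.add measurable_fst)).sub
        (hgm.comp measurable_snd)).enorm).pow_const 2)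
  have hηN : 0 < η * N ^ 2 := by positivity
  -- The variance identity turns the small loss of mass into a small ν-average of the squared
  -- distance between f(· + t) and its average.
  have hsum : ∫⁻ t, I t ∂ν ≤ ENNReal.ofReal (η * N ^ 2) := by
    have h := lintegral_translation_defect ν hf (by rw [h2]; exact ENNReal.ofReal_ne_top)
    rw [h2] at h
    have hle : (∫⁻ t, I t ∂ν) + ENNReal.ofReal ((1 - η) * N ^ 2) ≤ ENNReal.ofReal (N ^ 2) := by
      rw [← h]; gcongr
    have h3 : ENNReal.ofReal (N ^ 2)
        ≤ ENNReal.ofReal (η * N ^ 2) + ENNReal.ofReal ((1 - η) * N ^ 2) := by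
      refine le_trans (le_of_eq ?_) ENNReal.ofReal_add_le
      congr 1; ring
    exact ENNReal.le_of_add_le_add_right ENNReal.ofReal_ne_top (hle.trans h3)
  set s : Set ℝ := {t | I t < ENNReal.ofReal (2 * η * N ^ 2)} with hs
  have hsm : MeasurableSet s := measurableSet_lt hIm measurable_const
  -- Markov's inequality: translations whose defect is below twice the mean bound have probability
  -- at least 1/2.
  have hs1 : ENNReal.ofReal (1 / 2) ≤ ν s := by
    have hmk := (mul_meas_ge_le_lintegral hIm (ENNReal.ofReal (2 * η * N ^ 2)) (μ := ν)).trans hsum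
    have hc : {t | ENNReal.ofReal (2 * η * N ^ 2) ≤ I t} = sᶜ := by
      ext t; simp [hs]
    rw [hc] at hmk
    have h4 : ν sᶜ ≤ ENNReal.ofReal (1 / 2) := by
      have : ENNReal.ofReal (2 * η * N ^ 2) * ν sᶜ
          ≤ ENNReal.ofReal (2 * η * N ^ 2) * ENNReal.ofReal (1 / 2) := by
        rw [← ENNReal.ofReal_mul (by positivity)]
        refine hmk.trans (le_of_eq ?_)
        congr 1; ring
      exact (ENNReal.mul_le_mul_iff_right (ENNReal.ofReal_pos.2 (by positivity)).ne'
        ENNReal.ofReal_ne_top).1 this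
    have h5 : ν s + ν sᶜ = 1 := prob_add_prob_compl hsm
    have h6 : ENNReal.ofReal (1 / 2) + ENNReal.ofReal (1 / 2) = 1 := by
      rw [← ENNReal.ofReal_add (by norm_num) (by norm_num)]; norm_num
    have h7 : ENNReal.ofReal (1 / 2) + ENNReal.ofReal (1 / 2) ≤ ν s + ENNReal.ofReal (1 / 2) := by
      rw [h6, ← h5]; gcongr
    exact ENNReal.le_of_add_le_add_right ENNReal.ofReal_ne_top h7
  -- If good translations were never 1/(8Λ) apart, all of them would lie in an interval of length
  -- 1/(4Λ), which has probability at most 1/4.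
  by_contra! hcon
  have hdist : ∀ t ∈ s, ∀ t' ∈ s, t - t' < 1 / (8 * Λ) := by
    intro t ht t' ht'
    by_contra! h
    exact absurd (hcon t t' h (le_of_lt ht)) (not_lt.2 (le_of_lt ht'))
  have hne : s.Nonempty := by
    rw [Set.nonempty_iff_ne_empty]
    intro h
    rw [h, measure_empty] at hs1
    simp at hs1
  obtain ⟨t₀, ht₀⟩ := hne
  have hsub : s ⊆ Set.Icc (t₀ - 1 / (8 * Λ)) (t₀ + 1 / (8 * Λ)) := fun t ht =>
    ⟨by linarith [hdist t₀ ht₀ t ht], by linarith [hdist t ht t₀ ht₀]⟩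
  have hb : ν s ≤ ENNReal.ofReal (1 / 4) := by
    refine (hν s hsm).trans ?_
    refine (mul_le_mul_right (measure_mono hsub) _).trans ?_
    rw [Real.volume_Icc, ← ENNReal.ofReal_mul hΛ.le]
    refine ENNReal.ofReal_le_ofReal (le_of_eq ?_)
    field_simp
    ring
  have := (ENNReal.ofReal_le_ofReal_iff (by norm_num)).1 (hs1.trans hb)
  norm_num at this

theorem eLpNorm_two_sq {α : Type*} [MeasurableSpace α] (μ : Measure α) (f : α → ℝ) :
    eLpNorm f 2 μ ^ 2 = ∫⁻ x, ‖f x‖ₑ ^ 2 ∂μ := by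
  have h := eLpNorm_nnreal_pow_eq_lintegral (f := f) (μ := μ) (p := 2) two_ne_zero
  simpa using h

theorem eLpNorm_two_le_ofReal {α : Type*} [MeasurableSpace α] {μ : Measure α} {f : α → ℝ} {c : ℝ}
    (hc : 0 ≤ c) (h : ∫⁻ x, ‖f x‖ₑ ^ 2 ∂μ ≤ ENNReal.ofReal (c ^ 2)) :
    eLpNorm f 2 μ ≤ ENNReal.ofReal c := by
  rw [← eLpNorm_two_sq, ENNReal.ofReal_pow hc] at h
  exact (ENNReal.pow_le_pow_left_iff two_ne_zero).1 h

theorem eLpNorm_comp_add_right {f : ℝ → ℝ} (hf : Measurable f) (h : ℝ) :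
    eLpNorm (fun w => f (w + h)) 2 volume = eLpNorm f 2 volume :=
  eLpNorm_comp_measurePreserving hf.aestronglyMeasurable (measurePreserving_add_right volume h)

theorem eLpNorm_sub_triangle {f g k : ℝ → ℝ} (hf : Measurable f) (hg : Measurable g)
    (hk : Measurable k) (μ : Measure ℝ) :
    eLpNorm (fun w => f w - k w) 2 μ
      ≤ eLpNorm (fun w => f w - g w) 2 μ + eLpNorm (fun w => g w - k w) 2 μ := by
  have h := eLpNorm_add_le (p := 2) (μ := μ) (hf.sub hg).aestronglyMeasurable
    (hg.sub hk).aestronglyMeasurable (by norm_num)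
  refine le_trans (le_of_eq ?_) h
  congr 1
  ext w
  simp

theorem eLpNorm_sub_symm (f g : ℝ → ℝ) (μ : Measure ℝ) :
    eLpNorm (fun w => f w - g w) 2 μ = eLpNorm (fun w => g w - f w) 2 μ :=
  eLpNorm_sub_comm f g 2 μ

theorem eLpNorm_translate_sub_le_nsmul {f : ℝ → ℝ} (hf : Measurable f) (h : ℝ) (j : ℕ) :
    eLpNorm (fun w => f (w + j * h) - f w) 2 volume
      ≤ j * eLpNorm (fun w => f (w + h) - f w) 2 volume := by
  induction j with
  | zero => simp
  | succ j ih =>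
    refine (eLpNorm_sub_triangle (f := fun w => f (w + (j + 1 : ℕ) * h))
      (g := fun w => f (w + j * h)) (hf.comp (measurable_add_const _))
      (hf.comp (measurable_add_const _)) hf _).trans ?_
    have h1 : eLpNorm (fun w => f (w + (j + 1 : ℕ) * h) - f (w + j * h)) 2 volume
        = eLpNorm (fun w => f (w + h) - f w) 2 volume := by
      rw [← eLpNorm_comp_add_right (f := fun w => f (w + h) - f w)
        ((hf.comp (measurable_add_const _)).sub hf) (j * h)]
      congr 1
      ext w
      push_cast
      ring_nf
    rw [h1]
    push_cast
    rw [add_mul, one_mul, add_comm]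
    gcongr

/-- A function that is almost invariant under a translation by more than the length of an
interval carries less than half of its `L²` mass on that interval. -/
theorem setLIntegral_enorm_sq_lt_half {f : ℝ → ℝ} (hf : Measurable f) {N A H : ℝ} (hN : 0 < N)
    (hH : 2 * A < H) (h2 : ∫⁻ x, ‖f x‖ₑ ^ 2 = ENNReal.ofReal (N ^ 2))
    (hinv : eLpNorm (fun w => f (w + H) - f w) 2 volume ≤ ENNReal.ofReal (N / 10)) :
    ∫⁻ x in Set.Icc (-A) A, ‖f x‖ₑ ^ 2 < ENNReal.ofReal (N ^ 2 / 2) := by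
  set I := Set.Icc (-A) A with hI
  have hm : Measurable fun x => ‖f x‖ₑ ^ 2 := hf.enorm.pow_const 2
  have hshift : ∀ h : ℝ, ∫⁻ x in I, ‖f (x + h)‖ₑ ^ 2
      = ∫⁻ x in Set.Icc (-A + h) (A + h), ‖f x‖ₑ ^ 2 := by
    intro h
    rw [hI, ← lintegral_indicator measurableSet_Icc, ← lintegral_indicator measurableSet_Icc,
      ← lintegral_add_right_eq_self ((Set.Icc (-A + h) (A + h)).indicator fun x => ‖f x‖ₑ ^ 2) h]
    refine lintegral_congr fun x => ?_
    by_cases hx : x ∈ Set.Icc (-A) A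
    · have hx' : x + h ∈ Set.Icc (-A + h) (A + h) := ⟨by linarith [hx.1], by linarith [hx.2]⟩
      rw [Set.indicator_of_mem hx, Set.indicator_of_mem hx']
    · have hx' : x + h ∉ Set.Icc (-A + h) (A + h) := fun hc =>
        hx ⟨by linarith [hc.1], by linarith [hc.2]⟩
      rw [Set.indicator_of_notMem hx, Set.indicator_of_notMem hx']
  set μ := volume.restrict I
  set a := eLpNorm f 2 μ with ha
  set b := eLpNorm (fun x => f (x + H)) 2 μ with hb
  set c := eLpNorm (fun x => f (x + -H)) 2 μ with hc
  -- As H exceeds the length of I, the sets I, I + H and I - H are disjoint, so their masses add up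
  -- to at most N².
  have hsum : a ^ 2 + b ^ 2 + c ^ 2 ≤ ENNReal.ofReal (N ^ 2) := by
    rw [ha, hb, hc, eLpNorm_two_sq, eLpNorm_two_sq, eLpNorm_two_sq, hshift, hshift, ← h2,
      ← lintegral_union measurableSet_Icc, ← lintegral_union measurableSet_Icc]
    · exact setLIntegral_le_lintegral _ _
    · rw [Set.disjoint_left]
      rintro x hx hx'
      rcases hx with hx | hx <;> simp only [hI, Set.mem_Icc] at hx hx' <;> linarith [hx.1, hx.2]
    · rw [Set.disjoint_left]
      rintro x hx hx'
      simp only [hI, Set.mem_Icc] at hx hx'; linarith [hx.1, hx.2]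
  have hrest : ∀ g : ℝ → ℝ, eLpNorm g 2 μ ≤ eLpNorm g 2 volume := fun g =>
    eLpNorm_mono_measure _ Measure.restrict_le_self
  have hz : ∀ g k : ℝ → ℝ, Measurable g → Measurable k →
      eLpNorm g 2 μ ≤ eLpNorm k 2 μ + eLpNorm (fun w => g w - k w) 2 volume := by
    intro g k hg hk
    have h := eLpNorm_add_le (p := 2) (μ := μ) hk.aestronglyMeasurable
      (hg.sub hk).aestronglyMeasurable (by norm_num)
    refine le_trans (le_of_eq ?_) (h.trans (by gcongr; exact hrest _))
    congr 1
    ext w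
    simp
  have hab : a ≤ b + ENNReal.ofReal (N / 10) := by
    refine (hz f (fun x => f (x + H)) hf (hf.comp (measurable_add_const _))).trans ?_
    rw [eLpNorm_sub_symm]
    gcongr
  have hac : a ≤ c + ENNReal.ofReal (N / 10) := by
    refine (hz f (fun x => f (x + -H)) hf (hf.comp (measurable_add_const _))).trans ?_
    rw [← eLpNorm_comp_add_right (f := fun w => f w - f (w + -H))
      (hf.sub (hf.comp (measurable_add_const _))) H]
    simp only [add_neg_cancel_right]
    gcongr
  have hfin : ∀ z : ℝ≥0∞, z ^ 2 ≤ a ^ 2 + b ^ 2 + c ^ 2 → z ≠ ∞ := by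
    rintro z hz' rfl
    have := hz'.trans hsum
    simp at this
  have hafin : a ≠ ∞ := hfin a (le_trans le_self_add le_self_add)
  have hbfin : b ≠ ∞ := hfin b (le_trans le_add_self le_self_add)
  have hcfin : c ≠ ∞ := hfin c le_add_self
  lift a to NNReal using hafin with a' ha'
  lift b to NNReal using hbfin with b'
  lift c to NNReal using hcfin with c'
  have e1 : (a' : ℝ) ≤ b' + N / 10 := by
    have := ENNReal.toReal_mono (by finiteness) hab
    rwa [ENNReal.toReal_add (by finiteness) (by finiteness), ENNReal.toReal_ofReal (by positivity)]
      at this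
  have e2 : (a' : ℝ) ≤ c' + N / 10 := by
    have := ENNReal.toReal_mono (by finiteness) hac
    rwa [ENNReal.toReal_add (by finiteness) (by finiteness), ENNReal.toReal_ofReal (by positivity)]
      at this
  have e3 : (a' : ℝ) ^ 2 + b' ^ 2 + c' ^ 2 ≤ N ^ 2 := by
    have := ENNReal.toReal_mono (by finiteness) hsum
    rw [ENNReal.toReal_ofReal (by positivity)] at this
    exact_mod_cast this
  rw [← eLpNorm_two_sq, ← ha]
  have e4 : (a' : ℝ≥0∞) ^ 2 = ENNReal.ofReal ((a' : ℝ) ^ 2) := by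
    rw [ENNReal.ofReal_pow (by positivity), ENNReal.ofReal_coe_nnreal]
  rw [e4, ENNReal.ofReal_lt_ofReal_iff (by positivity)]
  -- If a² ≥ N²/2 then a ≥ 0.7 N and both translates carry norm at least 0.6 N on I; but 0.49 + 0.36
  -- + 0.36 > 1.
  by_contra! hcon
  have h0 : (0 : ℝ) ≤ a' := a'.2
  have h7 : 7 / 10 * N ≤ a' := by nlinarith
  have h8 : 6 / 10 * N ≤ b' := by linarith
  have h9 : 6 / 10 * N ≤ c' := by linarith
  nlinarith

/-- If averaging over a spread-out distribution on scale `d` loses at most a small multiple of `d²`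
of the `L²` mass, then both the function and its average are almost invariant under some
translation of size at least `M`. -/
theorem exists_large_almost_period {ν : Measure ℝ} [IsProbabilityMeasure ν] {B d M : ℝ}
    (hB : 0 < B) (hd : 0 < d) (hd1 : d ≤ 1) (hM : 0 < M)
    (hν : ∀ s, MeasurableSet s → ν s ≤ ENNReal.ofReal (B / d) * volume s) {f : ℝ → ℝ}
    (hf : Measurable f) {N : ℝ} (hN : 0 < N)
    (h2 : ∫⁻ x, ‖f x‖ₑ ^ 2 = ENNReal.ofReal (N ^ 2))
    (hg : ENNReal.ofReal ((1 - 1 / (3200 * (8 * B * M + 3) ^ 2) * d ^ 2) * N ^ 2)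
      ≤ ∫⁻ w, ‖translationAverage ν f w‖ₑ ^ 2) :
    ∃ H, M ≤ H ∧ eLpNorm (fun w => f (w + H) - f w) 2 volume ≤ ENNReal.ofReal (N / 20) ∧
      eLpNorm (fun w => translationAverage ν f (w + H) - translationAverage ν f w) 2 volume
        ≤ ENNReal.ofReal (N / 20) := by
  set Q := 8 * B * M + 3 with hQ
  have hQ3 : 3 ≤ Q := by have : 0 < B * M := by positivity
                         linarith
  have hQ0 : 0 < Q := by linarith
  obtain ⟨t, t', htt, ht, ht'⟩ := exists_translations_near_average (ν := ν) (Λ := B / d)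
    (by positivity) hν hf (η := 1 / (3200 * Q ^ 2) * d ^ 2) (by positivity) hN h2 hg
  set g := translationAverage ν f with hgdef
  have hgm : Measurable g := measurable_translationAverage ν hf
  -- κ² = 2ηN² for the chosen η, so κ bounds the L² distance from the average to either of the two
  -- translates.
  set κ := d * N / (40 * Q) with hκ
  have hκ0 : 0 ≤ κ := by positivity
  have hκ2 : 2 * (1 / (3200 * Q ^ 2) * d ^ 2) * N ^ 2 = κ ^ 2 := by
    rw [hκ]; field_simp; norm_num
  rw [hκ2] at ht ht'
  have et := eLpNorm_two_le_ofReal hκ0 ht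
  have et' := eLpNorm_two_le_ofReal hκ0 ht'
  set h := t - t' with hh
  have hft : ∀ s : ℝ, Measurable fun w => f (w + s) := fun s => hf.comp (measurable_add_const s)
  have hgt : ∀ s : ℝ, Measurable fun w => g (w + s) := fun s => hgm.comp (measurable_add_const s)
  have hstep : eLpNorm (fun w => f (w + h) - f w) 2 volume ≤ ENNReal.ofReal (2 * κ) := by
    rw [← eLpNorm_comp_add_right (f := fun w => f (w + h) - f w) ((hft h).sub hf) t']
    have e : (fun w => f (w + t' + h) - f (w + t')) = fun w => f (w + t) - f (w + t') := by
      ext w; rw [hh]; ring_nf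
    rw [e]
    refine (eLpNorm_sub_triangle (hft t) hgm (hft t') _).trans ?_
    rw [two_mul, ENNReal.ofReal_add hκ0 hκ0, eLpNorm_sub_symm g]
    gcongr
  have hh0 : d / (8 * B) ≤ h := by
    refine le_trans (le_of_eq ?_) htt
    field_simp
  have hhpos : 0 < h := lt_of_lt_of_le (by positivity) hh0
  -- Since h ≥ d/(8B), about 8BM/d steps of length h reach M; the error κ per translate is
  -- proportional to d and compensates this number.
  set j := ⌈M / h⌉₊ with hj
  have hj1 : M ≤ j * h := by
    have := Nat.le_ceil (M / h)
    rwa [div_le_iff₀ hhpos] at this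
  have hj2 : (j : ℝ) * d ≤ 8 * B * M + 1 := by
    have h1 : (j : ℝ) ≤ M / h + 1 := (Nat.ceil_lt_add_one (by positivity)).le
    have h2 : M / h ≤ 8 * B * M / d := by
      rw [div_le_div_iff₀ hhpos hd]
      rw [div_le_iff₀ (by positivity)] at hh0
      nlinarith
    calc (j : ℝ) * d ≤ (8 * B * M / d + 1) * d := by gcongr; linarith
      _ = 8 * B * M + d := by field_simp
      _ ≤ _ := by linarith
  have hiter : eLpNorm (fun w => f (w + j * h) - f w) 2 volume ≤ ENNReal.ofReal (j * (2 * κ)) := by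
    refine (eLpNorm_translate_sub_le_nsmul hf h j).trans ?_
    rw [ENNReal.ofReal_mul (by positivity), ENNReal.ofReal_natCast]
    gcongr
  -- The constant Q is chosen for this: jd + d ≤ 8BM + 2 ≤ Q. The extra 2κ pays for passing from the
  -- average to f and back.
  have hb : (j : ℝ) * (2 * κ) + 2 * κ ≤ N / 20 := by
    have e : (j : ℝ) * (2 * κ) + 2 * κ = (j * d + d) / Q * (N / 20) := by
      rw [hκ]; field_simp; norm_num
    rw [e]
    have : (j * d + d) / Q ≤ 1 := by rw [div_le_one hQ0]; linarith
    nlinarith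
  refine ⟨j * h, hj1, hiter.trans (ENNReal.ofReal_le_ofReal (by linarith)), ?_⟩
  refine le_trans ?_ (ENNReal.ofReal_le_ofReal hb)
  set H := (j : ℝ) * h
  have hA : eLpNorm (fun w => g (w + H) - f (w + (t + H))) 2 volume ≤ ENNReal.ofReal κ := by
    have := eLpNorm_comp_add_right (f := fun w => f (w + t) - g w) ((hft t).sub hgm) H
    rw [eLpNorm_sub_symm]
    refine le_trans (le_of_eq ?_) (this.le.trans et)
    congr 1; ext w; ring_nf
  have hBd : eLpNorm (fun w => f (w + (t + H)) - f (w + t)) 2 volume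
      ≤ ENNReal.ofReal (j * (2 * κ)) := by
    have := eLpNorm_comp_add_right (f := fun w => f (w + H) - f w) ((hft H).sub hf) t
    refine le_trans (le_of_eq ?_) (this.le.trans hiter)
    congr 1; ext w; ring_nf
  refine (eLpNorm_sub_triangle (hgt H) (hft (t + H)) hgm _).trans ?_
  have := eLpNorm_sub_triangle (hft (t + H)) (hft t) hgm volume
  have hsplit : ENNReal.ofReal (j * (2 * κ) + 2 * κ)
      = ENNReal.ofReal κ + (ENNReal.ofReal (j * (2 * κ)) + ENNReal.ofReal κ) := by
    rw [← ENNReal.ofReal_add (by positivity) hκ0, ← ENNReal.ofReal_add hκ0 (by positivity)]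
    congr 1; ring
  rw [hsplit]
  exact add_le_add hA (this.trans (add_le_add hBd et))

/-- The unitary inversion `h ↦ (a / |y|) h(-a² / y)` of `L²(ℝ)`. -/
def inversionOp (a : ℝ) (h : ℝ → ℝ≥0∞) (y : ℝ) : ℝ≥0∞ :=
  ENNReal.ofReal (a / |y|) * h (-a ^ 2 / y)

theorem measurable_inversionOp (a : ℝ) {h : ℝ → ℝ≥0∞} (hh : Measurable h) :
    Measurable (inversionOp a h) := by
  unfold inversionOp
  have : Measurable fun y : ℝ => -a ^ 2 / y := by fun_prop
  have h1 : Measurable fun y : ℝ => ENNReal.ofReal (a / |y|) := by fun_prop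
  exact h1.mul (hh.comp this)

/-- The weight a/|y| is the square root of the Jacobian a²/y² of y ↦ -a²/y, so this is the change of
variables formula. Taken on all of ℝ it makes the inversion unitary. -/
theorem setLIntegral_inversionOp_sq {a : ℝ} (ha : 0 < a) (h : ℝ → ℝ≥0∞) {s : Set ℝ}
    (hs : MeasurableSet s) (hs0 : (0 : ℝ) ∉ s) :
    ∫⁻ y in s, inversionOp a h y ^ 2 = ∫⁻ z in (fun y => -a ^ 2 / y) '' s, h z ^ 2 := by
  have hne : ∀ y ∈ s, y ≠ 0 := fun y hy h0 => hs0 (h0 ▸ hy)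
  rw [lintegral_image_eq_lintegral_abs_deriv_mul (f' := fun y => a ^ 2 / y ^ 2) hs]
  · refine setLIntegral_congr_fun hs fun y hy => ?_
    have hy := hne y hy
    simp only [inversionOp]
    rw [mul_pow, ← ENNReal.ofReal_pow (by positivity), div_pow, sq_abs, abs_of_nonneg]
    positivity
  · intro y hy
    have := (hasDerivAt_inv (hne y hy)).const_mul (-a ^ 2)
    have h2 : -a ^ 2 * -(y ^ 2)⁻¹ = a ^ 2 / y ^ 2 := by field_simp
    rw [h2] at this
    exact this.hasDerivWithinAt
  · intro y hy z hz hyz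
    have hy := hne y hy
    have hz := hne z hz
    have ha2 : a ^ 2 ≠ 0 := by positivity
    simp only at hyz
    field_simp at hyz
    exact neg_inj.1 (by linarith)

theorem lintegral_inversionOp_sq {a : ℝ} (ha : 0 < a) (h : ℝ → ℝ≥0∞) :
    ∫⁻ y, inversionOp a h y ^ 2 = ∫⁻ z, h z ^ 2 := by
  have himg : (fun y => -a ^ 2 / y) '' {(0 : ℝ)}ᶜ = {(0 : ℝ)}ᶜ := by
    ext z
    simp only [Set.mem_image, Set.mem_compl_iff, Set.mem_singleton_iff]
    constructor
    · rintro ⟨y, hy, rfl⟩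
      exact div_ne_zero (neg_ne_zero.2 (by positivity)) hy
    · intro hz
      refine ⟨-a ^ 2 / z, div_ne_zero (neg_ne_zero.2 (by positivity)) hz, ?_⟩
      field_simp
  have hr : volume.restrict ({(0 : ℝ)}ᶜ) = volume := by
    rw [restrict_compl_singleton]
  have := setLIntegral_inversionOp_sq ha h (s := {(0 : ℝ)}ᶜ)
    (measurableSet_singleton _).compl (by simp)
  rwa [himg, hr] at this

/-- The map y ↦ -a²/y sends 0 < |y| ≤ a onto |y| ≥ a. This exchange is what prevents a function and
its inversion from both having little mass on [-a, a]. -/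
theorem setLIntegral_Icc_inversionOp_sq {a : ℝ} (ha : 0 < a) (h : ℝ → ℝ≥0∞) :
    ∫⁻ y in Set.Icc (-a) a, inversionOp a h y ^ 2 = ∫⁻ z in (Set.Ioo (-a) a)ᶜ, h z ^ 2 := by
  have himg : (fun y => -a ^ 2 / y) '' (Set.Icc (-a) a \ {0}) = (Set.Ioo (-a) a)ᶜ := by
    ext z
    simp only [Set.mem_image, Set.mem_sdiff, Set.mem_compl_iff, Set.mem_singleton_iff,
      ← abs_le, Set.mem_Icc, Set.mem_Ioo, ← abs_lt, not_lt]
    constructor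
    · rintro ⟨y, ⟨hy, hy0⟩, rfl⟩
      rw [abs_div, abs_neg, abs_pow, abs_of_pos ha, le_div_iff₀ (abs_pos.2 hy0)]
      nlinarith
    · intro hz
      have hz0 : z ≠ 0 := by rintro rfl; simp at hz; linarith
      refine ⟨-a ^ 2 / z, ⟨?_, div_ne_zero (neg_ne_zero.2 (by positivity)) hz0⟩, ?_⟩
      · rw [abs_div, abs_neg, abs_pow, abs_of_pos ha, div_le_iff₀ (abs_pos.2 hz0)]
        nlinarith
      · field_simp
  have hr : ∫⁻ y in Set.Icc (-a) a, inversionOp a h y ^ 2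
      = ∫⁻ y in Set.Icc (-a) a \ {0}, inversionOp a h y ^ 2 := by
    refine setLIntegral_congr ?_
    exact (sdiff_null_ae_eq_self (by simp)).symm
  rw [hr, setLIntegral_inversionOp_sq ha h (measurableSet_Icc.diff (measurableSet_singleton _))
    (by simp), himg]

theorem lintegral_toReal_enorm_sq {F : ℝ → ℝ≥0∞} (hF : Measurable F) (h2 : ∫⁻ x, F x ^ 2 ≠ ∞)
    (s : Set ℝ) : ∫⁻ x in s, ‖(F x).toReal‖ₑ ^ 2 = ∫⁻ x in s, F x ^ 2 := by
  refine lintegral_congr_ae (ae_restrict_of_ae ?_)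
  filter_upwards [ae_lt_top (hF.pow_const 2) h2] with x hx
  have : F x ≠ ∞ := by
    intro h
    simp [h] at hx
  rw [Real.enorm_of_nonneg ENNReal.toReal_nonneg, ENNReal.ofReal_toReal this]

/-- The kernels take values in `ℝ≥0∞`, while the variance argument is about real functions. Finite
square integral makes F finite almost everywhere, and absolute continuity of ν keeps the null set
invisible to the average. -/
theorem ae_lintegral_comp_add_eq_enorm {ν : Measure ℝ} [IsProbabilityMeasure ν]
    (hν : ν ≪ volume) {F : ℝ → ℝ≥0∞} (hF : Measurable F) (h2 : ∫⁻ x, F x ^ 2 ≠ ∞) :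
    ∀ᵐ w, ∫⁻ t, F (w + t) ∂ν = ‖translationAverage ν (fun x => (F x).toReal) w‖ₑ := by
  have h3 := lintegral_toReal_enorm_sq hF h2 Set.univ
  simp only [Measure.restrict_univ] at h3
  have hfin : ∀ᵐ x, F x ≠ ∞ := by
    filter_upwards [ae_lt_top (hF.pow_const 2) h2] with x hx h
    simp [h] at hx
  filter_upwards [ae_memLp_comp_add ν hF.ennreal_toReal (h3 ▸ h2)] with w hw
  have hw' : ∀ᵐ t ∂ν, F (w + t) ≠ ∞ :=
    hν.ae_le ((measurePreserving_add_left volume w).quasiMeasurePreserving.ae hfin)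
  have hint := hw.integrable (by norm_num)
  rw [translationAverage, Real.enorm_of_nonneg (integral_nonneg fun _ => ENNReal.toReal_nonneg),
    ofReal_integral_eq_lintegral_ofReal hint
      (Filter.Eventually.of_forall fun _ => ENNReal.toReal_nonneg)]
  refine lintegral_congr_ae ?_
  filter_upwards [hw'] with t ht
  rw [ENNReal.ofReal_toReal ht]

/-- Cauchy–Schwarz for the probability measure ν, followed by Tonelli and translation invariance. -/
theorem lintegral_average_sq_le {ν : Measure ℝ} [IsProbabilityMeasure ν]
    {F : ℝ → ℝ≥0∞} (hF : Measurable F) :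
    ∫⁻ w, (∫⁻ t, F (w + t) ∂ν) ^ 2 ≤ ∫⁻ x, F x ^ 2 := by
  rw [← lintegral_lintegral_comp_add ν (hF.pow_const 2)]
  refine lintegral_mono fun w => ?_
  have hm : Measurable fun t => F (w + t) := hF.comp (measurable_const_add w)
  have h := ENNReal.lintegral_mul_le_Lp_mul_Lq ν Real.HolderConjugate.two_two hm.aemeasurable
    (aemeasurable_const (b := (1 : ℝ≥0∞)))
  simp only [Pi.mul_apply, mul_one, ENNReal.one_rpow, lintegral_const, measure_univ] at h
  calc (∫⁻ t, F (w + t) ∂ν) ^ 2 ≤ ((∫⁻ t, F (w + t) ^ (2 : ℝ) ∂ν) ^ (1 / 2 : ℝ)) ^ 2 := by gcongr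
    _ = ∫⁻ t, F (w + t) ^ 2 ∂ν := by
      rw [← ENNReal.rpow_natCast, ← ENNReal.rpow_mul]
      norm_num

theorem measurable_lintegral_comp_add {ν : Measure ℝ} [SFinite ν] {F : ℝ → ℝ≥0∞}
    (hF : Measurable F) : Measurable fun w => ∫⁻ t, F (w + t) ∂ν :=
  Measurable.lintegral_prod_right' (f := fun p : ℝ × ℝ => F (p.1 + p.2))
    (hF.comp (measurable_fst.add measurable_snd))

/-- Two consecutive averages separated by an inversion contract `L²` by `1 - ε d²`, where `d` is the
scale of the averages. -/
theorem lintegral_average_inversion_average_sq_le {ν₁ ν₂ : Measure ℝ} [IsProbabilityMeasure ν₁]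
    [IsProbabilityMeasure ν₂] {B A a d : ℝ} (hB : 0 < B) (ha : 0 < a) (haA : a ≤ A) (hd : 0 < d)
    (hd1 : d ≤ 1) (hν₁ : ∀ s, MeasurableSet s → ν₁ s ≤ ENNReal.ofReal (B / d) * volume s)
    (hν₂ : ∀ s, MeasurableSet s → ν₂ s ≤ ENNReal.ofReal (B / d) * volume s)
    {F : ℝ → ℝ≥0∞} (hF : Measurable F) (h2 : ∫⁻ x, F x ^ 2 ≠ ∞) :
    ∫⁻ w, (∫⁻ t, inversionOp a (fun u => ∫⁻ t', F (u + t') ∂ν₂) (w + t) ∂ν₁) ^ 2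
      ≤ ENNReal.ofReal (1 - 1 / (3200 * (8 * B * (2 * A + 1) + 3) ^ 2) * d ^ 2)
        * ∫⁻ x, F x ^ 2 := by
  have hA : 0 < A := ha.trans_le haA
  set ε := 1 / (3200 * (8 * B * (2 * A + 1) + 3) ^ 2) with hε
  have hε0 : 0 < ε := by positivity
  have hε1 : ε ≤ 1 / 2 := by
    rw [hε, div_le_div_iff₀ (by positivity) (by norm_num)]
    have : (3 : ℝ) ≤ 8 * B * (2 * A + 1) + 3 := by
      have : 0 < B * (2 * A + 1) := by positivity
      linarith
    nlinarith
  have hεd : ε * d ^ 2 ≤ 1 / 2 := by nlinarith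
  have hac : ∀ ν : Measure ℝ, (∀ s, MeasurableSet s → ν s ≤ ENNReal.ofReal (B / d) * volume s) →
      ν ≪ volume := fun ν hν => Measure.AbsolutelyContinuous.mk fun s hs h0 => by
    have := hν s hs
    rw [h0, mul_zero] at this
    exact le_antisymm this bot_le
  set G : ℝ → ℝ≥0∞ := fun u => ∫⁻ t', F (u + t') ∂ν₂ with hG
  have hGm : Measurable G := measurable_lintegral_comp_add hF
  have hVm := measurable_inversionOp a hGm
  by_contra! hcon
  have hle1 := lintegral_average_sq_le (ν := ν₁) hVm
  have hle2 := lintegral_average_sq_le (ν := ν₂) hF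
  rw [lintegral_inversionOp_sq ha] at hle1
  set N := Real.sqrt (∫⁻ x, F x ^ 2).toReal with hNdef
  have hN2 : ∫⁻ x, F x ^ 2 = ENNReal.ofReal (N ^ 2) := by
    rw [hNdef, Real.sq_sqrt ENNReal.toReal_nonneg, ENNReal.ofReal_toReal h2]
  have hGfin : ∫⁻ x, G x ^ 2 ≠ ∞ := ne_top_of_le_ne_top h2 hle2
  set N1 := Real.sqrt (∫⁻ x, G x ^ 2).toReal with hN1def
  have hN12 : ∫⁻ x, G x ^ 2 = ENNReal.ofReal (N1 ^ 2) := by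
    rw [hN1def, Real.sq_sqrt ENNReal.toReal_nonneg, ENNReal.ofReal_toReal hGfin]
  -- The outer average and the inversion do not increase the norm, so the inner average alone loses
  -- less than the fraction ε d².
  have hc1 : ENNReal.ofReal ((1 - ε * d ^ 2) * N ^ 2) < ENNReal.ofReal (N1 ^ 2) := by
    rw [ENNReal.ofReal_mul (by linarith), ← hN2, ← hN12]
    exact hcon.trans_le hle1
  have hN1sq : 0 < N1 ^ 2 := ENNReal.ofReal_pos.1 (bot_le.trans_lt hc1)
  have hN1 : 0 < N1 := lt_of_le_of_ne (Real.sqrt_nonneg _) fun h => by simp [← h] at hN1sq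
  have hN1N : N1 ^ 2 ≤ N ^ 2 := by
    have hGF : ∫⁻ x, G x ^ 2 ≤ ∫⁻ x, F x ^ 2 := hle2
    rw [hN12, hN2] at hGF
    exact (ENNReal.ofReal_le_ofReal_iff (sq_nonneg _)).1 hGF
  have hN : 0 < N := lt_of_le_of_ne (Real.sqrt_nonneg _) fun h => by
    rw [← h] at hN1N; linarith
  have hc1' := (ENNReal.ofReal_lt_ofReal_iff hN1sq).1 hc1
  -- Possible because ε d² ≤ 1/2. It converts the tolerance N/20 of the almost period into the N1/10
  -- required for the mass estimate.
  have hN2N1 : N ≤ 2 * N1 := by nlinarith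
  set f : ℝ → ℝ := fun x => (F x).toReal with hf
  have hfm : Measurable f := hF.ennreal_toReal
  have hf2 : ∫⁻ x, ‖f x‖ₑ ^ 2 = ENNReal.ofReal (N ^ 2) := by
    have := lintegral_toReal_enorm_sq hF h2 Set.univ
    simp only [Measure.restrict_univ] at this
    rw [this, hN2]
  set g := translationAverage ν₂ f with hg
  have hGg : ∀ᵐ w, G w = ‖g w‖ₑ := ae_lintegral_comp_add_eq_enorm (hac _ hν₂) hF h2
  have hg2 : ∫⁻ w, ‖g w‖ₑ ^ 2 = ENNReal.ofReal (N1 ^ 2) := by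
    rw [← hN12]
    refine lintegral_congr_ae ?_
    filter_upwards [hGg] with w hw
    rw [hw]
  -- For the inner average it is the output g that must be almost periodic; for the outer one below
  -- it is the input f'. The choice M = 2A + 1 makes the period exceed 2a.
  obtain ⟨H, hH, -, hHg⟩ := exists_large_almost_period hB hd hd1 (M := 2 * A + 1) (by linarith) hν₂
    hfm hN hf2 (by rw [← hg, hg2]; exact hc1.le)
  have hm1 := setLIntegral_enorm_sq_lt_half (A := a) (measurable_translationAverage ν₂ hfm) hN1
    (H := H) (by linarith) hg2 (hHg.trans (ENNReal.ofReal_le_ofReal (by linarith)))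
  set f' : ℝ → ℝ := fun x => (inversionOp a G x).toReal with hf'
  have hfm' : Measurable f' := hVm.ennreal_toReal
  have hV2 : ∫⁻ x, inversionOp a G x ^ 2 ≠ ∞ := by rwa [lintegral_inversionOp_sq ha]
  have hf2' : ∫⁻ x, ‖f' x‖ₑ ^ 2 = ENNReal.ofReal (N1 ^ 2) := by
    have := lintegral_toReal_enorm_sq hVm hV2 Set.univ
    simp only [Measure.restrict_univ] at this
    rw [this, lintegral_inversionOp_sq ha, hN12]
  have hc2 : ENNReal.ofReal ((1 - ε * d ^ 2) * N1 ^ 2)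
      ≤ ∫⁻ w, ‖translationAverage ν₁ f' w‖ₑ ^ 2 := by
    have e : ∫⁻ w, ‖translationAverage ν₁ f' w‖ₑ ^ 2
        = ∫⁻ w, (∫⁻ t, inversionOp a G (w + t) ∂ν₁) ^ 2 := by
      refine lintegral_congr_ae ?_
      filter_upwards [ae_lintegral_comp_add_eq_enorm (hac _ hν₁) hVm hV2] with w hw
      rw [hw]
    rw [e]
    refine le_trans ?_ hcon.le
    rw [hN2, ← ENNReal.ofReal_mul (by linarith)]
    refine ENNReal.ofReal_le_ofReal ?_
    have : 0 ≤ 1 - ε * d ^ 2 := by linarith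
    gcongr
  obtain ⟨H', hH', hHf', -⟩ := exists_large_almost_period hB hd hd1 (M := 2 * A + 1) (by linarith)
    hν₁ hfm' hN1 hf2' hc2
  have hm2 := setLIntegral_enorm_sq_lt_half (A := a) hfm' hN1
    (H := H') (by linarith) hf2' (hHf'.trans (ENNReal.ofReal_le_ofReal (by linarith)))
  -- The mass of the inverted function on [-a, a] is the mass of G outside (-a, a), so G has less
  -- than half of its mass on either side.
  rw [lintegral_toReal_enorm_sq hVm hV2, setLIntegral_Icc_inversionOp_sq ha] at hm2
  have hm1' : ∫⁻ x in Set.Icc (-a) a, G x ^ 2 < ENNReal.ofReal (N1 ^ 2 / 2) := by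
    refine lt_of_le_of_lt (le_of_eq ?_) hm1
    refine lintegral_congr_ae (ae_restrict_of_ae ?_)
    filter_upwards [hGg] with w hw
    rw [hw]
  have hm3 : ∫⁻ x in Set.Ioo (-a) a, G x ^ 2 ≤ ∫⁻ x in Set.Icc (-a) a, G x ^ 2 :=
    lintegral_mono_set Set.Ioo_subset_Icc_self
  have htot := lintegral_add_compl (μ := volume) (fun x => G x ^ 2)
    (measurableSet_Ioo (a := -a) (b := a))
  have := ENNReal.add_lt_add (hm3.trans_lt hm1') hm2
  rw [htot, hN12, ← ENNReal.ofReal_add (by positivity) (by positivity)] at this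
  simp at this

end Contraction

/-! ### Integrating the potential one site at a time -/

section Resampling

/-- Replacing one coordinate by an independent copy preserves a product probability measure. -/
theorem measurePreserving_update_infinitePi {ι : Type*} [DecidableEq ι] {X : ι → Type*}
    [∀ i, MeasurableSpace (X i)] (μ : ∀ i, Measure (X i)) [∀ i, IsProbabilityMeasure (μ i)] (n : ι) :
    MeasurePreserving (fun p : (∀ i, X i) × X n => Function.update p.1 n p.2)
      ((Measure.infinitePi μ).prod (μ n)) (Measure.infinitePi μ) := by
  have hm : Measurable fun p : (∀ i, X i) × X n => Function.update p.1 n p.2 := by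
    refine measurable_pi_lambda _ fun i => ?_
    by_cases h : i = n
    · subst h
      simpa using measurable_snd
    · simp only [Function.update_of_ne h]
      exact (measurable_pi_apply i).comp measurable_fst
  refine ⟨hm, Measure.eq_infinitePi _ fun s t ht => ?_⟩
  rw [Measure.map_apply hm (MeasurableSet.pi s.countable_toSet fun i _ => ht i)]
  by_cases hn : n ∈ s
  · have e : (fun p : (∀ i, X i) × X n => Function.update p.1 n p.2) ⁻¹' (Set.pi s t)
        = (Set.pi (s.erase n) t) ×ˢ (t n) := by
      ext ⟨x, y⟩
      simp only [Set.mem_preimage, Set.mem_pi, Set.mem_prod, Finset.coe_erase, Set.mem_sdiff,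
        Finset.mem_coe, Set.mem_singleton_iff]
      constructor
      · intro h
        refine ⟨fun i hi => ?_, ?_⟩
        · simpa [Function.update_of_ne hi.2] using h i hi.1
        · simpa using h n hn
      · rintro ⟨h1, h2⟩ i hi
        by_cases hin : i = n
        · subst hin; simpa using h2
        · simpa [Function.update_of_ne hin] using h1 i ⟨hi, hin⟩
    rw [e, Measure.prod_prod, Measure.infinitePi_pi _ fun i _ => ht i,
      Finset.prod_erase_mul _ _ hn]
  · have e : (fun p : (∀ i, X i) × X n => Function.update p.1 n p.2) ⁻¹' (Set.pi s t)
        = (Set.pi s t) ×ˢ Set.univ := by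
      ext ⟨x, y⟩
      simp only [Set.mem_preimage, Set.mem_pi, Set.mem_prod, Finset.mem_coe, Set.mem_univ, and_true]
      refine forall₂_congr fun i hi => ?_
      have : i ≠ n := fun h => hn (h ▸ hi)
      simp [Function.update_of_ne this]
    rw [e, Measure.prod_prod, Measure.infinitePi_pi _ fun i _ => ht i, measure_univ, mul_one]

namespace RandomJacobi

variable (S : RandomJacobi)

instance isProbabilityMeasure_configMeasure : IsProbabilityMeasure S.configMeasure := by
  unfold configMeasure; infer_instance

theorem measurable_potential : Measurable S.potential :=
  measurable_pi_lambda _ fun n => measurable_subtype_coe.comp (measurable_pi_apply n)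

/-- The density of the potential at the site `n`. -/
def siteDensity (n : ℤ) (x : ℝ) : ℝ≥0∞ := ENNReal.ofReal (S.density n (x - S.c n))

theorem measurable_siteDensity (n : ℤ) : Measurable (S.siteDensity n) :=
  ENNReal.measurable_ofReal.comp
    ((S.density_measurable n).comp (measurable_id.sub measurable_const))

theorem siteDensity_eq_zero {n : ℤ} {x : ℝ} (hx : x ∉ S.siteInterval n) :
    S.siteDensity n x = 0 := by
  by_contra h
  have h1 : S.density n (x - S.c n) ≠ 0 := fun h0 => h (by simp [siteDensity, h0])
  have h2 := abs_le.1 (S.abs_le_radius n h1)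
  exact hx ⟨by linarith [h2.1], by linarith [h2.2]⟩

theorem lintegral_siteMeasure (n : ℤ) {G : ℝ → ℝ≥0∞} (hG : Measurable G) :
    ∫⁻ x, G x ∂S.siteMeasure n = ∫⁻ x, S.siteDensity n x * G x := by
  have hm : MeasurableSet (S.siteInterval n) := measurableSet_Icc
  rw [← lintegral_map hG measurable_subtype_coe, siteMeasure,
    (MeasurableEmbedding.subtype_coe hm).map_comap, Subtype.range_coe]
  change ∫⁻ x in S.siteInterval n, G x ∂volume.withDensity (S.siteDensity n) = _
  rw [setLIntegral_withDensity_eq_setLIntegral_mul _ (S.measurable_siteDensity n) hG hm,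
    setLIntegral_eq_of_support_subset]
  · rfl
  · intro x hx
    by_contra hcon
    exact hx (by simp [S.siteDensity_eq_zero hcon])

theorem lintegral_siteDensity (n : ℤ) : ∫⁻ x, S.siteDensity n x = 1 := by
  have h := S.lintegral_siteMeasure n (G := fun _ => 1) measurable_const
  simpa using h.symm

/-- The expectation can be computed by first integrating the potential at the site `n`. -/
theorem lintegral_configMeasure_update (n : ℤ) {F : (ℤ → ℝ) → ℝ≥0∞} (hF : Measurable F) :
    ∫⁻ ω, F (S.potential ω) ∂S.configMeasure
      = ∫⁻ ω, (∫⁻ x, S.siteDensity n x * F (Function.update (S.potential ω) n x))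
          ∂S.configMeasure := by
  have hmp := measurePreserving_update_infinitePi S.siteMeasure n
  have hFm : Measurable fun ω => F (S.potential ω) := hF.comp S.measurable_potential
  unfold configMeasure
  rw [← hmp.lintegral_comp hFm, lintegral_prod
    (fun p => F (S.potential (Function.update p.1 n p.2))) (hFm.comp hmp.measurable).aemeasurable]
  refine lintegral_congr fun ω => ?_
  rw [← S.lintegral_siteMeasure n
    (G := fun x => F (Function.update (S.potential ω) n x)) (hF.comp (measurable_update _))]
  refine lintegral_congr fun x => ?_
  have : S.potential (Function.update ω n x) = Function.update (S.potential ω) n x := by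
    ext i
    by_cases h : i = n
    · subst h; simp [potential]
    · simp [potential, Function.update_of_ne h]
  rw [this]

theorem exists_density_bound : ∃ B > 0, ∀ n x, S.siteDensity n x ≤ ENNReal.ofReal (B / S.d n) := by
  obtain ⟨B, hB⟩ := S.r_bounded
  refine ⟨max B 1, by positivity, fun n x => ENNReal.ofReal_le_ofReal ?_⟩
  rw [density, div_eq_inv_mul]
  have := S.d_pos n
  gcongr
  exact (hB _).trans (le_max_left _ _)

theorem exists_potential_bound : ∃ B, ∀ n, ∀ x ∈ S.siteInterval n, |x| ≤ B := by
  obtain ⟨B, hB⟩ := S.c_bounded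
  obtain ⟨R, hR⟩ := S.exists_radius_le
  refine ⟨B + R, fun n x hx => ?_⟩
  have h1 := abs_le.1 (hB n)
  have h2 := hR n
  exact abs_le.2 ⟨by linarith [hx.1, h1.1], by linarith [hx.2, h1.2]⟩

end RandomJacobi

end Resampling

/-! ### Change of variables for piecewise increasing functions -/

section AreaFormula

/-- The number of points of X below E labels the component of the complement of X containing E, and
on one component a positive derivative makes f strictly increasing. -/
theorem injOn_card_filter_lt_fiber (X : Finset ℝ) {f f' : ℝ → ℝ}
    (hf : ∀ E, E ∉ X → HasDerivAt f (f' E) E) (hf' : ∀ E, E ∉ X → 0 < f' E) (j : ℕ) :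
    Set.InjOn f {E | E ∉ X ∧ (X.filter (· < E)).card = j} := by
  have key : ∀ E ∈ {E | E ∉ X ∧ (X.filter (· < E)).card = j},
      ∀ E' ∈ {E | E ∉ X ∧ (X.filter (· < E)).card = j}, E < E' → f E < f E' := by
    rintro E ⟨hE, hEj⟩ E' ⟨hE', hEj'⟩ hlt
    have hno : ∀ x ∈ Set.Icc E E', x ∉ X := by
      intro x hx hxX
      have h1 : E < x := lt_of_le_of_ne hx.1 fun h => hE (h ▸ hxX)
      have h2 : x < E' := lt_of_le_of_ne hx.2 fun h => hE' (h ▸ hxX)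
      have : (X.filter (· < E)).card < (X.filter (· < E')).card := by
        refine Finset.card_lt_card ⟨fun y hy => ?_, fun h => ?_⟩
        · rw [Finset.mem_filter] at hy ⊢
          exact ⟨hy.1, hy.2.trans hlt⟩
        · have := h (Finset.mem_filter.2 ⟨hxX, h2⟩)
          exact absurd (Finset.mem_filter.1 this).2 (not_lt.2 h1.le)
      omega
    have hmono : StrictMonoOn f (Set.Icc E E') := by
      refine strictMonoOn_of_deriv_pos (convex_Icc E E')
        (fun x hx => (hf x (hno x hx)).continuousAt.continuousWithinAt) fun x hx => ?_
      have hx' := hno x (interior_subset hx)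
      rw [(hf x hx').deriv]
      exact hf' x hx'
    exact hmono ⟨le_rfl, hlt.le⟩ ⟨hlt.le, le_rfl⟩ hlt
  intro E hE E' hE' hEE
  rcases lt_trichotomy E E' with h | h | h
  · exact absurd hEE (key E hE E' hE' h).ne
  · exact h
  · exact absurd hEE (key E' hE' E hE h).ne'

/-- Area formula inequality for a real function that is increasing on each component of the
complement of a finite set. -/
theorem lintegral_sum_fiber_le (X : Finset ℝ) {f f' : ℝ → ℝ}
    (hf : ∀ E, E ∉ X → HasDerivAt f (f' E) E) (hf' : ∀ E, E ∉ X → 0 < f' E)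
    {g : ℝ → ℝ≥0∞} (hg : Measurable g) (S : ℝ → Finset ℝ)
    (hS : ∀ v, ∀ E ∈ S v, E ∉ X ∧ f E = v) :
    ∫⁻ v, ∑ E ∈ S v, g E ≤ ∫⁻ E, ENNReal.ofReal (f' E) * g E := by
  set c : ℝ → ℕ := fun E => (X.filter (· < E)).card with hc
  set P : ℕ → Set ℝ := fun j => {E | E ∉ X ∧ c E = j} with hP
  have hcm : Measurable c := by
    refine Monotone.measurable fun E E' hEE => Finset.card_le_card fun y hy => ?_
    rw [Finset.mem_filter] at hy ⊢
    exact ⟨hy.1, hy.2.trans_le hEE⟩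
  have hPm : ∀ j, MeasurableSet (P j) := fun j =>
    (X.measurableSet.compl).inter (hcm (measurableSet_singleton j))
  have hinj : ∀ j, Set.InjOn f (P j) := fun j => injOn_card_filter_lt_fiber X hf hf' j
  have hcont : ∀ j, ContinuousOn f (P j) := fun j E hE =>
    (hf E hE.1).continuousAt.continuousWithinAt
  have hemb : ∀ j, MeasurableEmbedding ((P j).domRestrict f) := fun j =>
    ContinuousOn.measurableEmbedding (hPm j) (hcont j) (hinj j)
  -- This is g composed with the inverse of f on the j-th component, and zero off the image. A
  -- continuous injection on a Borel set is a measurable embedding, hence measurability.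
  set h : ℕ → ℝ → ℝ≥0∞ := fun j =>
    Function.extend ((P j).domRestrict f) (fun E => g E) fun _ => 0 with hh
  have hhm : ∀ j, Measurable (h j) := fun j =>
    (hemb j).measurable_extend (hg.comp measurable_subtype_coe) measurable_const
  have hhf : ∀ j, ∀ E ∈ P j, h j (f E) = g E := fun j E hE =>
    (hemb j).injective.extend_apply (fun E : P j => g E) (fun _ => 0) ⟨E, hE⟩
  have hh0 : ∀ j, ∀ v, v ∉ f '' P j → h j v = 0 := fun j v hv => by
    refine Function.extend_apply' _ _ _ ?_
    rintro ⟨E, rfl⟩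
    exact hv ⟨E, E.2, rfl⟩
  have hcle : ∀ E, c E ∈ Finset.range (X.card + 1) := fun E =>
    Finset.mem_range.2 (Nat.lt_succ_of_le (Finset.card_filter_le _ _))
  calc ∫⁻ v, ∑ E ∈ S v, g E
      ≤ ∫⁻ v, ∑ j ∈ Finset.range (X.card + 1), h j v := by
        refine lintegral_mono fun v => ?_
        rw [← Finset.sum_fiberwise_of_maps_to (t := Finset.range (X.card + 1)) (g := c)
          fun E _ => hcle E]
        refine Finset.sum_le_sum fun j _ => ?_
        have hsub : ∀ E ∈ (S v).filter (fun E => c E = j), E ∈ P j ∧ f E = v := fun E hE => by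
          rw [Finset.mem_filter] at hE
          exact ⟨⟨(hS v E hE.1).1, hE.2⟩, (hS v E hE.1).2⟩
        rcases ((S v).filter (fun E => c E = j)).eq_empty_or_nonempty with he | ⟨E, hE⟩
        · rw [he]; simp
        -- Each component contains at most one preimage of v, so the j-th partial sum is a single
        -- term.
        · have : (S v).filter (fun E => c E = j) = {E} := by
            refine Finset.eq_singleton_iff_unique_mem.2 ⟨hE, fun E' hE' => ?_⟩
            exact hinj j (hsub E' hE').1 (hsub E hE).1 ((hsub E' hE').2.trans (hsub E hE).2.symm)
          rw [this, Finset.sum_singleton, ← hhf j E (hsub E hE).1, (hsub E hE).2]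
    _ = ∑ j ∈ Finset.range (X.card + 1), ∫⁻ v, h j v :=
        lintegral_finsetSum _ fun j _ => hhm j
    _ = ∑ j ∈ Finset.range (X.card + 1), ∫⁻ E in P j, ENNReal.ofReal (f' E) * g E := by
        refine Finset.sum_congr rfl fun j _ => ?_
        rw [← setLIntegral_eq_of_support_subset (s := f '' P j) fun v hv => by
          by_contra hcon; exact hv (hh0 j v hcon)]
        rw [lintegral_image_eq_lintegral_abs_deriv_mul (hPm j)
          (fun E hE => (hf E hE.1).hasDerivWithinAt) (hinj j)]
        refine setLIntegral_congr_fun (hPm j) fun E hE => ?_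
        rw [hhf j E hE, abs_of_pos (hf' E hE.1)]
    _ = ∫⁻ E in ⋃ j ∈ Finset.range (X.card + 1), P j, ENNReal.ofReal (f' E) * g E := by
        rw [lintegral_biUnion_finset _ fun j _ => hPm j]
        intro i _ j _ hij
        rw [Function.onFun, Set.disjoint_left]
        rintro E hE hE'
        exact hij (hE.2.symm.trans hE'.2)
    _ ≤ _ := setLIntegral_le_lintegral _ _

end AreaFormula

/-! ### Solutions of the Jacobi recursion and their energy derivative -/

section Recursion

/-- The solution of the Jacobi recursion `α (n+1) u (n+2) = (E - β (n+1)) u (n+1) - α n u n` with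
`u 0 = 1` and a Dirichlet condition to the left of `0`. -/
def jacobiSol (α β : ℕ → ℝ) (E : ℝ) : ℕ → ℝ
  | 0 => 1
  | 1 => (E - β 0) / α 0
  | n + 2 => ((E - β (n + 1)) * jacobiSol α β E (n + 1) - α n * jacobiSol α β E n) / α (n + 1)

/-- The exact degree shows that the polynomial is nonzero, so only finitely many energies have to be
excluded. The recursion has two terms, so the induction carries two consecutive indices. -/
theorem exists_polynomial_jacobiSol {α : ℕ → ℝ} (hα : ∀ n, α n ≠ 0) (β : ℕ → ℝ) (n : ℕ) :
    (∃ p : Polynomial ℝ, p.degree = n ∧ ∀ E, p.eval E = jacobiSol α β E n) := by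
  suffices h : (∃ p : Polynomial ℝ, p.degree = n ∧ ∀ E, p.eval E = jacobiSol α β E n) ∧
      (∃ p : Polynomial ℝ, p.degree = (n + 1 : ℕ) ∧ ∀ E, p.eval E = jacobiSol α β E (n + 1)) from
    h.1
  induction n with
  | zero =>
    refine ⟨⟨1, by simp, fun E => by simp [jacobiSol]⟩,
      ⟨Polynomial.C (α 0)⁻¹ * (Polynomial.X - Polynomial.C (β 0)), ?_, fun E => ?_⟩⟩
    · rw [Polynomial.degree_C_mul (inv_ne_zero (hα 0)), Polynomial.degree_X_sub_C]; simp
    · simp [jacobiSol, div_eq_inv_mul]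
  | succ n ih =>
    refine ⟨ih.2, ?_⟩
    obtain ⟨⟨p, hp, hpe⟩, ⟨q, hq, hqe⟩⟩ := ih
    refine ⟨Polynomial.C (α (n + 1))⁻¹ * ((Polynomial.X - Polynomial.C (β (n + 1))) * q
      - Polynomial.C (α n) * p), ?_, fun E => ?_⟩
    · have h1 : ((Polynomial.X - Polynomial.C (β (n + 1))) * q).degree = ((n + 1 + 1 : ℕ) : WithBot ℕ) := by
        rw [Polynomial.degree_mul, Polynomial.degree_X_sub_C, hq]
        push_cast; ring
      rw [Polynomial.degree_C_mul (inv_ne_zero (hα _)), Polynomial.degree_sub_eq_left_of_degree_lt,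
        h1]
      rw [h1, Polynomial.degree_C_mul (hα _), hp]
      exact_mod_cast (by omega : n < n + 1 + 1)
    · simp only [Polynomial.eval_mul, Polynomial.eval_C, Polynomial.eval_sub, Polynomial.eval_X,
        hpe, hqe, jacobiSol, div_eq_inv_mul]

theorem finite_setOf_jacobiSol_eq_zero {α : ℕ → ℝ} (hα : ∀ n, α n ≠ 0) (β : ℕ → ℝ) (n : ℕ) :
    {E | jacobiSol α β E n = 0}.Finite := by
  obtain ⟨p, hp, hpe⟩ := exists_polynomial_jacobiSol hα β n
  have hp0 : p ≠ 0 := by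
    rintro rfl
    simp at hp
  refine (Polynomial.finite_setOfPred_isRoot hp0).subset fun E hE => ?_
  rw [Set.mem_ofPred_eq, Polynomial.IsRoot, hpe]
  exact hE

/-- The energy derivative exists and satisfies the Christoffel--Darboux identity. -/
theorem exists_hasDerivAt_jacobiSol {α : ℕ → ℝ} (hα : ∀ n, α n ≠ 0) (β : ℕ → ℝ) (E : ℝ) :
    ∃ D : ℕ → ℝ, (∀ n, HasDerivAt (fun E => jacobiSol α β E n) (D n) E) ∧
      ∀ n, α n * (D (n + 1) * jacobiSol α β E n - jacobiSol α β E (n + 1) * D n)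
        = ∑ j ∈ Finset.range (n + 1), jacobiSol α β E j ^ 2 := by
  have hdiff : ∀ n, DifferentiableAt ℝ (fun E => jacobiSol α β E n) E := fun n => by
    obtain ⟨p, -, hpe⟩ := exists_polynomial_jacobiSol hα β n
    rw [show (fun E => jacobiSol α β E n) = fun E => p.eval E from funext fun E => (hpe E).symm]
    exact p.differentiableAt
  refine ⟨fun n => deriv (fun E => jacobiSol α β E n) E, fun n => (hdiff n).hasDerivAt, ?_⟩
  set D := fun n => deriv (fun E => jacobiSol α β E n) E with hD
  have hd : ∀ n, HasDerivAt (fun E => jacobiSol α β E n) (D n) E := fun n => (hdiff n).hasDerivAt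
  have h0 : D 0 = 0 := by simp [hD, jacobiSol]
  have h1 : D 1 = 1 / α 0 := by
    have : HasDerivAt (fun E => jacobiSol α β E 1) (1 / α 0) E := by
      simp only [jacobiSol]
      exact ((hasDerivAt_id E).sub_const _).div_const _
    exact (hd 1).unique this
  have hrec : ∀ n, D (n + 2) = (jacobiSol α β E (n + 1) + (E - β (n + 1)) * D (n + 1)
      - α n * D n) / α (n + 1) := by
    intro n
    have : HasDerivAt (fun E => jacobiSol α β E (n + 2)) ((1 * jacobiSol α β E (n + 1)
        + (E - β (n + 1)) * D (n + 1) - α n * D n) / α (n + 1)) E := by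
      simp only [jacobiSol]
      exact ((((hasDerivAt_id E).sub_const _).mul (hd (n + 1))).sub
        ((hd n).const_mul _)).div_const _
    rw [(hd (n + 2)).unique this, one_mul]
  intro n
  induction n with
  | zero => simp [h0, h1, jacobiSol, hα 0]
  | succ n ih =>
    rw [Finset.sum_range_succ, ← ih, hrec]
    simp only [jacobiSol]
    have := hα (n + 1)
    field_simp
    ring

/-- The ratio `α n u n / u (n+1)` for the solution of the Jacobi recursion. -/
def jacobiRatio (α β : ℕ → ℝ) (n : ℕ) (E : ℝ) : ℝ :=
  α n * jacobiSol α β E n / jacobiSol α β E (n + 1)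

/-- The numerator in the quotient rule is minus the Christoffel–Darboux expression. Its sign is what
makes `siteValue` increasing between its poles. -/
theorem hasDerivAt_jacobiRatio {α : ℕ → ℝ} (hα : ∀ n, α n ≠ 0) (β : ℕ → ℝ) (n : ℕ) {E : ℝ}
    (hE : jacobiSol α β E (n + 1) ≠ 0) :
    HasDerivAt (jacobiRatio α β n) (-(∑ j ∈ Finset.range (n + 1), jacobiSol α β E j ^ 2)
      / jacobiSol α β E (n + 1) ^ 2) E := by
  obtain ⟨D, hD, hCD⟩ := exists_hasDerivAt_jacobiSol hα β E
  have h := ((hD n).const_mul (α n)).div (hD (n + 1)) hE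
  rw [← hCD n]
  refine h.congr_deriv ?_
  congr 1
  ring

theorem jacobiSol_congr {α β β' : ℕ → ℝ} (E : ℝ) {n : ℕ} (h : ∀ j < n, β j = β' j) :
    jacobiSol α β E n = jacobiSol α β' E n := by
  induction n using Nat.strong_induction_on with
  | _ n ih =>
    match n with
    | 0 => rfl
    | 1 => simp [jacobiSol, h 0]
    | n + 2 =>
      simp only [jacobiSol]
      rw [h (n + 1) (by omega), ih (n + 1) (by omega) fun j hj => h j (by omega),
        ih n (by omega) fun j hj => h j (by omega)]

/-- The solution of the Jacobi recursion obeys any sequence solving the eigenvalue equation. -/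
theorem eq_jacobiSol_mul {α β : ℕ → ℝ} (hα : ∀ n, α n ≠ 0) {E : ℝ} {q : ℕ} {x : ℕ → ℝ}
    (h0 : 0 < q → α 0 * x 1 + β 0 * x 0 = E * x 0)
    (hs : ∀ n, n + 1 < q → α (n + 1) * x (n + 2) + α n * x n + β (n + 1) * x (n + 1)
      = E * x (n + 1)) {n : ℕ} (hn : n ≤ q) :
    x n = jacobiSol α β E n * x 0 := by
  induction n using Nat.strong_induction_on with
  | _ n ih =>
    match n with
    | 0 => simp [jacobiSol]
    | 1 =>
      have := h0 (by omega)
      have := hα 0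
      simp only [jacobiSol]
      field_simp
      linarith
    | n + 2 =>
      have h1 := hs n (by omega)
      have h2 := ih (n + 1) (by omega) (by omega)
      have h3 := ih n (by omega) (by omega)
      have := hα (n + 1)
      simp only [jacobiSol]
      rw [h2, h3] at h1
      field_simp
      linarith

end Recursion

/-! ### Finite Jacobi matrices: the diagonal entry as a function of the eigenvalue -/

section FiniteJacobi

/-- The finite Jacobi matrix with diagonal `β 0, …, β N` and off-diagonal `α 0, …, α (N-1)`. -/
def jacobiMatrix (N : ℕ) (α β : ℕ → ℝ) : Matrix (Fin (N + 1)) (Fin (N + 1)) ℝ :=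
  Matrix.of fun i j => (if (j : ℕ) = i then β i else 0) + (if (j : ℕ) = i + 1 then α i else 0)
    + (if (i : ℕ) = j + 1 then α j else 0)

theorem jacobiMatrix_isHermitian (N : ℕ) (α β : ℕ → ℝ) : (jacobiMatrix N α β).IsHermitian := by
  refine Matrix.IsHermitian.ext fun i j => ?_
  simp only [jacobiMatrix, Matrix.of_apply, star_trivial]
  by_cases h : (i : ℕ) = j
  · simp [h]
  · have h' : ¬ (j : ℕ) = i := fun e => h e.symm
    simp only [h, h', if_false]
    ring

/-- Extension of a finite vector by zero. -/
def extendZero {N : ℕ} (φ : Fin (N + 1) → ℝ) (n : ℕ) : ℝ :=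
  if h : n < N + 1 then φ ⟨n, h⟩ else 0

theorem extendZero_val {N : ℕ} (φ : Fin (N + 1) → ℝ) (i : Fin (N + 1)) :
    extendZero φ i = φ i := dif_pos i.2

theorem extendZero_of_le {N : ℕ} (φ : Fin (N + 1) → ℝ) {n : ℕ} (h : N + 1 ≤ n) :
    extendZero φ n = 0 := dif_neg (not_lt.2 h)

theorem sum_ite_eq_mul_extendZero {N : ℕ} (φ : Fin (N + 1) → ℝ) (k : ℕ) (c : ℝ) :
    ∑ j : Fin (N + 1), (if (j : ℕ) = k then c else 0) * φ j = c * extendZero φ k := by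
  by_cases h : k < N + 1
  · rw [Finset.sum_eq_single ⟨k, h⟩]
    · simp [extendZero, h]
    · intro j _ hj
      rw [if_neg (fun e => hj (Fin.ext e)), zero_mul]
    · simp
  · rw [extendZero_of_le φ (not_lt.1 h), mul_zero]
    refine Finset.sum_eq_zero fun j _ => ?_
    rw [if_neg (fun e : (j : ℕ) = k => h (e ▸ j.2)), zero_mul]

theorem jacobiMatrix_mulVec_zero (N : ℕ) (α β : ℕ → ℝ) (φ : Fin (N + 1) → ℝ) :
    (jacobiMatrix N α β).mulVec φ 0 = α 0 * extendZero φ 1 + β 0 * extendZero φ 0 := by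
  simp only [Matrix.mulVec, dotProduct, jacobiMatrix, Matrix.of_apply, add_mul,
    Finset.sum_add_distrib, sum_ite_eq_mul_extendZero]
  simp
  ring

theorem jacobiMatrix_mulVec_succ (N : ℕ) (α β : ℕ → ℝ) (φ : Fin (N + 1) → ℝ) (n : ℕ)
    (hn : n + 1 < N + 1) :
    (jacobiMatrix N α β).mulVec φ ⟨n + 1, hn⟩ = α (n + 1) * extendZero φ (n + 2)
      + α n * extendZero φ n + β (n + 1) * extendZero φ (n + 1) := by
  have h : ∀ j : Fin (N + 1), (if n + 1 = (j : ℕ) + 1 then α j else 0)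
      = if (j : ℕ) = n then α n else 0 := fun j => by
    by_cases hj : (j : ℕ) = n
    · simp [hj]
    · rw [if_neg hj, if_neg (by omega)]
  simp only [Matrix.mulVec, dotProduct, jacobiMatrix, Matrix.of_apply, add_mul,
    Finset.sum_add_distrib, sum_ite_eq_mul_extendZero, h]
  ring

theorem abs_jacobiMatrix_mulVec_le {N : ℕ} {α β : ℕ → ℝ} {A B C : ℝ} (hα : ∀ n, |α n| ≤ A)
    (hβ : ∀ n, |β n| ≤ B) {φ : Fin (N + 1) → ℝ} (hφ : ∀ i, |φ i| ≤ C) (i : Fin (N + 1)) :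
    |(jacobiMatrix N α β).mulVec φ i| ≤ (A + A + B) * C := by
  have hC : 0 ≤ C := (abs_nonneg _).trans (hφ 0)
  have hA : 0 ≤ A := (abs_nonneg _).trans (hα 0)
  have hmax : ∀ n, |extendZero φ n| ≤ C := fun n => by
    unfold extendZero
    split_ifs with h
    · exact hφ _
    · simpa
  have hmul : ∀ (x y : ℝ) (n : ℕ), |x| ≤ y → |x * extendZero φ n| ≤ y * C := fun x y n h => by
    rw [abs_mul]
    exact mul_le_mul h (hmax n) (abs_nonneg _) ((abs_nonneg _).trans h)
  obtain ⟨n, hn⟩ := i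
  cases n with
  | zero =>
    have e : (⟨0, hn⟩ : Fin (N + 1)) = 0 := rfl
    rw [e, jacobiMatrix_mulVec_zero]
    refine (abs_add_le _ _).trans ?_
    have h1 := hmul _ _ 1 (hα 0)
    have h2 := hmul _ _ 0 (hβ 0)
    nlinarith
  | succ n =>
    rw [jacobiMatrix_mulVec_succ]
    refine (abs_add_three _ _ _).trans ?_
    have h1 := hmul _ _ (n + 2) (hα (n + 1))
    have h2 := hmul _ _ n (hα n)
    have h3 := hmul _ _ (n + 1) (hβ (n + 1))
    linarith

theorem sum_sq_eq_sum_range_extendZero {N : ℕ} (φ : Fin (N + 1) → ℝ) :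
    ∑ i, φ i ^ 2 = ∑ n ∈ Finset.range (N + 1), extendZero φ n ^ 2 := by
  rw [← Fin.sum_univ_eq_sum_range (fun n => extendZero φ n ^ 2)]
  simp [extendZero_val]

/-- The value of the diagonal entry at site `q' + 1` for which `E` is an eigenvalue of the Jacobi
matrix on `0, …, q' + r' + 2`. -/
def siteValue (α β : ℕ → ℝ) (q' r' : ℕ) (E : ℝ) : ℝ :=
  E - jacobiRatio α β q' E
    - jacobiRatio (fun i => α (q' + r' + 1 - i)) (fun i => β (q' + r' + 2 - i)) r' E

/-- The energy derivative of `siteValue`. -/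
def siteValueDeriv (α β : ℕ → ℝ) (q' r' : ℕ) (E : ℝ) : ℝ :=
  1 + (∑ j ∈ Finset.range (q' + 1), jacobiSol α β E j ^ 2) / jacobiSol α β E (q' + 1) ^ 2
    + (∑ j ∈ Finset.range (r' + 1), jacobiSol (fun i => α (q' + r' + 1 - i))
        (fun i => β (q' + r' + 2 - i)) E j ^ 2)
      / jacobiSol (fun i => α (q' + r' + 1 - i)) (fun i => β (q' + r' + 2 - i)) E (r' + 1) ^ 2

theorem one_le_siteValueDeriv (α β : ℕ → ℝ) (q' r' : ℕ) (E : ℝ) :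
    1 ≤ siteValueDeriv α β q' r' E := by
  unfold siteValueDeriv
  have h1 : 0 ≤ (∑ j ∈ Finset.range (q' + 1), jacobiSol α β E j ^ 2)
    / jacobiSol α β E (q' + 1) ^ 2 := by positivity
  have h2 : 0 ≤ (∑ j ∈ Finset.range (r' + 1), jacobiSol (fun i => α (q' + r' + 1 - i))
        (fun i => β (q' + r' + 2 - i)) E j ^ 2)
      / jacobiSol (fun i => α (q' + r' + 1 - i)) (fun i => β (q' + r' + 2 - i)) E (r' + 1) ^ 2 := by
    positivity
  linarith

theorem hasDerivAt_siteValue {α : ℕ → ℝ} (hα : ∀ n, α n ≠ 0) (β : ℕ → ℝ) (q' r' : ℕ) {E : ℝ}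
    (hL : jacobiSol α β E (q' + 1) ≠ 0)
    (hR : jacobiSol (fun i => α (q' + r' + 1 - i)) (fun i => β (q' + r' + 2 - i)) E (r' + 1) ≠ 0) :
    HasDerivAt (siteValue α β q' r') (siteValueDeriv α β q' r' E) E := by
  have h := ((hasDerivAt_id E).sub (hasDerivAt_jacobiRatio hα β q' hL)).sub
    (hasDerivAt_jacobiRatio (fun n => hα _) _ r' hR)
  refine h.congr_deriv ?_
  unfold siteValueDeriv
  ring

/-- A normalized eigenvector that does not vanish at the site `q' + 1` is determined there by the
eigenvalue. -/
theorem jacobi_eigenvector_at_site {α : ℕ → ℝ} (hα : ∀ n, α n ≠ 0) (β : ℕ → ℝ) (q' r' : ℕ)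
    {E v : ℝ} {φ : Fin (q' + r' + 2 + 1) → ℝ}
    (hφ : (jacobiMatrix (q' + r' + 2) α (Function.update β (q' + 1) v)).mulVec φ = E • φ)
    (h1 : ∑ i, φ i ^ 2 = 1) (hq : extendZero φ (q' + 1) ≠ 0) :
    jacobiSol α β E (q' + 1) ≠ 0 ∧
    jacobiSol (fun i => α (q' + r' + 1 - i)) (fun i => β (q' + r' + 2 - i)) E (r' + 1) ≠ 0 ∧
    siteValue α β q' r' E = v ∧
    extendZero φ (q' + 1) ^ 2 * siteValueDeriv α β q' r' E = 1 ∧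
    (∀ p ≤ q' + 1, extendZero φ p
      = jacobiSol α β E p / jacobiSol α β E (q' + 1) * extendZero φ (q' + 1)) ∧
    (∀ p ≤ r' + 1, extendZero φ (q' + r' + 2 - p)
      = jacobiSol (fun i => α (q' + r' + 1 - i)) (fun i => β (q' + r' + 2 - i)) E p
        / jacobiSol (fun i => α (q' + r' + 1 - i)) (fun i => β (q' + r' + 2 - i)) E (r' + 1)
        * extendZero φ (q' + 1)) := by
  set b := Function.update β (q' + 1) v with hb
  -- Reading the matrix from its right end lets the same recursion treat the sites to the right of
  -- q' + 1.
  set αR : ℕ → ℝ := fun i => α (q' + r' + 1 - i) with hαR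
  set βR : ℕ → ℝ := fun i => β ((q' + r' + 2) - i) with hβR
  set x := extendZero φ with hx
  have hEx : ∀ n (h : n < (q' + r' + 2) + 1), E * x n = (E • φ) ⟨n, h⟩ := fun n h => by
    simp [hx, extendZero, h]
  have e0 : α 0 * x 1 + b 0 * x 0 = E * x 0 := by
    rw [← jacobiMatrix_mulVec_zero, hφ, hEx 0 (by omega)]; rfl
  have es : ∀ n, n + 1 < (q' + r' + 2) + 1 → α (n + 1) * x (n + 2) + α n * x n + b (n + 1) * x (n + 1)
      = E * x (n + 1) := fun n hn => by
    rw [← jacobiMatrix_mulVec_succ (q' + r' + 2) α b φ n hn, hφ, hEx]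
  have eN : x ((q' + r' + 2) + 1) = 0 := extendZero_of_le φ le_rfl
  have hbne : ∀ j, j ≠ q' + 1 → b j = β j := fun j hj => Function.update_of_ne hj _ _
  have hbq : b (q' + 1) = v := Function.update_self _ _ _
  -- Rows 0, …, q' do not contain the diagonal entry v, so they determine the entries up to q' + 1
  -- from the one at 0.
  have hleft : ∀ p ≤ q' + 1, x p = jacobiSol α β E p * x 0 := fun p hp => by
    refine eq_jacobiSol_mul hα (q := q' + 1) (fun _ => ?_) (fun n hn => ?_) hp
    · rw [← hbne 0 (by omega)]; exact e0
    · rw [← hbne (n + 1) (by omega)]; exact es n (by omega)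
  have hright : ∀ p ≤ r' + 1, x ((q' + r' + 2) - p) = jacobiSol αR βR E p * x (q' + r' + 2) := fun p hp => by
    refine eq_jacobiSol_mul (x := fun p => x ((q' + r' + 2) - p)) (fun n => hα _) (q := r' + 1) (fun _ => ?_)
      (fun n hn => ?_) hp
    · have := es (q' + r' + 1) (by omega)
      -- The zero extension supplies the Dirichlet condition beyond the last row.
      rw [show q' + r' + 1 + 2 = (q' + r' + 2) + 1 by omega, eN, hbne _ (by omega)] at this
      simp only [hβR, Nat.sub_zero] at this ⊢
      rw [show q' + r' + 2 - 1 = q' + r' + 1 by omega]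
      linarith
    · obtain ⟨m, hm⟩ : ∃ m, q' + r' = m + n := ⟨q' + r' - n, by omega⟩
      have := es m (by omega)
      rw [hbne _ (by omega)] at this
      simp only [hβR]
      rw [show q' + r' + 1 - (n + 1) = m by omega, show q' + r' + 2 - (n + 2) = m by omega,
        show q' + r' + 1 - n = m + 1 by omega, show q' + r' + 2 - n = m + 2 by omega,
        show q' + r' + 2 - (n + 1) = m + 1 by omega]
      linarith
  have hql := hleft (q' + 1) le_rfl
  have hqr := hright (r' + 1) le_rfl
  rw [show (q' + r' + 2) - (r' + 1) = q' + 1 by omega] at hqr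
  have hL : jacobiSol α β E (q' + 1) ≠ 0 := fun h => hq (by rw [hql, h, zero_mul])
  have hR : jacobiSol αR βR E (r' + 1) ≠ 0 := fun h => hq (by rw [hqr, h, zero_mul])
  have hleft' : ∀ p ≤ q' + 1, x p
      = jacobiSol α β E p / jacobiSol α β E (q' + 1) * x (q' + 1) := fun p hp => by
    rw [hleft p hp, hql]; field_simp
  have hright' : ∀ p ≤ r' + 1, x ((q' + r' + 2) - p)
      = jacobiSol αR βR E p / jacobiSol αR βR E (r' + 1) * x (q' + 1) := fun p hp => by
    rw [hright p hp, hqr]; field_simp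
  refine ⟨hL, hR, ?_, ?_, hleft', hright'⟩
  -- Row q' + 1, divided by the nonzero entry there, expresses v through the left and right ratios.
  · have e := es q' (by omega)
    rw [hbq, hleft' q' (by omega), show q' + 2 = (q' + r' + 2) - r' by omega, hright' r' (by omega)] at e
    have hαq : αR r' = α (q' + 1) := by simp only [hαR]; congr 1; omega
    have e' : (α (q' + 1) * (jacobiSol αR βR E r' / jacobiSol αR βR E (r' + 1))
        + α q' * (jacobiSol α β E q' / jacobiSol α β E (q' + 1)) + v) * x (q' + 1)
        = E * x (q' + 1) := by linarith
    have e'' := mul_right_cancel₀ hq e'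
    simp only [siteValue, jacobiRatio]
    change E - _ - αR r' * jacobiSol αR βR E r' / jacobiSol αR βR E (r' + 1) = v
    rw [hαq, mul_div_assoc, mul_div_assoc]
    linarith
  -- Splitting the normalization at q' + 1 and factoring out the square of that entry leaves exactly
  -- the derivative of `siteValue`.
  · have hsplit : ∑ n ∈ Finset.range ((q' + r' + 2) + 1), x n ^ 2
        = ∑ j ∈ Finset.range (q' + 1), x j ^ 2 + x (q' + 1) ^ 2
          + ∑ j ∈ Finset.range (r' + 1), x ((q' + r' + 2) - j) ^ 2 := by
      rw [show q' + r' + 2 + 1 = (q' + 2) + (r' + 1) by omega, Finset.sum_range_add,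
        Finset.sum_range_succ, ← Finset.sum_range_reflect _ (r' + 1)]
      congr 1
      refine Finset.sum_congr rfl fun j hj => ?_
      rw [Finset.mem_range] at hj
      congr 2
      omega
    rw [sum_sq_eq_sum_range_extendZero] at h1
    change ∑ n ∈ Finset.range ((q' + r' + 2) + 1), x n ^ 2 = 1 at h1
    rw [hsplit] at h1
    rw [← h1, siteValueDeriv, mul_add, mul_add, mul_one, Finset.sum_div, Finset.sum_div,
      Finset.mul_sum, Finset.mul_sum, add_comm (x (q' + 1) ^ 2)]
    congr 1
    · congr 1
      refine Finset.sum_congr rfl fun j hj => ?_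
      rw [hleft' j (Finset.mem_range.1 hj).le]; ring
    · refine Finset.sum_congr rfl fun j hj => ?_
      rw [hright' j (Finset.mem_range.1 hj).le]; ring

end FiniteJacobi

/-! ### Spectral averaging of the eigenfunction correlator -/

section SpectralAveraging

theorem measurable_jacobiSol {Ω : Type*} [MeasurableSpace Ω] (α : ℕ → ℝ) {β : Ω → ℕ → ℝ}
    (hβ : ∀ n, Measurable fun ω => β ω n) {e : Ω → ℝ} (he : Measurable e) (n : ℕ) :
    Measurable fun ω => jacobiSol α (β ω) (e ω) n := by
  induction n using Nat.strong_induction_on with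
  | _ n ih =>
    match n with
    | 0 => exact measurable_const
    | 1 =>
      simp only [jacobiSol]
      exact (he.sub (hβ 0)).div_const _
    | n + 2 =>
      simp only [jacobiSol]
      exact (((he.sub (hβ _)).mul (ih (n + 1) (by omega))).sub
        ((ih n (by omega)).const_mul _)).div_const _

theorem measurable_jacobiRatio {Ω : Type*} [MeasurableSpace Ω] (α : ℕ → ℝ) {β : Ω → ℕ → ℝ}
    (hβ : ∀ n, Measurable fun ω => β ω n) {e : Ω → ℝ} (he : Measurable e) (n : ℕ) :
    Measurable fun ω => jacobiRatio α (β ω) n (e ω) :=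
  ((measurable_jacobiSol α hβ he n).const_mul _).div (measurable_jacobiSol α hβ he (n + 1))

theorem measurable_siteValue {Ω : Type*} [MeasurableSpace Ω] (α : ℕ → ℝ) {β : Ω → ℕ → ℝ}
    (hβ : ∀ n, Measurable fun ω => β ω n) {e : Ω → ℝ} (he : Measurable e) (q' r' : ℕ) :
    Measurable fun ω => siteValue α (β ω) q' r' (e ω) :=
  (he.sub (measurable_jacobiRatio α hβ he q')).sub
    (measurable_jacobiRatio _ (β := fun ω i => β ω (q' + r' + 2 - i)) (fun _ => hβ _) he r')

/-- The normalized real eigenvectors of a finite Jacobi matrix. -/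
def jacobiEigenvector (N : ℕ) (α β : ℕ → ℝ) (k i : Fin (N + 1)) : ℝ :=
  (jacobiMatrix_isHermitian N α β).eigenvectorBasis k i

/-- The eigenvalues of a finite Jacobi matrix. -/
def jacobiEigenvalue (N : ℕ) (α β : ℕ → ℝ) (k : Fin (N + 1)) : ℝ :=
  (jacobiMatrix_isHermitian N α β).eigenvalues k

theorem jacobiMatrix_mulVec_eigenvector (N : ℕ) (α β : ℕ → ℝ) (k : Fin (N + 1)) :
    (jacobiMatrix N α β).mulVec (jacobiEigenvector N α β k)
      = jacobiEigenvalue N α β k • jacobiEigenvector N α β k :=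
  (jacobiMatrix_isHermitian N α β).mulVec_eigenvectorBasis k

theorem sum_jacobiEigenvector_mul (N : ℕ) (α β : ℕ → ℝ) (k l : Fin (N + 1)) :
    ∑ i, jacobiEigenvector N α β k i * jacobiEigenvector N α β l i = if k = l then 1 else 0 := by
  have h := orthonormal_iff_ite.1 (jacobiMatrix_isHermitian N α β).eigenvectorBasis.orthonormal l k
  rw [PiLp.inner_apply] at h
  simp only [RCLike.inner_apply, conj_trivial] at h
  simp only [jacobiEigenvector]
  rw [h]
  simp [eq_comm]

theorem sum_jacobiEigenvector_mul' (N : ℕ) (α β : ℕ → ℝ) (i j : Fin (N + 1)) :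
    ∑ k, jacobiEigenvector N α β k i * jacobiEigenvector N α β k j = if i = j then 1 else 0 := by
  set U : Matrix (Fin (N + 1)) (Fin (N + 1)) ℝ := Matrix.of (jacobiEigenvector N α β)
  have h : U * U.transpose = 1 := by
    ext k l
    rw [Matrix.mul_apply, Matrix.one_apply, ← sum_jacobiEigenvector_mul N α β k l]
    rfl
  have hc : U.transpose * U = 1 := mul_eq_one_comm.1 h
  have h' : (U.transpose * U) i j = (1 : Matrix (Fin (N + 1)) (Fin (N + 1)) ℝ) i j := by rw [hc]
  rw [Matrix.mul_apply, Matrix.one_apply] at h'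
  exact h'

/-- The eigenfunction correlator of a finite Jacobi matrix. -/
def eigenCorrelator (N : ℕ) (α β : ℕ → ℝ) (p q : Fin (N + 1)) : ℝ :=
  ∑ k, |jacobiEigenvector N α β k p * jacobiEigenvector N α β k q|

/-- Spectral averaging of the eigenfunction correlator over the potential at one site. -/
theorem lintegral_eigenCorrelator_le {α : ℕ → ℝ} (hα : ∀ n, α n ≠ 0) (β : ℕ → ℝ) (q' r' p : ℕ)
    (hp : p ≤ q' + 1) {ρ : ℝ → ℝ≥0∞} (hρ : Measurable ρ) {K : ℝ}
    (hK : ∀ v, ρ v ≠ 0 → ∀ k,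
      |jacobiEigenvalue (q' + r' + 2) α (Function.update β (q' + 1) v) k| ≤ K) :
    ∫⁻ v, ρ v * ENNReal.ofReal (eigenCorrelator (q' + r' + 2) α (Function.update β (q' + 1) v)
        ⟨p, by omega⟩ ⟨q' + 1, by omega⟩)
      ≤ ∫⁻ E in Set.Icc (-K) K, ρ (siteValue α β q' r' E)
          * ENNReal.ofReal |jacobiSol α β E p / jacobiSol α β E (q' + 1)| := by
  classical
  set αR : ℕ → ℝ := fun i => α (q' + r' + 1 - i) with hαR
  set βR : ℕ → ℝ := fun i => β (q' + r' + 2 - i) with hβR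
  have hfinL := finite_setOf_jacobiSol_eq_zero hα β (q' + 1)
  have hfinR := finite_setOf_jacobiSol_eq_zero (α := αR) (fun n => hα _) βR (r' + 1)
  set X : Finset ℝ := hfinL.toFinset ∪ hfinR.toFinset with hX
  have hXmem : ∀ E, E ∉ X ↔ jacobiSol α β E (q' + 1) ≠ 0 ∧ jacobiSol αR βR E (r' + 1) ≠ 0 := by
    intro E; simp [hX]
  set f := siteValue α β q' r' with hf
  set f' := siteValueDeriv α β q' r' with hf'
  have hfd : ∀ E, E ∉ X → HasDerivAt f (f' E) E := fun E hE =>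
    hasDerivAt_siteValue hα β q' r' ((hXmem E).1 hE).1 ((hXmem E).1 hE).2
  have hf'1 : ∀ E, 1 ≤ f' E := one_le_siteValueDeriv α β q' r'
  have hsol : ∀ n, Measurable fun E => jacobiSol α β E n := fun n =>
    measurable_jacobiSol α (β := fun _ => β) (fun _ => measurable_const) measurable_id n
  have hsolR : ∀ n, Measurable fun E => jacobiSol αR βR E n := fun n =>
    measurable_jacobiSol αR (β := fun _ => βR) (fun _ => measurable_const) measurable_id n
  have hfm : Measurable f :=
    measurable_siteValue α (β := fun _ => β) (fun _ => measurable_const) measurable_id q' r'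
  have hf'm : Measurable f' := by
    refine (measurable_const.add ((Finset.measurable_sum _ fun j _ => (hsol j).pow_const 2).div
      ((hsol _).pow_const 2))).add ((Finset.measurable_sum _ fun j _ =>
      (hsolR j).pow_const 2).div ((hsolR _).pow_const 2))
  -- The factor 1/f' is φ(q)² at an eigenvalue; the Jacobian of the area formula will cancel it.
  set g : ℝ → ℝ≥0∞ := (Set.Icc (-K) K).indicator fun E => ρ (f E)
    * ENNReal.ofReal (|jacobiSol α β E p / jacobiSol α β E (q' + 1)| / f' E) with hg
  have hgm : Measurable g := by
    refine Measurable.indicator ?_ measurableSet_Icc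
    refine (hρ.comp hfm).mul (ENNReal.measurable_ofReal.comp (Measurable.div ?_ hf'm))
    exact ((hsol p).div (hsol _)).abs
  set M := q' + r' + 2 with hM
  set b : ℝ → ℕ → ℝ := fun v => Function.update β (q' + 1) v with hb
  set qi : Fin (M + 1) := ⟨q' + 1, by omega⟩ with hqi
  set ev : ℝ → Fin (M + 1) → ℝ := fun v k => jacobiEigenvalue M α (b v) k with hev
  set vec : ℝ → Fin (M + 1) → Fin (M + 1) → ℝ := fun v k => jacobiEigenvector M α (b v) k with hvec
  have hq : ∀ v k, extendZero (vec v k) (q' + 1) = vec v k qi := fun v k =>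
    extendZero_val _ qi
  have key := fun v k (h : vec v k qi ≠ 0) => jacobi_eigenvector_at_site hα β q' r' (E := ev v k)
    (v := v) (φ := vec v k) (jacobiMatrix_mulVec_eigenvector M α (b v) k)
    (by simpa [sq] using sum_jacobiEigenvector_mul M α (b v) k k) (by rw [hq]; exact h)
  set T : ℝ → Finset (Fin (M + 1)) := fun v => Finset.univ.filter fun k => vec v k qi ≠ 0 with hT
  have hTmem : ∀ v k, k ∈ T v ↔ vec v k qi ≠ 0 := fun v k => by simp [hT]
  -- Two eigenvectors with the same eigenvalue, both nonzero at q' + 1, are proportional, which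
  -- contradicts orthogonality. So the sum over eigenvectors may be read as a sum over energies.
  have hinj : ∀ v, Set.InjOn (ev v) (T v) := by
    intro v k hk l hl hkl
    have hk := (hTmem v k).1 hk
    have hl := (hTmem v l).1 hl
    obtain ⟨-, -, -, -, hk1, hk2⟩ := key v k hk
    obtain ⟨-, -, -, -, hl1, hl2⟩ := key v l hl
    have hprop : ∀ i : Fin (M + 1), vec v k i * vec v l qi = vec v l i * vec v k qi := by
      intro i
      rw [← extendZero_val (vec v k) i, ← extendZero_val (vec v l) i]
      rcases le_or_gt (i : ℕ) (q' + 1) with h | h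
      · rw [hk1 i h, hl1 i h, hq, hq, hkl]; ring
      · have hi := i.2
        have e : (i : ℕ) = q' + r' + 2 - (q' + r' + 2 - i) := by omega
        rw [e, hk2 _ (by omega), hl2 _ (by omega), hq, hq, hkl]; ring
    by_contra hne
    have h0 := sum_jacobiEigenvector_mul M α (b v) k l
    have h1 := sum_jacobiEigenvector_mul M α (b v) l l
    rw [if_neg hne] at h0
    rw [if_pos rfl] at h1
    have : vec v l qi * (∑ i, vec v k i * vec v l i)
        = vec v k qi * ∑ i, vec v l i * vec v l i := by
      rw [Finset.mul_sum, Finset.mul_sum]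
      refine Finset.sum_congr rfl fun i _ => ?_
      linear_combination (vec v l i) * hprop i
    simp only [hvec] at this
    rw [h0, h1, mul_zero, mul_one] at this
    exact hk this.symm
  set S : ℝ → Finset ℝ := fun v => if ρ v = 0 then ∅ else (T v).image (ev v) with hS
  have hSmem : ∀ v, ∀ E ∈ S v, E ∉ X ∧ f E = v := by
    intro v E hE
    simp only [hS] at hE
    split_ifs at hE with h
    · simp at hE
    · obtain ⟨k, hk, rfl⟩ := Finset.mem_image.1 hE
      obtain ⟨h1, h2, h3, -⟩ := key v k ((hTmem v k).1 hk)
      exact ⟨(hXmem _).2 ⟨h1, h2⟩, h3⟩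
  have hmain := lintegral_sum_fiber_le X hfd (fun E _ => zero_lt_one.trans_le (hf'1 E)) hgm S hSmem
  calc _ ≤ ∫⁻ v, ∑ E ∈ S v, g E := by
        refine lintegral_mono fun v => ?_
        by_cases hv : ρ v = 0
        · simp [hv]
        simp only [hS, if_neg hv]
        rw [Finset.sum_image (hinj v)]
        -- Here φ(p)φ(q) = (u_p/u_q) φ(q)² and φ(q)² = 1/f'; eigenvectors vanishing at q contribute
        -- nothing.
        have hcorr : eigenCorrelator M α (b v) ⟨p, by omega⟩ qi
            = ∑ k ∈ T v, |jacobiSol α β (ev v k) p / jacobiSol α β (ev v k) (q' + 1)|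
              / f' (ev v k) := by
          rw [eigenCorrelator, ← Finset.sum_subset (Finset.subset_univ (T v))]
          · refine Finset.sum_congr rfl fun k hk => ?_
            obtain ⟨h1, h2, h3, h4, h5, h6⟩ := key v k ((hTmem v k).1 hk)
            have hpv : vec v k ⟨p, by omega⟩
                = jacobiSol α β (ev v k) p / jacobiSol α β (ev v k) (q' + 1) * vec v k qi := by
              rw [← hq, ← h5 p hp]
              exact (extendZero_val (vec v k) ⟨p, by omega⟩).symm
            rw [hq] at h4
            have hf'pos : 0 < f' (ev v k) := zero_lt_one.trans_le (hf'1 _)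
            change |vec v k ⟨p, _⟩ * vec v k qi| = _
            rw [hpv, mul_assoc, abs_mul, ← sq, abs_of_nonneg (sq_nonneg (vec v k qi)),
              eq_div_iff hf'pos.ne', mul_assoc, h4, mul_one]
          · intro k _ hk
            have : vec v k qi = 0 := by
              by_contra h; exact hk ((hTmem v k).2 h)
            change |vec v k ⟨p, _⟩ * vec v k qi| = 0
            rw [this, mul_zero, abs_zero]
        change ρ v * ENNReal.ofReal (eigenCorrelator M α (b v) ⟨p, _⟩ qi) ≤ _
        rw [hcorr, ENNReal.ofReal_sum_of_nonneg (fun k _ => div_nonneg (abs_nonneg _)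
          (zero_le_one.trans (hf'1 _))), Finset.mul_sum]
        refine Finset.sum_le_sum fun k hk => ?_
        have hmem : ev v k ∈ Set.Icc (-K) K := abs_le.1 (hK v hv k)
        rw [hg, Set.indicator_of_mem hmem, hf, (key v k ((hTmem v k).1 hk)).2.2.1]
    _ ≤ ∫⁻ E, ENNReal.ofReal (f' E) * g E := hmain
    _ = ∫⁻ E in Set.Icc (-K) K, ρ (siteValue α β q' r' E)
          * ENNReal.ofReal |jacobiSol α β E p / jacobiSol α β E (q' + 1)| := by
        rw [← lintegral_indicator measurableSet_Icc]
        refine lintegral_congr fun E => ?_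
        by_cases hE : E ∈ Set.Icc (-K) K
        · have hpos : 0 < f' E := zero_lt_one.trans_le (hf'1 E)
          rw [hg, Set.indicator_of_mem hE, Set.indicator_of_mem hE, mul_left_comm,
            ← ENNReal.ofReal_mul hpos.le, mul_div_cancel₀ _ hpos.ne']
        · rw [hg, Set.indicator_of_notMem hE, Set.indicator_of_notMem hE, mul_zero]

/-- Evaluate the eigenvalue equation at a site where the eigenvector has maximal modulus. The bound
does not depend on the size of the matrix, so neither does the energy range in the averaging. -/
theorem abs_jacobiEigenvalue_le {N : ℕ} {α β : ℕ → ℝ} {A B : ℝ} (hα : ∀ n, |α n| ≤ A)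
    (hβ : ∀ n, |β n| ≤ B) (k : Fin (N + 1)) : |jacobiEigenvalue N α β k| ≤ A + A + B := by
  set φ := jacobiEigenvector N α β k with hφ
  set E := jacobiEigenvalue N α β k
  obtain ⟨i, -, hi⟩ := Finset.exists_max_image Finset.univ (fun i => |φ i|) Finset.univ_nonempty
  have hpos : 0 < |φ i| := by
    rw [abs_pos]
    intro h0
    have h1 := sum_jacobiEigenvector_mul N α β k k
    rw [if_pos rfl] at h1
    have hz : ∀ j, φ j = 0 := fun j => by
      have := hi j (Finset.mem_univ _)
      rw [h0, abs_zero] at this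
      exact abs_nonpos_iff.1 this
    simp only [← hφ, hz] at h1
    simp at h1
  have heq := congrFun (jacobiMatrix_mulVec_eigenvector N α β k) i
  have hbound := abs_jacobiMatrix_mulVec_le (N := N) hα hβ (fun j => hi j (Finset.mem_univ _)) i
  rw [heq, Pi.smul_apply, smul_eq_mul, abs_mul] at hbound
  exact le_of_mul_le_mul_right hbound hpos

end SpectralAveraging

/-! ### Amplitudes of finite Jacobi matrices -/

section Amplitude

/-- The matrix element `⟨p, e^{-itH} q⟩` of the propagator of a finite Jacobi matrix `H`. -/
def jacobiAmplitude (N : ℕ) (α β : ℕ → ℝ) (p q : Fin (N + 1)) (t : ℝ) : ℂ :=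
  ∑' j : ℕ, (-(Complex.I * t)) ^ j / (j.factorial : ℂ) * ((jacobiMatrix N α β ^ j) p q : ℝ)

theorem jacobiMatrix_pow_apply (N : ℕ) (α β : ℕ → ℝ) (j : ℕ) (p q : Fin (N + 1)) :
    (jacobiMatrix N α β ^ j) p q = ∑ k, jacobiEigenvalue N α β k ^ j
      * (jacobiEigenvector N α β k p * jacobiEigenvector N α β k q) := by
  induction j generalizing p with
  | zero =>
    simp only [pow_zero, one_mul, sum_jacobiEigenvector_mul', Matrix.one_apply]
  | succ j ih =>
    rw [pow_succ', Matrix.mul_apply]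
    simp_rw [ih, Finset.mul_sum]
    rw [Finset.sum_comm]
    refine Finset.sum_congr rfl fun k _ => ?_
    have h := congrFun (jacobiMatrix_mulVec_eigenvector N α β k) p
    simp only [Matrix.mulVec, dotProduct, Pi.smul_apply, smul_eq_mul] at h
    calc ∑ i, jacobiMatrix N α β p i * (jacobiEigenvalue N α β k ^ j
          * (jacobiEigenvector N α β k i * jacobiEigenvector N α β k q))
        = jacobiEigenvalue N α β k ^ j * jacobiEigenvector N α β k q
          * ∑ i, jacobiMatrix N α β p i * jacobiEigenvector N α β k i := by
          rw [Finset.mul_sum]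
          exact Finset.sum_congr rfl fun i _ => by ring
      _ = _ := by rw [h]; ring

/-- The power series serves measurability and the comparison with the infinite operator; this
spectral form serves the bound in time, because its phases have modulus one. -/
theorem hasSum_jacobiAmplitude (N : ℕ) (α β : ℕ → ℝ) (p q : Fin (N + 1)) (t : ℝ) :
    HasSum (fun j : ℕ => (-(Complex.I * t)) ^ j / (j.factorial : ℂ)
        * ((jacobiMatrix N α β ^ j) p q : ℝ))
      (∑ k, Complex.exp (-(Complex.I * t) * jacobiEigenvalue N α β k)
        * (jacobiEigenvector N α β k p * jacobiEigenvector N α β k q : ℝ)) := by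
  have h : ∀ k, HasSum (fun j : ℕ => (-(Complex.I * t) * jacobiEigenvalue N α β k) ^ j
        / (j.factorial : ℂ) * (jacobiEigenvector N α β k p * jacobiEigenvector N α β k q : ℝ))
      (Complex.exp (-(Complex.I * t) * jacobiEigenvalue N α β k)
        * (jacobiEigenvector N α β k p * jacobiEigenvector N α β k q : ℝ)) := fun k => by
    refine HasSum.mul_right _ ?_
    rw [Complex.exp_eq_exp_ℂ]
    exact NormedSpace.expSeries_div_hasSum_exp _
  refine (hasSum_sum fun k (_ : k ∈ Finset.univ) => h k).congr_fun ?_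
  intro j
  rw [jacobiMatrix_pow_apply]
  push_cast
  rw [Finset.mul_sum]
  refine Finset.sum_congr rfl fun k _ => ?_
  rw [mul_pow]
  ring

theorem norm_jacobiAmplitude_le (N : ℕ) (α β : ℕ → ℝ) (p q : Fin (N + 1)) (t : ℝ) :
    ‖jacobiAmplitude N α β p q t‖ ≤ eigenCorrelator N α β p q := by
  rw [jacobiAmplitude, (hasSum_jacobiAmplitude N α β p q t).tsum_eq]
  refine (norm_sum_le _ _).trans (Finset.sum_le_sum fun k _ => ?_)
  rw [norm_mul, Complex.norm_real, Real.norm_eq_abs]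
  have : ‖Complex.exp (-(Complex.I * t) * jacobiEigenvalue N α β k)‖ = 1 := by
    rw [Complex.norm_exp]
    simp
  rw [this, one_mul]

theorem eigenCorrelator_comm (N : ℕ) (α β : ℕ → ℝ) (p q : Fin (N + 1)) :
    eigenCorrelator N α β p q = eigenCorrelator N α β q p := by
  simp only [eigenCorrelator, mul_comm]

/-- |xy| ≤ (x² + y²)/2 and completeness of the eigenbasis. In the limit this also bounds the
infinite-volume amplitudes by 1. -/
theorem eigenCorrelator_le_one (N : ℕ) (α β : ℕ → ℝ) (p q : Fin (N + 1)) :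
    eigenCorrelator N α β p q ≤ 1 := by
  have h1 := sum_jacobiEigenvector_mul' N α β p p
  have h2 := sum_jacobiEigenvector_mul' N α β q q
  rw [if_pos rfl] at h1 h2
  have : eigenCorrelator N α β p q ≤ ∑ k, (jacobiEigenvector N α β k p
      * jacobiEigenvector N α β k p + jacobiEigenvector N α β k q
      * jacobiEigenvector N α β k q) / 2 := by
    refine Finset.sum_le_sum fun k _ => ?_
    rw [abs_le]
    constructor
    · nlinarith [sq_nonneg (jacobiEigenvector N α β k p + jacobiEigenvector N α β k q)]
    · nlinarith [sq_nonneg (jacobiEigenvector N α β k p - jacobiEigenvector N α β k q)]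
  rw [← Finset.sum_div, Finset.sum_add_distrib, h1, h2] at this
  linarith

theorem abs_jacobiMatrix_pow_apply_le {N : ℕ} {α β : ℕ → ℝ} {A B : ℝ} (hα : ∀ n, |α n| ≤ A)
    (hβ : ∀ n, |β n| ≤ B) (j : ℕ) (p q : Fin (N + 1)) :
    |(jacobiMatrix N α β ^ j) p q| ≤ (A + A + B) ^ j := by
  induction j generalizing p with
  | zero =>
    rw [pow_zero, pow_zero, Matrix.one_apply]
    split_ifs <;> simp
  | succ j ih =>
    rw [pow_succ', pow_succ']
    exact abs_jacobiMatrix_mulVec_le hα hβ (φ := fun i => (jacobiMatrix N α β ^ j) i q) ih p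

theorem continuous_jacobiMatrix {X : Type*} [TopologicalSpace X] (N : ℕ) (α : ℕ → ℝ)
    {β : X → ℕ → ℝ} (hβ : ∀ n, Continuous fun x => β x n) :
    Continuous fun x => jacobiMatrix N α (β x) := by
  refine continuous_matrix fun i j => ?_
  simp only [jacobiMatrix, Matrix.of_apply]
  split_ifs <;> fun_prop

theorem measurable_jacobiAmplitude (N : ℕ) (α : ℕ → ℝ) (p q : Fin (N + 1)) (t : ℝ) :
    Measurable fun β : ℕ → ℝ => jacobiAmplitude N α β p q t := by
  refine measurable_of_tendsto_metrizable (f := fun n (β : ℕ → ℝ) => ∑ j ∈ Finset.range n,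
    (-(Complex.I * t)) ^ j / (j.factorial : ℂ) * ((jacobiMatrix N α β ^ j) p q : ℝ)) (fun n => ?_)
    (tendsto_pi_nhds.2 fun β => ?_)
  · refine (continuous_finsetSum _ fun j _ => ?_).measurable
    refine continuous_const.mul (Complex.continuous_ofReal.comp ?_)
    exact ((continuous_jacobiMatrix N α (fun n => continuous_apply n)).pow j).matrix_elem p q
  · have h := hasSum_jacobiAmplitude N α β p q t
    rw [← h.tsum_eq] at h
    exact h.tendsto_sum_nat

end Amplitude

/-! ### Approximation of the operator on ℤ by finite windows -/

section Truncation

open Filter Topology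

theorem inner_basisVec (p : ℤ) (f : EllTwo) : ⟪basisVec p, f⟫_ℂ = f p := by
  rw [basisVec, lp.inner_single_left]
  simp

theorem basisVec_apply (q n : ℤ) : (basisVec q : ℤ → ℂ) n = if n = q then 1 else 0 := by
  rw [basisVec, lp.coeFn_single, Pi.single_apply]

theorem jacobiOp_pow_succ_apply (a b : ℤ → ℝ) (ha : ∃ A, ∀ n, |a n| ≤ A)
    (hb : ∃ B, ∀ n, |b n| ≤ B) (j : ℕ) (f : EllTwo) (n : ℤ) :
    ((jacobiOp a b ha hb ^ (j + 1)) f) n = (a n : ℂ) * ((jacobiOp a b ha hb ^ j) f) (n + 1)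
      + (a (n - 1) : ℂ) * ((jacobiOp a b ha hb ^ j) f) (n - 1)
      + (b n : ℂ) * ((jacobiOp a b ha hb ^ j) f) n := by
  rw [pow_succ']
  exact jacobiOp_apply a b ha hb _ n

theorem jacobiOp_pow_basisVec_eq_zero (a b : ℤ → ℝ) (ha : ∃ A, ∀ n, |a n| ≤ A)
    (hb : ∃ B, ∀ n, |b n| ≤ B) (q : ℤ) (j : ℕ) {n : ℤ} (hn : j < |n - q|) :
    ((jacobiOp a b ha hb ^ j) (basisVec q)) n = 0 := by
  induction j generalizing n with
  | zero =>
    have : n ≠ q := by rintro rfl; simp at hn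
    rw [pow_zero]
    simp [basisVec_apply, this]
  | succ j ih =>
    push_cast at hn
    rw [jacobiOp_pow_succ_apply, ih (n := n + 1) (by grind), ih (n := n - 1) (by grind),
      ih (n := n) (by grind)]
    simp

/-- The position of the integer `n` in the window `-L, …, L`. -/
def windowIndex (L : ℕ) (n : ℤ) : Fin (2 * L + 1) :=
  -- Both cut-offs are default values for n outside the window; inside, the index is n + L.
  ⟨min (n + L).toNat (2 * L), by omega⟩

/-- Each application of the operator spreads the support by one site, so j steps from q stay in the
window and the boundary of the truncation is not felt. -/
theorem jacobiOp_pow_basisVec_eq (a b : ℤ → ℝ) (ha : ∃ A, ∀ n, |a n| ≤ A)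
    (hb : ∃ B, ∀ n, |b n| ≤ B) {q : ℤ} {L j : ℕ} (hj : j + |q| ≤ L) (i : Fin (2 * L + 1)) :
    ((jacobiOp a b ha hb ^ j) (basisVec q)) (-L + (i : ℕ))
      = ((jacobiMatrix (2 * L) (fun i => a (-L + i)) (fun i => b (-L + i)) ^ j) i
          (windowIndex L q) : ℝ) := by
  induction j generalizing i with
  | zero =>
    rw [pow_zero, pow_zero, Matrix.one_apply]
    simp only [one_apply_eq_self, basisVec_apply]
    have hi := i.2
    have : (-(L : ℤ) + (i : ℕ) = q) ↔ i = windowIndex L q := by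
      rw [Fin.ext_iff]
      simp only [windowIndex]
      grind
    by_cases h : i = windowIndex L q
    · rw [if_pos h, if_pos (this.2 h)]; simp
    · rw [if_neg h, if_neg fun e => h (this.1 e)]; simp
  | succ j ih =>
    have ih := fun i => ih (by push_cast at hj; omega) i
    set H := jacobiMatrix (2 * L) (fun i => a (-L + i)) (fun i => b (-L + i)) with hH
    set φ : Fin (2 * L + 1) → ℝ := fun i => (H ^ j) i (windowIndex L q) with hφ
    set z : ℤ → ℂ := fun n => ((jacobiOp a b ha hb ^ j) (basisVec q)) n
    have hzφ : ∀ n : ℕ, z (-L + n) = (extendZero φ n : ℝ) := fun n => by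
      unfold extendZero
      split_ifs with h
      · exact ih ⟨n, h⟩
      · rw [Complex.ofReal_zero]
        refine jacobiOp_pow_basisVec_eq_zero _ _ _ _ _ _ ?_
        push_cast at hj
        grind
    have hz1 : z (-L - 1) = 0 := by
      refine jacobiOp_pow_basisVec_eq_zero _ _ _ _ _ _ ?_
      push_cast at hj
      grind
    rw [jacobiOp_pow_succ_apply, pow_succ', Matrix.mul_apply]
    change (a (-L + (i : ℕ)) : ℂ) * z (-L + (i : ℕ) + 1) + (a (-L + (i : ℕ) - 1) : ℂ)
      * z (-L + (i : ℕ) - 1) + (b (-L + (i : ℕ)) : ℂ) * z (-L + (i : ℕ)) = (H.mulVec φ i : ℝ)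
    obtain ⟨n, hn⟩ := i
    cases n with
    | zero =>
      have e : (⟨0, hn⟩ : Fin (2 * L + 1)) = 0 := rfl
      have h0 := hzφ 0
      have h1 := hzφ 1
      push_cast at h0 h1
      rw [add_zero] at h0
      rw [e, hH, jacobiMatrix_mulVec_zero]
      simp only [Fin.coe_ofNat_eq_mod, Nat.zero_mod, Nat.cast_zero, add_zero, hz1, h0, h1]
      push_cast
      simp
    | succ n =>
      rw [hH, jacobiMatrix_mulVec_succ]
      have h0 := hzφ n
      have h1 := hzφ (n + 1)
      have h2 := hzφ (n + 2)
      have e0 : -(L : ℤ) + ((n + 1 : ℕ) : ℤ) - 1 = -L + n := by push_cast; ring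
      have e2 : -(L : ℤ) + ((n + 1 : ℕ) : ℤ) + 1 = -L + ((n + 2 : ℕ) : ℤ) := by push_cast; ring
      simp only [e0, e2, h0, h1, h2]
      push_cast
      ring

theorem inner_basisVec_exp_jacobiOp (a b : ℤ → ℝ) (ha : ∃ A, ∀ n, |a n| ≤ A)
    (hb : ∃ B, ∀ n, |b n| ≤ B) (p q : ℤ) (z : ℂ) :
    ⟪basisVec p, NormedSpace.exp (z • jacobiOp a b ha hb) (basisVec q)⟫_ℂ
      = ∑' j : ℕ, z ^ j / (j.factorial : ℂ) * ((jacobiOp a b ha hb ^ j) (basisVec q)) p := by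
  have h := NormedSpace.exp_series_hasSum_exp' (𝕂 := ℂ) (z • jacobiOp a b ha hb)
  have h1 := (ContinuousLinearMap.apply ℂ EllTwo (basisVec q)).hasSum h
  have h2 := (innerSL ℂ (basisVec p)).hasSum h1
  refine Eq.trans (b := _) h2.tsum_eq.symm ?_
  refine tsum_congr fun j => ?_
  simp only [innerSL_apply_apply, ContinuousLinearMap.apply_apply, smul_apply,
    smul_pow, inner_smul_right, inner_basisVec]
  ring

/-- The truncated amplitudes converge to the amplitude of the full Jacobi operator. -/
theorem tendsto_jacobiAmplitude (a b : ℤ → ℝ) (ha : ∃ A, ∀ n, |a n| ≤ A)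
    (hb : ∃ B, ∀ n, |b n| ≤ B) (p q : ℤ) (t : ℝ) :
    Tendsto (fun L : ℕ => jacobiAmplitude (2 * L) (fun i => a (-L + i)) (fun i => b (-L + i))
        (windowIndex L p) (windowIndex L q) t) atTop
      (𝓝 ⟪basisVec p, NormedSpace.exp ((-(Complex.I * (t : ℂ))) • jacobiOp a b ha hb)
        (basisVec q)⟫_ℂ) := by
  obtain ⟨A, hA⟩ := id ha
  obtain ⟨B, hB⟩ := id hb
  rw [inner_basisVec_exp_jacobiOp]
  unfold jacobiAmplitude
  -- Each term of the exponential series is eventually constant in L, and a scalar exponential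
  -- series dominates all of them.
  refine tendsto_tsum_of_dominated_convergence
    (bound := fun j : ℕ => (|t| * (A + A + B)) ^ j / (j.factorial : ℝ))
    (Real.summable_pow_div_factorial _) (fun j => ?_) (Eventually.of_forall fun L j => ?_)
  · refine tendsto_const_nhds.congr' ?_
    filter_upwards [eventually_ge_atTop (j + q.natAbs), eventually_ge_atTop p.natAbs] with L hL hL'
    have h := jacobiOp_pow_basisVec_eq a b ha hb (q := q) (L := L) (j := j) (by
      rw [Int.abs_eq_natAbs]; omega)
      (windowIndex L p)
    have e : -(L : ℤ) + ((windowIndex L p : ℕ) : ℤ) = p := by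
      simp only [windowIndex]; omega
    rw [e] at h
    rw [h]
  · have h := abs_jacobiMatrix_pow_apply_le (N := 2 * L) (fun n : ℕ => hA (-L + n))
      (fun n : ℕ => hB (-L + n)) j (windowIndex L p) (windowIndex L q)
    rw [norm_mul, norm_div, norm_pow, Complex.norm_real, Real.norm_eq_abs, norm_neg, norm_mul,
      Complex.norm_I, one_mul, Complex.norm_real, Real.norm_eq_abs, Complex.norm_natCast, mul_pow,
      mul_div_right_comm]
    gcongr

end Truncation

/-! ### Iterated transfer kernels -/

section TransferChain

/-- The distribution of `E - x` for `x` with density `ρ`. -/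
def reflectedMeasure (ρ : ℝ → ℝ≥0∞) (E : ℝ) : Measure ℝ :=
  (volume.withDensity ρ).map fun x => E - x

theorem lintegral_reflectedMeasure {ρ : ℝ → ℝ≥0∞} (hρ : Measurable ρ) (E : ℝ) {G : ℝ → ℝ≥0∞}
    (hG : Measurable G) (w : ℝ) :
    ∫⁻ t, G (w + t) ∂reflectedMeasure ρ E = ∫⁻ x, ρ x * G (E - x + w) := by
  rw [reflectedMeasure, lintegral_map (f := fun t => G (w + t)) (hG.comp (measurable_const_add w))
      (by fun_prop),
    lintegral_withDensity_eq_lintegral_mul _ hρ (g := fun x => G (w + (E - x)))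
      (hG.comp ((measurable_const_add w).comp (measurable_const.sub measurable_id)))]
  refine lintegral_congr fun x => ?_
  rw [Pi.mul_apply, add_comm w]

theorem isProbabilityMeasure_reflectedMeasure {ρ : ℝ → ℝ≥0∞} (h1 : ∫⁻ x, ρ x = 1) (E : ℝ) :
    IsProbabilityMeasure (reflectedMeasure ρ E) := by
  have : IsProbabilityMeasure (volume.withDensity ρ) := ⟨by simpa using h1⟩
  exact Measure.isProbabilityMeasure_map (by fun_prop)

theorem reflectedMeasure_le {ρ : ℝ → ℝ≥0∞} {Λ : ℝ≥0∞} (hΛ : ∀ x, ρ x ≤ Λ) (E : ℝ) (s : Set ℝ)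
    (hs : MeasurableSet s) : reflectedMeasure ρ E s ≤ Λ * volume s := by
  have hm : Measurable fun x : ℝ => E - x := by fun_prop
  rw [reflectedMeasure, Measure.map_apply hm hs, withDensity_apply _ (hm hs)]
  calc ∫⁻ x in (fun x => E - x) ⁻¹' s, ρ x ≤ ∫⁻ _ in (fun x => E - x) ⁻¹' s, Λ :=
        lintegral_mono fun x => hΛ x
    _ = Λ * volume s := by
        rw [setLIntegral_const, (volume.measurePreserving_sub_left E).measure_preimage
          hs.nullMeasurableSet]

theorem lintegral_sq_le_of_le {ρ : ℝ → ℝ≥0∞} (h1 : ∫⁻ x, ρ x = 1) {Λ : ℝ≥0∞}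
    (hΛ : ∀ x, ρ x ≤ Λ) (hΛ' : Λ ≠ ∞) : ∫⁻ x, ρ x ^ 2 ≤ Λ := by
  calc ∫⁻ x, ρ x ^ 2 ≤ ∫⁻ x, Λ * ρ x :=
        lintegral_mono fun x => by rw [sq]; gcongr; exact hΛ x
    _ = Λ := by rw [lintegral_const_mul' _ _ hΛ', h1, mul_one]

/-- Successive integration of the sites `q - 1, q - 2, …` against the kernel obtained from the
Riccati recursion; `s` is a spectator variable. -/
def transferChain (α : ℕ → ℝ) (ρ : ℕ → ℝ → ℝ≥0∞) (E : ℝ) (q : ℕ) : ℕ → ℝ → ℝ → ℝ≥0∞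
  | 0, s, w => ρ q (s + w)
  | k + 1, s, w => ∫⁻ x, ρ (q - 1 - k) x
      * inversionOp (α (q - 1 - k)) (transferChain α ρ E q k s) (E - x + w)

variable {α : ℕ → ℝ} {ρ : ℕ → ℝ → ℝ≥0∞}

theorem measurable_uncurry_transferChain (hρ : ∀ n, Measurable (ρ n)) (E : ℝ) (q k : ℕ) :
    Measurable fun p : ℝ × ℝ => transferChain α ρ E q k p.1 p.2 := by
  induction k with
  | zero => exact (hρ q).comp (measurable_fst.add measurable_snd)
  | succ k ih =>
    simp only [transferChain, inversionOp]
    refine Measurable.lintegral_prod_right' (f := fun z : (ℝ × ℝ) × ℝ => ρ (q - 1 - k) z.2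
      * (ENNReal.ofReal (α (q - 1 - k) / |E - z.2 + z.1.2|)
        * transferChain α ρ E q k z.1.1 (-α (q - 1 - k) ^ 2 / (E - z.2 + z.1.2)))) ?_
    have h1 : Measurable fun z : (ℝ × ℝ) × ℝ =>
        ENNReal.ofReal (α (q - 1 - k) / |E - z.2 + z.1.2|) := by fun_prop
    have h2 : Measurable fun z : (ℝ × ℝ) × ℝ =>
        (z.1.1, -α (q - 1 - k) ^ 2 / (E - z.2 + z.1.2)) := by fun_prop
    exact ((hρ _).comp measurable_snd).mul (h1.mul (ih.comp h2))

theorem measurable_transferChain (hρ : ∀ n, Measurable (ρ n)) (E : ℝ) (q k : ℕ) (s : ℝ) :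
    Measurable (transferChain α ρ E q k s) :=
  (measurable_uncurry_transferChain hρ E q k).comp (measurable_const.prodMk measurable_id)

/-- One integration is an average over translations applied to an inversion, the form to which the
contraction estimates apply. -/
theorem transferChain_succ (hρ : ∀ n, Measurable (ρ n)) (E : ℝ) (q k : ℕ) (s w : ℝ) :
    transferChain α ρ E q (k + 1) s w
      = ∫⁻ t, inversionOp (α (q - 1 - k)) (transferChain α ρ E q k s) (w + t)
          ∂reflectedMeasure (ρ (q - 1 - k)) E :=
  (lintegral_reflectedMeasure (hρ _) E
    (measurable_inversionOp _ (measurable_transferChain hρ E q k s)) w).symm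

theorem lintegral_transferChain_succ_sq_le (hα : ∀ n, 0 < α n) (hρ : ∀ n, Measurable (ρ n))
    (h1 : ∀ n, ∫⁻ x, ρ n x = 1) (E : ℝ) (q k : ℕ) (s : ℝ) :
    ∫⁻ w, transferChain α ρ E q (k + 1) s w ^ 2 ≤ ∫⁻ w, transferChain α ρ E q k s w ^ 2 := by
  have := isProbabilityMeasure_reflectedMeasure (h1 (q - 1 - k)) E
  simp_rw [transferChain_succ hρ]
  refine (lintegral_average_sq_le
    (measurable_inversionOp _ (measurable_transferChain hρ E q k s))).trans ?_
  rw [lintegral_inversionOp_sq (hα _)]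

theorem lintegral_transferChain_sq_le_lintegral_sq (hα : ∀ n, 0 < α n)
    (hρ : ∀ n, Measurable (ρ n)) (h1 : ∀ n, ∫⁻ x, ρ n x = 1) (E : ℝ) (q k : ℕ) (s : ℝ) :
    ∫⁻ w, transferChain α ρ E q k s w ^ 2 ≤ ∫⁻ x, ρ q x ^ 2 := by
  induction k with
  | zero =>
    simp only [transferChain]
    rw [lintegral_add_left_eq_self (fun w => ρ q w ^ 2)]
  | succ k ih => exact (lintegral_transferChain_succ_sq_le hα hρ h1 E q k s).trans ih

/-- Steps are taken in pairs: one average alone need not lose a definite fraction of the mass, but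
two averages separated by an inversion do. The inversion preceding both is unitary and is absorbed
into the input. -/
theorem lintegral_transferChain_sq_le (hα : ∀ n, 0 < α n) {A : ℝ} (hαA : ∀ n, α n ≤ A)
    (hρ : ∀ n, Measurable (ρ n)) (h1 : ∀ n, ∫⁻ x, ρ n x = 1) {B D : ℝ} (hB : 0 < B) (hD : 0 < D)
    (hD1 : D ≤ 1) (E : ℝ) (q : ℕ) (s : ℝ) (hq : ∫⁻ x, ρ q x ^ 2 ≠ ∞) (k : ℕ)
    (hk : ∀ j < 2 * k, ∀ x, ρ (q - 1 - j) x ≤ ENNReal.ofReal (B / D)) :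
    ∫⁻ w, transferChain α ρ E q (2 * k) s w ^ 2
      ≤ ENNReal.ofReal (1 - 1 / (3200 * (8 * B * (2 * A + 1) + 3) ^ 2) * D ^ 2) ^ k
        * ∫⁻ x, ρ q x ^ 2 := by
  induction k with
  | zero =>
    rw [pow_zero, one_mul]
    exact lintegral_transferChain_sq_le_lintegral_sq hα hρ h1 E q _ s
  | succ k ih =>
    have := isProbabilityMeasure_reflectedMeasure (h1 (q - 1 - 2 * k)) E
    have := isProbabilityMeasure_reflectedMeasure (h1 (q - 1 - (2 * k + 1))) E
    have hm := measurable_transferChain (α := α) hρ E q (2 * k) s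
    have hV := lintegral_inversionOp_sq (hα (q - 1 - 2 * k)) (transferChain α ρ E q (2 * k) s)
    have h := lintegral_average_inversion_average_sq_le
      (ν₁ := reflectedMeasure (ρ (q - 1 - (2 * k + 1))) E)
      (ν₂ := reflectedMeasure (ρ (q - 1 - 2 * k)) E) hB (hα (q - 1 - (2 * k + 1)))
      (hαA _) hD hD1 (fun s hs => reflectedMeasure_le (hk _ (by omega)) E s hs)
      (fun s hs => reflectedMeasure_le (hk _ (by omega)) E s hs)
      (measurable_inversionOp (α (q - 1 - 2 * k)) hm)
      (by rw [hV]; exact ne_top_of_le_ne_top hq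
            (lintegral_transferChain_sq_le_lintegral_sq hα hρ h1 E q _ s))
    have e : 2 * (k + 1) = 2 * k + 1 + 1 := by ring
    rw [e]
    simp_rw [transferChain_succ hρ E q (2 * k + 1)]
    have e2 : transferChain α ρ E q (2 * k + 1) s = fun u =>
        ∫⁻ t, inversionOp (α (q - 1 - 2 * k)) (transferChain α ρ E q (2 * k) s) (u + t)
          ∂reflectedMeasure (ρ (q - 1 - 2 * k)) E :=
      funext fun u => transferChain_succ hρ E q (2 * k) s u
    rw [e2]
    refine h.trans ?_
    rw [hV]
    refine (mul_le_mul_right (ih fun j hj => hk j (by omega)) _).trans (le_of_eq ?_)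
    rw [pow_succ' _ k]
    exact (mul_assoc _ _ _).symm

/-- Pointwise bound for a chain of transfer kernels. -/
theorem transferChain_succ_le (hα : ∀ n, 0 < α n) {A : ℝ} (hαA : ∀ n, α n ≤ A)
    (hρ : ∀ n, Measurable (ρ n)) (h1 : ∀ n, ∫⁻ x, ρ n x = 1) {B D : ℝ} (hB : 0 < B) (hD : 0 < D)
    (hD1 : D ≤ 1) (E : ℝ) (q : ℕ) (s w : ℝ) (hq : ∫⁻ x, ρ q x ^ 2 ≠ ∞) (k : ℕ)
    (hk : ∀ j < k, ∀ x, ρ (q - 1 - j) x ≤ ENNReal.ofReal (B / D)) :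
    transferChain α ρ E q (k + 1) s w ^ 2 ≤ (∫⁻ x, ρ (q - 1 - k) x ^ 2)
      * (ENNReal.ofReal (1 - 1 / (3200 * (8 * B * (2 * A + 1) + 3) ^ 2) * D ^ 2) ^ (k / 2)
        * ∫⁻ x, ρ q x ^ 2) := by
  have hV : Measurable fun x => inversionOp (α (q - 1 - k)) (transferChain α ρ E q k s)
      (E - x + w) :=
    (measurable_inversionOp _ (measurable_transferChain hρ E q k s)).comp
      ((measurable_const.sub measurable_id).add measurable_const)
  -- Cauchy–Schwarz in the last integration trades the L² bound for a pointwise one, at the cost of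
  -- the L² norm of that site's density.
  have hH := ENNReal.lintegral_mul_le_Lp_mul_Lq volume Real.HolderConjugate.two_two
    (hρ (q - 1 - k)).aemeasurable hV.aemeasurable
  have hsq : ∀ z : ℝ≥0∞, (z ^ (1 / 2 : ℝ)) ^ 2 = z := fun z => by
    rw [← ENNReal.rpow_natCast, ← ENNReal.rpow_mul]; norm_num
  simp only [transferChain]
  refine (pow_le_pow_left' hH 2).trans ?_
  rw [mul_pow, hsq, hsq]
  simp only [ENNReal.rpow_two]
  gcongr
  have hshift : ∫⁻ x, inversionOp (α (q - 1 - k)) (transferChain α ρ E q k s) (E - x + w) ^ 2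
      = ∫⁻ y, transferChain α ρ E q k s y ^ 2 := by
    rw [← lintegral_inversionOp_sq (hα (q - 1 - k)) (transferChain α ρ E q k s),
      ← lintegral_sub_left_eq_self (fun y => inversionOp (α (q - 1 - k))
        (transferChain α ρ E q k s) y ^ 2) (E + w)]
    exact lintegral_congr fun x => by rw [sub_add_eq_add_sub]
  rw [hshift]
  -- An unpaired step, when k is odd, is only used as a contraction.
  have hmono : ∫⁻ y, transferChain α ρ E q k s y ^ 2
      ≤ ∫⁻ y, transferChain α ρ E q (2 * (k / 2)) s y ^ 2 := by
    rcases Nat.even_or_odd k with he | ho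
    · rw [Nat.two_mul_div_two_of_even he]
    · have : k = 2 * (k / 2) + 1 := (Nat.two_mul_div_two_add_one_of_odd ho).symm
      conv_lhs => rw [this]
      exact lintegral_transferChain_succ_sq_le hα hρ h1 E q _ s
  exact hmono.trans (lintegral_transferChain_sq_le hα hαA hρ h1 hB hD hD1 E q s hq _
    fun j hj => hk j (by omega))

end TransferChain

/-! ### Riccati variables and successive integration of sites -/

section Riccati

/-- The term `-α n ^ 2 / y n` of the Riccati recursion `y n = E - β n - α (n-1) ^ 2 / y (n-1)`,
so that `y n = E - β n + riccatiShift α β E n`. -/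
def riccatiShift (α β : ℕ → ℝ) (E : ℝ) : ℕ → ℝ
  | 0 => 0
  | n + 1 => -α n ^ 2 / (E - β n + riccatiShift α β E n)

theorem riccatiShift_congr {α β β' : ℕ → ℝ} (E : ℝ) {n : ℕ} (h : ∀ j < n, β j = β' j) :
    riccatiShift α β E n = riccatiShift α β' E n := by
  induction n with
  | zero => rfl
  | succ n ih =>
    simp only [riccatiShift]
    rw [h n (by omega), ih fun j hj => h j (by omega)]

theorem measurable_riccatiShift {Ω : Type*} [MeasurableSpace Ω] (α : ℕ → ℝ) {β : Ω → ℕ → ℝ}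
    (hβ : ∀ n, Measurable fun ω => β ω n) {e : Ω → ℝ} (he : Measurable e) (n : ℕ) :
    Measurable fun ω => riccatiShift α (β ω) (e ω) n := by
  induction n with
  | zero => exact measurable_const
  | succ n ih =>
    simp only [riccatiShift]
    exact measurable_const.div ((he.sub (hβ n)).add ih)

theorem riccati_eq_ratio {α : ℕ → ℝ} (hα : ∀ n, α n ≠ 0) (β : ℕ → ℝ) {E : ℝ} {n : ℕ}
    (h : ∀ j ≤ n, jacobiSol α β E j ≠ 0) :
    E - β n + riccatiShift α β E n = α n * jacobiSol α β E (n + 1) / jacobiSol α β E n := by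
  induction n with
  | zero =>
    have := hα 0
    simp only [riccatiShift, jacobiSol]
    field_simp
    ring
  | succ n ih =>
    have h0 := h n (by omega)
    have h1 := h (n + 1) le_rfl
    have ha := hα n
    have ha' := hα (n + 1)
    simp only [riccatiShift]
    rw [ih fun j hj => h j (by omega)]
    simp only [jacobiSol]
    field_simp
    ring

theorem riccatiShift_succ_eq {α : ℕ → ℝ} (hα : ∀ n, α n ≠ 0) (β : ℕ → ℝ) {E : ℝ} {n : ℕ}
    (h : ∀ j ≤ n, jacobiSol α β E j ≠ 0) :
    riccatiShift α β E (n + 1) = -jacobiRatio α β n E := by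
  have h0 := h n le_rfl
  have ha := hα n
  simp only [riccatiShift, jacobiRatio]
  rw [riccati_eq_ratio hα β h]
  by_cases h1 : jacobiSol α β E (n + 1) = 0
  · simp [h1]
  · field_simp

/-- Each factor is |u_j/u_{j+1}|, so the product telescopes. -/
theorem prod_riccati_eq {α : ℕ → ℝ} (hα : ∀ n, 0 < α n) (β : ℕ → ℝ) {E : ℝ} {p q : ℕ}
    (hpq : p ≤ q) (h : ∀ j ≤ q, jacobiSol α β E j ≠ 0) :
    ∏ j ∈ Finset.Ico p q, ENNReal.ofReal (α j / |E - β j + riccatiShift α β E j|)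
      = ENNReal.ofReal |jacobiSol α β E p / jacobiSol α β E q| := by
  induction q, hpq using Nat.le_induction with
  | base => simp [div_self (h p le_rfl)]
  | succ q hpq ih =>
    have h0 := h q (by omega)
    have h1 := h (q + 1) le_rfl
    have ha := hα q
    rw [Finset.prod_Ico_succ_top hpq, ih fun j hj => h j (by omega),
      riccati_eq_ratio (fun n => (hα n).ne') β fun j hj => h j (by omega),
      ← ENNReal.ofReal_mul (abs_nonneg _)]
    congr 1
    rw [abs_div, abs_div, abs_div, abs_mul, abs_of_pos ha]
    have h0' := abs_ne_zero.2 h0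
    have h1' := abs_ne_zero.2 h1
    field_simp

/-- The spectator variable at the site `q' + 1`, which only involves the sites to its right. -/
def rightShift (α β : ℕ → ℝ) (q' r' : ℕ) (E : ℝ) : ℝ :=
  E - jacobiRatio (fun i => α (q' + r' + 1 - i)) (fun i => β (q' + r' + 2 - i)) r' E

/-- Only sites to the right of q' + 1 enter, so this quantity stays fixed while the sites to the
left are integrated. -/
theorem rightShift_update (α β : ℕ → ℝ) (q' r' : ℕ) (E : ℝ) {n : ℕ} (hn : n ≤ q') (x : ℝ) :
    rightShift α (Function.update β n x) q' r' E = rightShift α β q' r' E := by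
  have h : ∀ m ≤ r' + 1, jacobiSol (fun i => α (q' + r' + 1 - i))
      (fun i => Function.update β n x (q' + r' + 2 - i)) E m
      = jacobiSol (fun i => α (q' + r' + 1 - i)) (fun i => β (q' + r' + 2 - i)) E m := fun m hm =>
    jacobiSol_congr E fun j hj => Function.update_of_ne (by omega) _ _
  simp only [rightShift, jacobiRatio]
  rw [h r' (by omega), h (r' + 1) le_rfl]

theorem measurable_rightShift {Ω : Type*} [MeasurableSpace Ω] (α : ℕ → ℝ) {β : Ω → ℕ → ℝ}
    (hβ : ∀ n, Measurable fun ω => β ω n) {e : Ω → ℝ} (he : Measurable e) (q' r' : ℕ) :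
    Measurable fun ω => rightShift α (β ω) q' r' (e ω) :=
  he.sub (measurable_jacobiRatio _ (β := fun ω i => β ω (q' + r' + 2 - i)) (fun _ => hβ _) he r')

/-- The integrand obtained after integrating out `k` sites to the left of `q' + 1`. -/
def chainIntegrand (α : ℕ → ℝ) (ρ : ℕ → ℝ → ℝ≥0∞) (E : ℝ) (p q' r' k : ℕ) (β : ℕ → ℝ) : ℝ≥0∞ :=
  (∏ j ∈ Finset.Ico p (q' + 1 - k), ENNReal.ofReal (α j / |E - β j + riccatiShift α β E j|))
    * transferChain α ρ E (q' + 1) k (rightShift α β q' r' E) (riccatiShift α β E (q' + 1 - k))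

theorem measurable_prod_riccati {Ω : Type*} [MeasurableSpace Ω] (α : ℕ → ℝ) {β : Ω → ℕ → ℝ}
    (hβ : ∀ n, Measurable fun ω => β ω n) {e : Ω → ℝ} (he : Measurable e) (s : Finset ℕ) :
    Measurable fun ω => ∏ j ∈ s,
      ENNReal.ofReal (α j / |e ω - β ω j + riccatiShift α (β ω) (e ω) j|) :=
  Finset.measurable_fun_prod _ fun j _ => ENNReal.measurable_ofReal.comp
    (measurable_const.div ((he.sub (hβ j)).add (measurable_riccatiShift α hβ he j)).abs)

theorem measurable_chainIntegrand (α : ℕ → ℝ) {ρ : ℕ → ℝ → ℝ≥0∞} (hρ : ∀ n, Measurable (ρ n))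
    (E : ℝ) (p q' r' k : ℕ) : Measurable (chainIntegrand α ρ E p q' r' k) := by
  have hβ : ∀ n, Measurable fun β : ℕ → ℝ => β n := fun n => measurable_pi_apply n
  exact (measurable_prod_riccati α hβ measurable_const _).mul
    ((measurable_uncurry_transferChain hρ E (q' + 1) k).comp
      ((measurable_rightShift α hβ measurable_const q' r').prodMk
        (measurable_riccatiShift α hβ measurable_const _)))

/-- The site q' - k occurs only in the last factor of the product and, through the Riccati step, in
the argument of the kernel. Together these form an inversion evaluated at E - x plus the previous
shift, so integrating over x is one more step of the chain. -/
theorem lintegral_chainIntegrand_update (α : ℕ → ℝ) {ρ : ℕ → ℝ → ℝ≥0∞}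
    (hρ : ∀ n, Measurable (ρ n)) (E : ℝ) {p q' k : ℕ} (r' : ℕ) (hk : p + k ≤ q') (β : ℕ → ℝ) :
    ∫⁻ x, ρ (q' - k) x * chainIntegrand α ρ E p q' r' k (Function.update β (q' - k) x)
      = chainIntegrand α ρ E p q' r' (k + 1) β := by
  have e1 : q' + 1 - k = (q' - k) + 1 := by omega
  have e2 : q' + 1 - (k + 1) = q' - k := by omega
  have e3 : q' + 1 - 1 - k = q' - k := by omega
  simp only [chainIntegrand, e1, e2]
  set n := q' - k with hn
  have hs : ∀ x, ∀ j ≤ n, riccatiShift α (Function.update β n x) E j = riccatiShift α β E j :=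
    fun x j hj => riccatiShift_congr E fun i hi => Function.update_of_ne (by omega) _ _
  simp only [transferChain, e3]
  rw [← lintegral_const_mul]
  · refine lintegral_congr fun x => ?_
    rw [rightShift_update α β q' r' E (by omega), Finset.prod_Ico_succ_top (by omega)]
    have hprod : ∏ j ∈ Finset.Ico p n, ENNReal.ofReal (α j
          / |E - Function.update β n x j + riccatiShift α (Function.update β n x) E j|)
        = ∏ j ∈ Finset.Ico p n, ENNReal.ofReal (α j / |E - β j + riccatiShift α β E j|) := by
      refine Finset.prod_congr rfl fun j hj => ?_
      rw [Finset.mem_Ico] at hj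
      rw [hs x j hj.2.le, Function.update_of_ne (by omega)]
    rw [hprod, hs x n le_rfl, Function.update_self, riccatiShift, hs x n le_rfl,
      Function.update_self, inversionOp]
    ring
  · exact (hρ _).mul ((measurable_inversionOp _ (measurable_transferChain hρ E _ k _)).comp
      ((measurable_const.sub measurable_id).add measurable_const))

theorem siteValue_eq_rightShift_add {α : ℕ → ℝ} (hα : ∀ n, α n ≠ 0) (β : ℕ → ℝ) (q' r' : ℕ) {E : ℝ}
    (h : ∀ j ≤ q', jacobiSol α β E j ≠ 0) :
    siteValue α β q' r' E = rightShift α β q' r' E + riccatiShift α β E (q' + 1) := by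
  rw [riccatiShift_succ_eq hα β h, siteValue, rightShift]
  ring

/-- Riccati variables and solution ratios agree unless some u_j vanishes at E, which happens for
countably many energies. -/
theorem chainIntegrand_zero_eq_ae {α : ℕ → ℝ} (hα : ∀ n, 0 < α n) (ρ : ℕ → ℝ → ℝ≥0∞) (β : ℕ → ℝ)
    {p q' : ℕ} (r' : ℕ) (hp : p ≤ q' + 1) :
    ∀ᵐ E : ℝ, ρ (q' + 1) (siteValue α β q' r' E)
        * ENNReal.ofReal |jacobiSol α β E p / jacobiSol α β E (q' + 1)|
      = chainIntegrand α ρ E p q' r' 0 β := by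
  have hfin : ∀ j, ∀ᵐ E : ℝ, jacobiSol α β E j ≠ 0 := fun j => by
    rw [ae_iff]
    simpa using (finite_setOf_jacobiSol_eq_zero (fun n => (hα n).ne') β j).measure_zero volume
  filter_upwards [ae_all_iff.2 hfin] with E hE
  rw [chainIntegrand, Nat.sub_zero, prod_riccati_eq hα β hp fun j _ => hE j, transferChain,
    siteValue_eq_rightShift_add (fun n => (hα n).ne') β q' r' fun j _ => hE j, mul_comm]

end Riccati

/-! ### Averaged correlator bounds uniform in the window -/

section TruncatedBound

theorem lintegral_eigenCorrelator_le_of_eq {α : ℕ → ℝ} (hα : ∀ n, α n ≠ 0) (β : ℕ → ℝ)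
    {N q' r' : ℕ} (hN : N = q' + r' + 2) {p q : Fin (N + 1)} (hq : (q : ℕ) = q' + 1)
    (hp : (p : ℕ) ≤ q' + 1) {ρ : ℝ → ℝ≥0∞} (hρ : Measurable ρ) {K : ℝ}
    (hK : ∀ v, ρ v ≠ 0 → ∀ k, |jacobiEigenvalue N α (Function.update β (q' + 1) v) k| ≤ K) :
    ∫⁻ v, ρ v * ENNReal.ofReal (eigenCorrelator N α (Function.update β (q' + 1) v) p q)
      ≤ ∫⁻ E in Set.Icc (-K) K, ρ (siteValue α β q' r' E)
          * ENNReal.ofReal |jacobiSol α β E p / jacobiSol α β E (q' + 1)| := by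
  subst hN
  have e : q = ⟨q' + 1, by omega⟩ := Fin.ext hq
  rw [e]
  exact lintegral_eigenCorrelator_le hα β q' r' p hp hρ hK

/-- The two end densities cost their L² norms, at most (B/d)^(1/2) each, and only the sites strictly
between need the bound B/D. The powers of 1 - εD² become an exponential by 1 - x ≤ exp(-x). -/
theorem transferChain_succ_le_ofReal_sqrt {α : ℕ → ℝ} {ρ : ℕ → ℝ → ℝ≥0∞} (hα : ∀ n, 0 < α n)
    {A : ℝ} (hαA : ∀ n, α n ≤ A) (hρ : ∀ n, Measurable (ρ n)) (h1 : ∀ n, ∫⁻ x, ρ n x = 1)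
    {B D dp dq : ℝ} (hB : 0 < B) (hD : 0 < D) (hD1 : D ≤ 1) (hdp : 0 < dp) (hdq : 0 < dq)
    (E : ℝ) (q : ℕ) (s w : ℝ) (k : ℕ) (hq : ∀ x, ρ q x ≤ ENNReal.ofReal (B / dq))
    (hp : ∀ x, ρ (q - 1 - k) x ≤ ENNReal.ofReal (B / dp))
    (hk : ∀ j < k, ∀ x, ρ (q - 1 - j) x ≤ ENNReal.ofReal (B / D)) :
    transferChain α ρ E q (k + 1) s w ≤ ENNReal.ofReal (Real.sqrt (B / dp * (B / dq)
      * Real.exp (-(1 / (3200 * (8 * B * (2 * A + 1) + 3) ^ 2)) * D ^ 2 * (k / 2 : ℕ)))) := by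
  have hqq := lintegral_sq_le_of_le (h1 q) hq ENNReal.ofReal_ne_top
  have hpp := lintegral_sq_le_of_le (h1 (q - 1 - k)) hp ENNReal.ofReal_ne_top
  have h := transferChain_succ_le hα hαA hρ h1 hB hD hD1 E q s w
    (ne_top_of_le_ne_top ENNReal.ofReal_ne_top hqq) k hk
  set ε := 1 / (3200 * (8 * B * (2 * A + 1) + 3) ^ 2)
  have hθ : ENNReal.ofReal (1 - ε * D ^ 2) ^ (k / 2)
      ≤ ENNReal.ofReal (Real.exp (-ε * D ^ 2 * (k / 2 : ℕ))) := by
    rw [mul_comm (-ε * D ^ 2), Real.exp_nat_mul, ENNReal.ofReal_pow (Real.exp_pos _).le]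
    gcongr
    have := Real.add_one_le_exp (-ε * D ^ 2)
    linarith
  have h2 : transferChain α ρ E q (k + 1) s w ^ 2 ≤ ENNReal.ofReal (B / dp * (B / dq)
      * Real.exp (-ε * D ^ 2 * (k / 2 : ℕ))) := by
    refine h.trans ?_
    rw [mul_assoc, mul_comm (B / dq), ENNReal.ofReal_mul (by positivity),
      ENNReal.ofReal_mul (by positivity)]
    gcongr
  rw [← Real.sq_sqrt (x := B / dp * (B / dq) * _) (by positivity),
    ENNReal.ofReal_pow (Real.sqrt_nonneg _)] at h2
  exact (ENNReal.pow_le_pow_left_iff two_ne_zero).1 h2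

namespace RandomJacobi

variable (S : RandomJacobi)

/-- The restriction of a sequence to `{-L, -L + 1, …}`, indexed from `0`. -/
def shiftSeq (L : ℕ) (b : ℤ → ℝ) (i : ℕ) : ℝ := b (-L + i)

theorem measurable_shiftSeq (L : ℕ) : Measurable (shiftSeq L) :=
  measurable_pi_lambda _ fun _ => measurable_pi_apply _

theorem shiftSeq_update (L : ℕ) (b : ℤ → ℝ) (n : ℕ) (x : ℝ) :
    shiftSeq L (Function.update b (-L + n) x) = Function.update (shiftSeq L b) n x := by
  ext i
  by_cases h : i = n
  · subst h; simp [shiftSeq]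
  · have : (-(L : ℤ) + i) ≠ -L + n := by omega
    simp [shiftSeq, Function.update_of_ne h, Function.update_of_ne this]

/-- The site densities on the window starting at `-L`. -/
def windowDensity (L : ℕ) (n : ℕ) : ℝ → ℝ≥0∞ := S.siteDensity (-L + n)

theorem lintegral_chainIntegrand_eq_succ (L : ℕ) (E : ℝ) {p q' k : ℕ} (r' : ℕ)
    (hk : p + k ≤ q') :
    ∫⁻ ω, chainIntegrand (shiftSeq L S.a) (S.windowDensity L) E p q' r' k
        (shiftSeq L (S.potential ω)) ∂S.configMeasure
      = ∫⁻ ω, chainIntegrand (shiftSeq L S.a) (S.windowDensity L) E p q' r' (k + 1)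
        (shiftSeq L (S.potential ω)) ∂S.configMeasure := by
  have hρ : ∀ n, Measurable (S.windowDensity L n) := fun n => S.measurable_siteDensity _
  rw [S.lintegral_configMeasure_update (-L + (q' - k : ℕ))
    (F := fun b => chainIntegrand (shiftSeq L S.a) (S.windowDensity L) E p q' r' k (shiftSeq L b))
    ((measurable_chainIntegrand _ hρ E p q' r' k).comp (measurable_shiftSeq L))]
  refine lintegral_congr fun ω => ?_
  simp_rw [shiftSeq_update]
  exact lintegral_chainIntegrand_update _ hρ E r' hk _

theorem lintegral_chainIntegrand_zero_eq (L : ℕ) (E : ℝ) {p q' k : ℕ} (r' : ℕ)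
    (hk : p + k ≤ q' + 1) :
    ∫⁻ ω, chainIntegrand (shiftSeq L S.a) (S.windowDensity L) E p q' r' 0
        (shiftSeq L (S.potential ω)) ∂S.configMeasure
      = ∫⁻ ω, chainIntegrand (shiftSeq L S.a) (S.windowDensity L) E p q' r' k
        (shiftSeq L (S.potential ω)) ∂S.configMeasure := by
  induction k with
  | zero => rfl
  | succ k ih => rw [ih (by omega), S.lintegral_chainIntegrand_eq_succ L E r' (by omega)]

theorem a_pos (n : ℤ) : 0 < S.a n := by
  obtain ⟨δ, hδ, h⟩ := S.a_lower
  exact hδ.trans_le (h n)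

/-- Averaged decay of the eigenfunction correlators of the truncated operators, uniformly in the
size of the truncation. -/
theorem exists_lintegral_truncated_le :
    ∃ K > 0, ∃ ε > 0, ∃ B > 0, ∀ p q : ℤ, p < q → ∀ D : ℝ, 0 < D → D ≤ 1 →
      (∀ n, p < n → n < q → D ≤ S.d n) → ∀ L : ℕ, p.natAbs < L → q.natAbs < L →
      ∀ f : (ℕ → ℝ) → ℝ≥0∞, Measurable f →
      (∀ β, f β ≤ ENNReal.ofReal (eigenCorrelator (2 * L) (shiftSeq L S.a) β
        (windowIndex L p) (windowIndex L q))) →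
      ∫⁻ ω, f (shiftSeq L (S.potential ω)) ∂S.configMeasure
        ≤ ENNReal.ofReal (K * Real.sqrt (B / S.d p * (B / S.d q)
            * Real.exp (-ε * D ^ 2 * ((q - p - 1).toNat / 2 : ℕ)))) := by
  obtain ⟨A, hA⟩ := S.a_bounded
  obtain ⟨V, hV⟩ := S.exists_potential_bound
  obtain ⟨B, hB, hBd⟩ := S.exists_density_bound
  have hA0 : 0 < A := lt_of_lt_of_le (abs_pos.2 (S.a_pos 0).ne') (hA 0)
  have hV0 : 0 ≤ |V| := abs_nonneg V
  set K₀ := A + A + |V| with hK₀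
  have hK₀0 : 0 < K₀ := by positivity
  refine ⟨2 * K₀, by positivity, 1 / (3200 * (8 * B * (2 * A + 1) + 3) ^ 2), by positivity, B, hB,
    fun p q hpq D hD hD1 hDd L hpL hqL f hf hfle => ?_⟩
  obtain ⟨p', hp'⟩ : ∃ p' : ℕ, p = -L + p' := ⟨(p + L).toNat, by omega⟩
  obtain ⟨q', hq'⟩ : ∃ q' : ℕ, q = -L + (q' + 1 : ℕ) := ⟨(q + L - 1).toNat, by omega⟩
  -- The strict bound on |q| leaves a site of the window to the right of q, as `siteValue` requires.
  obtain ⟨r', hr'⟩ : ∃ r' : ℕ, 2 * L = q' + r' + 2 := ⟨2 * L - q' - 2, by omega⟩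
  have hpw : (windowIndex L p : ℕ) = p' := by simp only [windowIndex]; omega
  have hqw : (windowIndex L q : ℕ) = q' + 1 := by simp only [windowIndex]; omega
  have hple : p' ≤ q' := by omega
  set α := shiftSeq L S.a with hα
  set ρ := S.windowDensity L with hρdef
  have hα0 : ∀ n, 0 < α n := fun n => S.a_pos _
  have hαA : ∀ n, |α n| ≤ A := fun n => hA _
  have hρ : ∀ n, Measurable (ρ n) := fun n => S.measurable_siteDensity _
  have h1 : ∀ n, ∫⁻ x, ρ n x = 1 := fun n => S.lintegral_siteDensity _
  have hdens : S.siteDensity q = ρ (q' + 1) := by rw [hρdef, windowDensity, ← hq']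
  set b : S.Config → ℕ → ℝ := fun ω => shiftSeq L (S.potential ω) with hb
  have hbm : Measurable b := (measurable_shiftSeq L).comp S.measurable_potential
  have hbn : ∀ n, Measurable fun z : S.Config × ℝ => b z.1 n := fun n =>
    (measurable_pi_apply n).comp (hbm.comp measurable_fst)
  have hbV : ∀ ω n, |b ω n| ≤ |V| := fun ω n => (hV _ _ (ω _).2).trans (le_abs_self V)
  set X : ℝ≥0∞ := ENNReal.ofReal (Real.sqrt (B / S.d p * (B / S.d q) * Real.exp
    (-(1 / (3200 * (8 * B * (2 * A + 1) + 3) ^ 2)) * D ^ 2 * ((q - p - 1).toNat / 2 : ℕ)))) with hX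
  have hchain : ∀ E s w, transferChain α ρ E (q' + 1) (q' - p' + 1) s w ≤ X := fun E s w => by
    have e : (q - p - 1).toNat = q' - p' := by omega
    rw [hX, e]
    refine transferChain_succ_le_ofReal_sqrt hα0 (fun n => (le_abs_self _).trans (hαA n)) hρ h1
      hB hD hD1 (S.d_pos p) (S.d_pos q) E (q' + 1) s w (q' - p') (fun x => ?_) (fun x => ?_)
      fun j hj x => ?_
    · rw [← hdens]; exact hBd q x
    · have e2 : q' + 1 - 1 - (q' - p') = p' := by omega
      rw [e2, hρdef, windowDensity, ← hp']
      exact hBd p x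
    · refine (hBd _ x).trans (ENNReal.ofReal_le_ofReal ?_)
      have := hDd (-L + (q' + 1 - 1 - j : ℕ)) (by omega) (by omega)
      gcongr
  -- Working with a measurable minorant f avoids measurability of the correlator, whose eigenvectors
  -- are chosen without regard to the potential. Resample site q, average spectrally, exchange the
  -- integrals, then integrate the sites q - 1, …, p at fixed energy.
  calc ∫⁻ ω, f (b ω) ∂S.configMeasure
      = ∫⁻ ω, (∫⁻ x, ρ (q' + 1) x * f (Function.update (b ω) (q' + 1) x)) ∂S.configMeasure := by
        rw [hb, S.lintegral_configMeasure_update q (F := fun b => f (shiftSeq L b))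
          (hf.comp (measurable_shiftSeq L)), hdens]
        simp_rw [hq', shiftSeq_update]
    _ ≤ ∫⁻ ω, (∫⁻ E in Set.Icc (-K₀) K₀, ρ (q' + 1) (siteValue α (b ω) q' r' E)
          * ENNReal.ofReal |jacobiSol α (b ω) E p' / jacobiSol α (b ω) E (q' + 1)|)
            ∂S.configMeasure := by
        refine lintegral_mono fun ω => ?_
        have h := lintegral_eigenCorrelator_le_of_eq (fun n => (hα0 n).ne') (b ω) hr' hqw
          (p := windowIndex L p) (by omega) (hρ (q' + 1)) (K := K₀) fun v hv k => by
            refine abs_jacobiEigenvalue_le hαA (fun n => ?_) k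
            by_cases hn : n = q' + 1
            · rw [hn, Function.update_self]
              have : v ∈ S.siteInterval q := by
                by_contra hcon
                exact hv (by rw [← hdens]; exact S.siteDensity_eq_zero hcon)
              exact (hV q v this).trans (le_abs_self V)
            · rw [Function.update_of_ne hn]; exact hbV ω n
        rw [hpw] at h
        refine le_trans (lintegral_mono fun x => ?_) h
        exact mul_le_mul_right (hfle _) _
    _ = ∫⁻ ω, (∫⁻ E in Set.Icc (-K₀) K₀, chainIntegrand α ρ E p' q' r' 0 (b ω))
          ∂S.configMeasure := by
        refine lintegral_congr fun ω => lintegral_congr_ae (ae_restrict_of_ae ?_)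
        exact chainIntegrand_zero_eq_ae hα0 ρ (b ω) r' (by omega)
    _ = ∫⁻ E in Set.Icc (-K₀) K₀, (∫⁻ ω, chainIntegrand α ρ E p' q' r' 0 (b ω)
          ∂S.configMeasure) := by
        refine lintegral_lintegral_swap (Measurable.aemeasurable ?_)
        simp only [chainIntegrand, transferChain]
        exact (measurable_prod_riccati α hbn measurable_snd _).mul
          ((hρ _).comp ((measurable_rightShift α hbn measurable_snd q' r').add
            (measurable_riccatiShift α hbn measurable_snd _)))
    _ ≤ ∫⁻ _ in Set.Icc (-K₀) K₀, X := by
        refine lintegral_mono fun E => ?_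
        simp only
        -- After q' - p' + 1 integrations the product is empty and only the kernel remains, which is
        -- bounded uniformly in the energy and the remaining sites.
        rw [S.lintegral_chainIntegrand_zero_eq L E r' (k := q' - p' + 1) (by omega)]
        calc _ ≤ ∫⁻ _, X ∂S.configMeasure := lintegral_mono fun ω => by
              rw [chainIntegrand, Finset.Ico_eq_empty (by omega), Finset.prod_empty, one_mul]
              exact hchain _ _ _
          _ = X := by rw [lintegral_const, measure_univ, mul_one]
    _ = _ := by
        rw [setLIntegral_const, Real.volume_Icc, mul_comm, hX, ← ENNReal.ofReal_mul (by linarith)]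
        congr 2
        ring

end RandomJacobi

end TruncatedBound

/-! ### The maximal amplitude: measurability and the infinite-volume limit -/

section MaxAmplitude

open Filter Topology

namespace RandomJacobi

variable (S : RandomJacobi)

/-- The amplitude `⟨δ_m, e^{-itJ_ω} δ_n⟩`. -/
def amplitude (m n : ℤ) (ω : S.Config) (t : ℝ) : ℂ :=
  ⟪basisVec m, S.propagator ω t (basisVec n)⟫_ℂ

/-- The amplitude of the operator truncated to the window `-L, …, L`, as a function of the
potential. -/
def truncatedAmplitude (m n : ℤ) (L : ℕ) (β : ℕ → ℝ) (t : ℝ) : ℂ :=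
  jacobiAmplitude (2 * L) (shiftSeq L S.a) β (windowIndex L m) (windowIndex L n) t

theorem tendsto_truncatedAmplitude (m n : ℤ) (ω : S.Config) (t : ℝ) :
    Tendsto (fun L => S.truncatedAmplitude m n L (shiftSeq L (S.potential ω)) t) atTop
      (𝓝 (S.amplitude m n ω t)) :=
  tendsto_jacobiAmplitude S.a (S.potential ω) S.a_bounded (S.potential_bounded ω) m n t

theorem norm_amplitude_le_one (m n : ℤ) (ω : S.Config) (t : ℝ) : ‖S.amplitude m n ω t‖ ≤ 1 :=
  le_of_tendsto (S.tendsto_truncatedAmplitude m n ω t).norm (Eventually.of_forall fun _ =>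
    (norm_jacobiAmplitude_le _ _ _ _ _ _).trans (eigenCorrelator_le_one _ _ _ _ _))

theorem measurable_amplitude (m n : ℤ) (t : ℝ) : Measurable fun ω => S.amplitude m n ω t :=
  measurable_of_tendsto_metrizable
    (fun L => (measurable_jacobiAmplitude _ _ _ _ t).comp
      ((measurable_shiftSeq L).comp S.measurable_potential))
    (tendsto_pi_nhds.2 fun ω => S.tendsto_truncatedAmplitude m n ω t)

theorem continuous_amplitude (m n : ℤ) (ω : S.Config) : Continuous (S.amplitude m n ω) := by
  let : NormedAlgebra ℚ (EllTwo →L[ℂ] EllTwo) := NormedAlgebra.restrictScalars ℚ ℂ _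
  have h1 : Continuous fun t : ℝ => NormedSpace.exp ((-(Complex.I * (t : ℂ))) • S.operator ω) :=
    NormedSpace.exp_continuous.comp (by fun_prop)
  have h2 : Continuous fun t : ℝ => S.propagator ω t (basisVec n) := h1.clm_apply continuous_const
  exact Continuous.inner continuous_const h2

theorem maxAmplitude_nonneg (m n : ℤ) (ω : S.Config) : 0 ≤ S.maxAmplitude m n ω :=
  Real.iSup_nonneg fun _ => norm_nonneg _

theorem maxAmplitude_le_one (m n : ℤ) (ω : S.Config) : S.maxAmplitude m n ω ≤ 1 :=
  ciSup_le fun t => S.norm_amplitude_le_one m n ω t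

/-- Continuity in time reduces the supremum to rational times; being countable, it is then
measurable in ω. -/
theorem ofReal_maxAmplitude (m n : ℤ) (ω : S.Config) :
    ENNReal.ofReal (S.maxAmplitude m n ω)
      = ⨆ t : ℚ, ENNReal.ofReal ‖S.amplitude m n ω t‖ := by
  have hbdd : BddAbove (Set.range fun t : ℝ => ‖S.amplitude m n ω t‖) :=
    ⟨1, by rintro _ ⟨t, rfl⟩; exact S.norm_amplitude_le_one m n ω t⟩
  refine le_antisymm ?_ (iSup_le fun t => ENNReal.ofReal_le_ofReal (le_ciSup hbdd (t : ℝ)))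
  set M := ⨆ t : ℚ, ENNReal.ofReal ‖S.amplitude m n ω t‖ with hM
  have hM1 : M ≠ ∞ := ne_top_of_le_ne_top ENNReal.one_ne_top (iSup_le fun t =>
    ENNReal.ofReal_le_one.2 (S.norm_amplitude_le_one m n ω t))
  have hclosed : IsClosed {t : ℝ | ENNReal.ofReal ‖S.amplitude m n ω t‖ ≤ M} :=
    isClosed_le (ENNReal.continuous_ofReal.comp (S.continuous_amplitude m n ω).norm)
      continuous_const
  have hall : ∀ t : ℝ, ENNReal.ofReal ‖S.amplitude m n ω t‖ ≤ M := fun t =>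
    (Rat.isDenseEmbedding_coe_real.dense.induction_on (p := fun t : ℝ =>
      ENNReal.ofReal ‖S.amplitude m n ω t‖ ≤ M) t hclosed
      (fun t => le_iSup (fun t : ℚ => ENNReal.ofReal ‖S.amplitude m n ω t‖) t))
  rw [← ENNReal.ofReal_toReal hM1]
  refine ENNReal.ofReal_le_ofReal (ciSup_le fun t => ?_)
  exact (ENNReal.ofReal_le_iff_le_toReal hM1).1 (hall t)

theorem measurable_maxAmplitude (m n : ℤ) : Measurable (S.maxAmplitude m n) := by
  have h : S.maxAmplitude m n = fun ω =>
      (⨆ t : ℚ, ENNReal.ofReal ‖S.amplitude m n ω t‖).toReal := by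
    ext ω
    rw [← S.ofReal_maxAmplitude, ENNReal.toReal_ofReal (S.maxAmplitude_nonneg m n ω)]
  rw [h]
  exact (Measurable.iSup fun t : ℚ =>
    (S.measurable_amplitude m n t).norm.ennreal_ofReal).ennreal_toReal

theorem integrable_maxAmplitude (m n : ℤ) : Integrable (S.maxAmplitude m n) S.configMeasure :=
  Integrable.of_bound (S.measurable_maxAmplitude m n).aestronglyMeasurable 1
    (Eventually.of_forall fun ω => by
      rw [Real.norm_of_nonneg (S.maxAmplitude_nonneg m n ω)]
      exact S.maxAmplitude_le_one m n ω)

/-- A bound for the truncated maximal amplitudes passes to the limit. -/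
theorem integral_maxAmplitude_le (m n : ℤ) {R : ℝ} (hR : 0 ≤ R)
    (h : ∀ᶠ L : ℕ in atTop, ∫⁻ ω, (⨆ t : ℚ, ENNReal.ofReal
      ‖S.truncatedAmplitude m n L (shiftSeq L (S.potential ω)) t‖) ∂S.configMeasure
        ≤ ENNReal.ofReal R) :
    ∫ ω, S.maxAmplitude m n ω ∂S.configMeasure ≤ R := by
  have hm : ∀ L, Measurable fun ω => ⨆ t : ℚ, ENNReal.ofReal
      ‖S.truncatedAmplitude m n L (shiftSeq L (S.potential ω)) t‖ := fun L =>
    Measurable.iSup fun t : ℚ => ((measurable_jacobiAmplitude _ _ _ _ t).comp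
      ((measurable_shiftSeq L).comp S.measurable_potential)).norm.ennreal_ofReal
  rw [integral_eq_lintegral_of_nonneg_ae
    (Eventually.of_forall fun ω => S.maxAmplitude_nonneg m n ω)
    (S.measurable_maxAmplitude m n).aestronglyMeasurable]
  refine ENNReal.toReal_le_of_le_ofReal hR ?_
  calc ∫⁻ ω, ENNReal.ofReal (S.maxAmplitude m n ω) ∂S.configMeasure
      -- A supremum over t of limits in L is at most the lower limit of the suprema; Fatou follows.
      ≤ ∫⁻ ω, liminf (fun L : ℕ => ⨆ t : ℚ, ENNReal.ofReal
          ‖S.truncatedAmplitude m n L (shiftSeq L (S.potential ω)) t‖) atTop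
            ∂S.configMeasure := by
        refine lintegral_mono fun ω => ?_
        rw [S.ofReal_maxAmplitude]
        refine iSup_le fun t => ?_
        have ht := (ENNReal.continuous_ofReal.tendsto _).comp
          (S.tendsto_truncatedAmplitude m n ω t).norm
        rw [← ht.liminf_eq]
        exact liminf_le_liminf (Eventually.of_forall fun L => le_iSup (fun t : ℚ =>
          ENNReal.ofReal ‖S.truncatedAmplitude m n L (shiftSeq L (S.potential ω)) t‖) t)
    _ ≤ liminf (fun L : ℕ => ∫⁻ ω, (⨆ t : ℚ, ENNReal.ofReal
          ‖S.truncatedAmplitude m n L (shiftSeq L (S.potential ω)) t‖) ∂S.configMeasure) atTop :=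
        lintegral_liminf_le hm
    _ ≤ ENNReal.ofReal R := by
        refine liminf_le_of_le (by isBoundedDefault) fun b hb => ?_
        obtain ⟨L, hL1, hL2⟩ := (hb.and h).exists
        exact hL1.trans hL2

/-- The chain runs leftwards from q to p, so p < q is needed; symmetry of the correlator covers both
orders of the amplitude. -/
theorem exists_integral_maxAmplitude_le :
    ∃ K > 0, ∃ ε > 0, ∃ B > 0, ∀ p q : ℤ, p < q → ∀ D : ℝ, 0 < D → D ≤ 1 →
      (∀ n, p < n → n < q → D ≤ S.d n) → ∀ m n : ℤ, (m = p ∧ n = q ∨ m = q ∧ n = p) →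
      ∫ ω, S.maxAmplitude m n ω ∂S.configMeasure
        ≤ K * Real.sqrt (B / S.d p * (B / S.d q)
            * Real.exp (-ε * D ^ 2 * ((q - p - 1).toNat / 2 : ℕ))) := by
  obtain ⟨K, hK, ε, hε, B, hB, h⟩ := S.exists_lintegral_truncated_le
  refine ⟨K, hK, ε, hε, B, hB, fun p q hpq D hD hD1 hDd m n hmn => ?_⟩
  refine S.integral_maxAmplitude_le m n (by positivity) ?_
  filter_upwards [eventually_gt_atTop p.natAbs, eventually_gt_atTop q.natAbs] with L hL hL'
  refine h p q hpq D hD hD1 hDd L hL hL' (fun β => ⨆ t : ℚ, ENNReal.ofReal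
    ‖S.truncatedAmplitude m n L β t‖) (Measurable.iSup fun t : ℚ =>
      (measurable_jacobiAmplitude _ _ _ _ t).norm.ennreal_ofReal) fun β => iSup_le fun t =>
      ENNReal.ofReal_le_ofReal ((norm_jacobiAmplitude_le _ _ _ _ _ _).trans (le_of_eq ?_))
  rcases hmn with ⟨rfl, rfl⟩ | ⟨rfl, rfl⟩
  · rfl
  · exact eigenCorrelator_comm _ _ _ _ _

end RandomJacobi

/-- Power-law lower bounds on a sequence bounded by one force a nonnegative exponent. -/
theorem nonneg_of_forall_mul_rpow_neg_le_one {ζ C : ℝ} (hC : 0 < C)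
    (h : ∀ n : ℕ, n ≠ 0 → C * (n : ℝ) ^ (-ζ) ≤ 1) : 0 ≤ ζ := by
  by_contra! hζ
  have ht : Tendsto (fun n : ℕ => C * (n : ℝ) ^ (-ζ)) atTop atTop :=
    ((tendsto_rpow_atTop (neg_pos.2 hζ)).comp tendsto_natCast_atTop_atTop).const_mul_atTop hC
  obtain ⟨n, hn, hn0⟩ := ((ht.eventually_gt_atTop 1).and (eventually_ne_atTop 0)).exists
  exact absurd (h n hn0) (not_le.2 hn)

/-- The exponent under the root is at most -(εC²/2) x^(1-2ζ) + εC² x^(-2ζ), and x^(-2ζ) ≤ 1 makes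
the second term a constant. The root halves both, and 1/dm ≤ x^ζ/C supplies x^(ζ/2). -/
theorem sqrt_decay_le {B C d₀ dm ζ ε x : ℝ} {j : ℕ} (hB : 0 < B) (hC : 0 < C) (hd₀ : 0 < d₀)
    (hdm : C * x ^ (-ζ) ≤ dm) (hζ : 0 ≤ ζ) (hε : 0 < ε) (hx : 1 ≤ x) (hj : (x - 2) / 2 ≤ j) :
    Real.sqrt (B / d₀ * (B / dm) * Real.exp (-ε * (C * x ^ (-ζ)) ^ 2 * j))
      ≤ Real.sqrt (B / d₀ * (B / C)) * Real.exp (ε * C ^ 2 / 2) * x ^ (ζ / 2)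
        * Real.exp (-(ε * C ^ 2 / 4) * x ^ (1 - 2 * ζ)) := by
  have hx0 : 0 < x := by linarith
  have hp : 0 < x ^ (-ζ) := Real.rpow_pos_of_pos hx0 _
  have hp1 : (x ^ (-ζ)) ^ 2 ≤ 1 := by
    have : x ^ (-ζ) ≤ 1 := Real.rpow_le_one_of_one_le_of_nonpos hx (by linarith)
    nlinarith
  have hpx : (x ^ (-ζ)) ^ 2 * x = x ^ (1 - 2 * ζ) := by
    rw [← Real.rpow_natCast, ← Real.rpow_mul hx0.le, ← Real.rpow_add_one hx0.ne']
    congr 1; push_cast; ring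
  have hinv : 1 / x ^ (-ζ) = x ^ ζ := by rw [Real.rpow_neg hx0.le]; simp
  have hh : (x ^ (ζ / 2)) ^ 2 = x ^ ζ := by
    rw [← Real.rpow_natCast, ← Real.rpow_mul hx0.le]
    congr 1; push_cast; ring
  rw [Real.sqrt_le_left (by positivity)]
  have e1 : B / dm ≤ B / C * x ^ ζ := by
    rw [← hinv, div_mul_div_comm, mul_one]
    gcongr
  have e2 : Real.exp (-ε * (C * x ^ (-ζ)) ^ 2 * j)
      ≤ (Real.exp (ε * C ^ 2 / 2) * Real.exp (-(ε * C ^ 2 / 4) * x ^ (1 - 2 * ζ))) ^ 2 := by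
    rw [← Real.exp_add, ← Real.exp_nat_mul]
    refine Real.exp_le_exp.2 ?_
    rw [← hpx]
    have h1 : ε * C ^ 2 * (x ^ (-ζ)) ^ 2 * ((x - 2) / 2) ≤ ε * C ^ 2 * (x ^ (-ζ)) ^ 2 * j := by
      gcongr
    have h2 : ε * C ^ 2 * (x ^ (-ζ)) ^ 2 ≤ ε * C ^ 2 * 1 := by gcongr
    push_cast
    nlinarith
  calc B / d₀ * (B / dm) * Real.exp (-ε * (C * x ^ (-ζ)) ^ 2 * j)
      ≤ B / d₀ * (B / C * x ^ ζ) * (Real.exp (ε * C ^ 2 / 2)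
          * Real.exp (-(ε * C ^ 2 / 4) * x ^ (1 - 2 * ζ))) ^ 2 := by gcongr
    _ = _ := by
        rw [← hh]
        simp only [mul_pow]
        rw [Real.sq_sqrt (by positivity)]
        ring

end MaxAmplitude
end

/-! ### Power-law damping between 0 and m -/

theorem theorem2p6 (S : RandomJacobi) (ζ C : ℝ) (hζ : ζ < 1 / 2) (hC : 0 < C)
    (hd_le : ∀ n : ℤ, S.d n ≤ 1)
    (hd_ge : ∀ n : ℤ, n ≠ 0 → C * |(n : ℝ)| ^ (-ζ) ≤ S.d n) :
    ∃ C' > (0 : ℝ), ∃ γ > (0 : ℝ), ∀ m : ℤ, m ≠ 0 →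
      Integrable (S.maxAmplitude m 0) S.configMeasure ∧
        ∫ ω, S.maxAmplitude m 0 ω ∂S.configMeasure
          ≤ C' * |(m : ℝ)| ^ (ζ / 2) * Real.exp (-γ * |(m : ℝ)| ^ (1 - 2 * ζ)) := by
  -- Forced by d_n ≤ 1; it makes |n|^(-ζ) nonincreasing, so C|m|^(-ζ) bounds every d_n with 0 < |n|
  -- ≤ |m| from below.
  have hζ0 : 0 ≤ ζ := nonneg_of_forall_mul_rpow_neg_le_one hC fun n hn => by
    have h := (hd_ge n (by exact_mod_cast hn)).trans (hd_le n)
    simpa using h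
  obtain ⟨K, hK, ε, hε, B, hB, h⟩ := S.exists_integral_maxAmplitude_le
  have hd0 := S.d_pos 0
  refine ⟨K * (Real.sqrt (B / S.d 0 * (B / C)) * Real.exp (ε * C ^ 2 / 2)), by positivity,
    ε * C ^ 2 / 4, by positivity, fun m hm => ⟨S.integrable_maxAmplitude m 0, ?_⟩⟩
  set x : ℝ := |(m : ℝ)| with hx
  have hx1 : 1 ≤ x := by
    rw [hx, ← Int.cast_abs]
    exact_mod_cast Int.one_le_abs hm
  have hx0 : 0 < x := by linarith
  have hD0 : 0 < C * x ^ (-ζ) := by positivity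
  have hD1 : C * x ^ (-ζ) ≤ 1 := (hd_ge m hm).trans (hd_le m)
  have hDn : ∀ n : ℤ, n ≠ 0 → |n| ≤ |m| → C * x ^ (-ζ) ≤ S.d n := fun n hn hnm => by
    refine le_trans ?_ (hd_ge n hn)
    have h1 : |(n : ℝ)| ≤ x := by rw [hx, ← Int.cast_abs, ← Int.cast_abs]; exact_mod_cast hnm
    have h2 : 0 < |(n : ℝ)| := abs_pos.2 (by exact_mod_cast hn)
    exact mul_le_mul_of_nonneg_left
      (Real.rpow_le_rpow_of_nonpos h2 h1 (by linarith)) hC.le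
  have hxm : x = ((m.natAbs : ℕ) : ℝ) := by rw [hx, Nat.cast_natAbs, Int.cast_abs]
  -- Of the |m| - 1 sites strictly between 0 and m only complete pairs contract; rounding down costs
  -- at most one more site.
  have hj : (x - 2) / 2 ≤ (((m.natAbs - 1) / 2 : ℕ) : ℝ) := by
    have : m.natAbs ≤ 2 * ((m.natAbs - 1) / 2) + 2 := by omega
    have : (m.natAbs : ℝ) ≤ 2 * (((m.natAbs - 1) / 2 : ℕ) : ℝ) + 2 := by exact_mod_cast this
    rw [hxm]
    linarith
  have hdecay := sqrt_decay_le hB hC hd0 (hd_ge m hm) hζ0 hε hx1 hj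
  have hmain : ∫ ω, S.maxAmplitude m 0 ω ∂S.configMeasure
      ≤ K * Real.sqrt (B / S.d 0 * (B / S.d m)
        * Real.exp (-ε * (C * x ^ (-ζ)) ^ 2 * ((m.natAbs - 1) / 2 : ℕ))) := by
    rcases lt_or_gt_of_ne hm with hneg | hpos
    · have := h m 0 hneg _ hD0 hD1 (fun n h1 h2 => hDn n h2.ne (by
        rw [abs_of_neg h2, abs_of_neg hneg]; omega)) m 0 (Or.inl ⟨rfl, rfl⟩)
      rwa [show (0 - m - 1).toNat = m.natAbs - 1 by omega, mul_comm (B / S.d m)] at this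
    · have := h 0 m hpos _ hD0 hD1 (fun n h1 h2 => hDn n h1.ne' (by
        rw [abs_of_pos h1, abs_of_pos hpos]; omega)) m 0 (Or.inr ⟨rfl, rfl⟩)
      rwa [show (m - 0 - 1).toNat = m.natAbs - 1 by omega] at this
  calc _ ≤ _ := hmain
    _ ≤ K * (Real.sqrt (B / S.d 0 * (B / C)) * Real.exp (ε * C ^ 2 / 2) * x ^ (ζ / 2)
        * Real.exp (-(ε * C ^ 2 / 4) * x ^ (1 - 2 * ζ))) := by gcongr
    _ = _ := by ring
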